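/- Let $\lambda$ be an infinite cardinal, let $\kappa\le\lambda^+$ be an infinite regular cardinal, and let $\mathbb B$ be a Boolean algebra with $|\mathbb B|\le\lambda$; write $\mathrm{uf}(\mathbb B)$ for its set of ultrafilters. *Conventions.* $\mathbb L_{\Lambda,\kappa}$ is the infinitary logic with negation, conjunctions of length $<\Lambda$ and existential quantification over sets of fewer than $\kappa$ variables, every formula having fewer than $\kappa$ free variables; vocabularies are finitary, models are non-empty. $H(\mathbb L_{\Lambda,\kappa})$ is the first cardinal $\mu$ such that every sentence of $\mathbb L_{\Lambda,\kappa}$ with a model of cardinality $\ge\mu$ has models of arbitrarily large cardinality. A sentence $\psi\in\mathbb L_{\lambda^+,\kappa}[\mathbb B]$ is a sentence of $\mathbb L_{\lambda^+,\kappa}$ in a vocabulary of at most $\lambda$ symbols that contains individual constants $c_b$ ($b\in\mathbb B$), unary predicates $P,Q$ and a binary predicate $R$, all distinct. $\mathrm{Mod}^1_\psi[\mathbb B]$ is the class of models $M$ of $\psi$ such that $b\mapsto c_b^M$ is a bijection of $\mathbb B$ onto $P^M$, $R^M\subseteq P^M\times Q^M$, and $a\mapsto\{b\in\mathbb B: M\models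 c_b\,R\,a\}$ is a bijection of $Q^M$ onto $\mathrm{uf}(\mathbb B)$. $\mathrm{Mod}^2_\psi[\mathbb B]$ is the class of those $M\in\mathrm{Mod}^1_\psi[\mathbb B]$ with $\|M\|=\|M\|^{<\kappa}$, where $\mu^{<\kappa}=\sup_{\theta<\kappa}\mu^\theta$. For $\iota=1,2$ let $\mathrm{spec}^\iota_\psi[\mathbb B]=\{\|M\|:M\in\mathrm{Mod}^\iota_\psi[\mathbb B]\}$. $H(\mathbb L_{\lambda^+,\kappa}[\mathbb B])$ is the first $\mu$ such that for every $\psi\in\mathbb L_{\lambda^+,\kappa}[\mathbb B]$, if $\mathrm{spec}^2_\psi[\mathbb B]$ has an element $\ge\mu$ then it is unbounded in the class of cardinals. $H(\mathbb L^{\rm ba}_{\lambda^+,\kappa})$ is defined in the same way, with $(\mathbb B',\psi)$ ranging over all Boolean algebras $\mathbb B'$ with $|\mathbb B'|\le\lambda$ and all $\psi\in\mathbb L_{\lambda^+,\kappa}[\mathbb B']$. $\mathbb B^{\rm fr}_\lambda$ is the Boolean algebra freely generated by $\lambda$ generators. *Claim.* All these Hanf numbers exist, and: 0. Using $\mathrm{spec}^1_\psi[\mathbb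 B]$ instead of $\mathrm{spec}^2_\psi[\mathbb B]$ in the definition of $H(\mathbb L_{\lambda^+,\kappa}[\mathbb B])$ gives the same cardinal. 1. $H(\mathbb L_{\lambda^+,\kappa})\le H(\mathbb L_{\lambda^+,\kappa}[\mathbb B])\le H(\mathbb L_{\lambda^+,\kappa}[\mathbb B^{\rm fr}_\lambda])=H(\mathbb L^{\rm ba}_{\lambda^+,\kappa})<H(\mathbb L_{(2^\lambda)^+,\kappa})$. If $\kappa=\aleph_0$, then moreover $H(\mathbb L_{\lambda^+,\kappa})<\beth_{(2^\lambda)^+}<H(\mathbb L_{\lambda^+,\kappa}[\mathbb B^{\rm fr}_\lambda])$. 2. If $\mu<H(\mathbb L_{\lambda^+,\kappa}[\mathbb B])$ then $2^\mu<H(\mathbb L_{\lambda^+,\kappa}[\mathbb B])$; hence $H(\mathbb L_{\lambda^+,\kappa}[\mathbb B])$ is a strong limit cardinal. The same holds for $H(\mathbb L^{\rm ba}_{\lambda^+,\kappa})$. 3. If $\psi\in\mathbb L_{\lambda^+,\kappa}[\mathbb B]$ and $H(\mathbb L_{\lambda^+,\kappa}[\mathbb B])\le\sup\mathrm{spec}^2_\psi[\mathbb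 B]$, then $\sup\mathrm{spec}^2_\psi[\mathbb B]=\infty$ (that is, a bounded $\mathrm{spec}^2_\psi[\mathbb B]$ has supremum $<H(\mathbb L_{\lambda^+,\kappa}[\mathbb B])$). Likewise, for every Boolean algebra $\mathbb B'$ with $|\mathbb B'|\le\lambda$ and $\psi\in\mathbb L_{\lambda^+,\kappa}[\mathbb B']$, if $H(\mathbb L^{\rm ba}_{\lambda^+,\kappa})\le\sup\mathrm{spec}^2_\psi[\mathbb B']$ then $\sup\mathrm{spec}^2_\psi[\mathbb B']=\infty$. 4. For every $\psi_1\in\mathbb L_{\lambda^+,\kappa}[\mathbb B]$ there are $\psi_2,\psi_2',\psi_2''\in\mathbb L_{\lambda^+,\kappa}[\mathbb B]$ with $\mathrm{spec}^1_{\psi_2}[\mathbb B]=\{\mu:\mu=\mu^{<\kappa}\in\mathrm{spec}^1_{\psi_1}[\mathbb B]\}$, $\mathrm{spec}^1_{\psi_2'}[\mathbb B]=\{\mu^{<\kappa}:\mu\in\mathrm{spec}^1_{\psi_1}[\mathbb B]\}$ and $\mathrm{spec}^1_{\psi_2''}[\mathbb B]=\{\mu:\mu\ge\lambda\text{ and }\mu\in\mathrm{spec}^1_{\psi_1}[\mathbb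 B]\}$. -/

import Mathlib

open Cardinal

universe u

namespace HanfBA

/-! ### The infinitary logics -/

/-- The variables `x_i`, `i < κ`. -/
abbrev Var (κ : Cardinal.{u}) : Type u := κ.ord.ToType

/-- Formulas of the infinitary logic with conjunctions of length `γ < Λ` and with quantification
`∃ x_[u]` over sets `u` of fewer than `κ` variables. The elements of `Λ.ord.ToType` are the
ordinals `γ < Λ`, and `Set.Iio γ` is the set of ordinals `α < γ`. -/
inductive InfFormula (Λ κ : Cardinal.{u}) (L : FirstOrder.Language.{u, u}) : Type u
  | equal (t₁ t₂ : L.Term (Var κ)) : InfFormula Λ κ L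
  | rel {n : ℕ} (R : L.Relations n) (ts : Fin n → L.Term (Var κ)) : InfFormula Λ κ L
  | neg (φ : InfFormula Λ κ L) : InfFormula Λ κ L
  | conj (γ : Λ.ord.ToType) (φ : Set.Iio γ → InfFormula Λ κ L) : InfFormula Λ κ L
  | ex (s : Set (Var κ)) (hs : #s < κ) (φ : InfFormula Λ κ L) : InfFormula Λ κ L

namespace InfFormula

variable {Λ κ : Cardinal.{u}} {L : FirstOrder.Language.{u, u}}

open Classical in
/-- The set of free variables of a formula. -/
noncomputable def freeVars : InfFormula Λ κ L → Set (Var κ)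
  | equal t₁ t₂ => (t₁.varFinset : Set (Var κ)) ∪ (t₂.varFinset : Set (Var κ))
  | rel _ ts => ⋃ i, ((ts i).varFinset : Set (Var κ))
  | neg φ => φ.freeVars
  | conj _ φ => ⋃ i, (φ i).freeVars
  | ex s _ φ => φ.freeVars \ s

/-- The formula and all its subformulas have fewer than `κ` free variables. -/
def FewVars : InfFormula Λ κ L → Prop
  | equal t₁ t₂ => #(equal t₁ t₂ : InfFormula Λ κ L).freeVars < κ
  | rel R ts => #(rel R ts : InfFormula Λ κ L).freeVars < κ
  | neg φ => #(neg φ).freeVars < κ ∧ φ.FewVars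
  | conj γ φ => #(conj γ φ).freeVars < κ ∧ ∀ i, (φ i).FewVars
  | ex s hs φ => #(ex s hs φ).freeVars < κ ∧ φ.FewVars

/-- For infinite `κ`, subformulas of a formula with fewer than `κ` free variables have fewer than
`κ` free variables; so the restriction on free variables is automatic for sentences. -/
theorem fewVars_of_card_freeVars_lt (hκ : ℵ₀ ≤ κ) (φ : InfFormula Λ κ L)
    (h : #φ.freeVars < κ) : φ.FewVars := by
  induction φ with
  | equal t₁ t₂ => exact h
  | rel R ts => exact h
  | neg φ ih => exact ⟨h, ih h⟩
  | conj γ φ ih =>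
    refine ⟨h, fun i => ih i (lt_of_le_of_lt (mk_le_mk_of_subset ?_) h)⟩
    exact Set.subset_iUnion (fun i => (φ i).freeVars) i
  | ex s hs φ ih =>
    refine ⟨h, ih (lt_of_le_of_lt ((mk_le_mk_of_subset ?_).trans (mk_union_le _ _))
      (add_lt_of_lt hκ h hs))⟩
    intro x hx
    by_cases hxs : x ∈ s
    · exact Or.inr hxs
    · exact Or.inl ⟨hx, hxs⟩

/-- Satisfaction of a formula under an assignment of the variables. -/
def Realize {M : Type u} [L.Structure M] : InfFormula Λ κ L → (Var κ → M) → Prop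
  | equal t₁ t₂, v => t₁.realize v = t₂.realize v
  | rel R ts, v => FirstOrder.Language.Structure.RelMap R fun i => (ts i).realize v
  | neg φ, v => ¬ φ.Realize v
  | conj _ φ, v => ∀ i, (φ i).Realize v
  | ex s _ φ, v => ∃ w : Var κ → M, (∀ x, x ∉ s → w x = v x) ∧ φ.Realize w

end InfFormula

/-- The sentences of `𝕃_{Λ,κ}` in the vocabulary `L`. -/
def InfSentence (Λ κ : Cardinal.{u}) (L : FirstOrder.Language.{u, u}) : Type u :=
  {φ : InfFormula Λ κ L // φ.freeVars = ∅}

/-- `M` is a (non-empty) model of the sentence `ψ`. -/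
def IsModel {Λ κ : Cardinal.{u}} {L : FirstOrder.Language.{u, u}} (M : Type u) [L.Structure M]
    (ψ : InfSentence Λ κ L) : Prop :=
  Nonempty M ∧ ∀ v : Var κ → M, ψ.1.Realize v

/-- The cardinalities of the models of a sentence. -/
def spec {Λ κ : Cardinal.{u}} {L : FirstOrder.Language.{u, u}} (ψ : InfSentence Λ κ L) :
    Set Cardinal.{u} :=
  {μ | ∃ (M : Type u) (_ : L.Structure M), IsModel M ψ ∧ #M = μ}

/-! ### Hanf numbers -/

/-- `μ` is a Hanf bound for a class of spectra: every spectrum in the class that has an element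
`≥ μ` is unbounded in the cardinals. -/
def IsHanfBound (𝒮 : Set (Set Cardinal.{u})) (μ : Cardinal.{u}) : Prop :=
  ∀ S ∈ 𝒮, (∃ χ ∈ S, μ ≤ χ) → ¬ BddAbove S

/-- The first Hanf bound. -/
noncomputable def hanf (𝒮 : Set (Set Cardinal.{u})) : Cardinal.{u} :=
  sInf {μ | IsHanfBound 𝒮 μ}

/-- The spectra of the sentences of `𝕃_{Λ,κ}`, in arbitrary vocabularies. -/
def infSpectra (Λ κ : Cardinal.{u}) : Set (Set Cardinal.{u}) :=
  {S | ∃ (L : FirstOrder.Language.{u, u}) (ψ : InfSentence Λ κ L), S = spec ψ}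

/-! ### The logics with a Boolean algebra -/

/-- The set `U` is an ultrafilter of the Boolean algebra `B`. -/
structure IsUltra {B : Type u} [BooleanAlgebra B] (U : Set B) : Prop where
  top_mem : ⊤ ∈ U
  bot_notMem : ⊥ ∉ U
  mem_of_le : ∀ a ∈ U, ∀ b, a ≤ b → b ∈ U
  inf_mem : ∀ a ∈ U, ∀ b ∈ U, a ⊓ b ∈ U
  mem_or_compl_mem : ∀ a, a ∈ U ∨ aᶜ ∈ U

/-- The individual constants `c_b`, `b ∈ B`. -/
inductive BAFunc (B : Type u) : ℕ → Type u
  | c (b : B) : BAFunc B 0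

/-- The unary predicates `P`, `Q` and the binary predicate `R`. -/
inductive BARel : ℕ → Type
  | P : BARel 1
  | Q : BARel 1
  | R : BARel 2

/-- The vocabulary `{c_b : b ∈ B} ∪ {P, Q, R}`. -/
def baLang (B : Type u) : FirstOrder.Language.{u, 0} := ⟨BAFunc B, BARel⟩

/-- The vocabulary `{c_b : b ∈ B} ∪ {P, Q, R}` together with the additional symbols of `L`. -/
abbrev voc (B : Type u) (L : FirstOrder.Language.{u, u}) : FirstOrder.Language.{u, u} := (baLang B).sum L

section Interpretation

variable {B : Type u} (L : FirstOrder.Language.{u, u}) {M : Type u} [(voc B L).Structure M]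

/-- The interpretation of `c_b`. -/
def cM (b : B) : M := FirstOrder.Language.Structure.funMap (L := voc B L) (n := 0) (Sum.inl (BAFunc.c b)) ![]

variable (B)

/-- The interpretation of `P`. -/
def PM (x : M) : Prop := FirstOrder.Language.Structure.RelMap (L := voc B L) (n := 1) (Sum.inl BARel.P) ![x]

/-- The interpretation of `Q`. -/
def QM (x : M) : Prop := FirstOrder.Language.Structure.RelMap (L := voc B L) (n := 1) (Sum.inl BARel.Q) ![x]

/-- The interpretation of `R`. -/
def RM (x y : M) : Prop := FirstOrder.Language.Structure.RelMap (L := voc B L) (n := 2) (Sum.inl BARel.R) ![x, y]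

/-- `uf^M(a)`, the set of all `b ∈ B` with `c_b R a`. -/
def ufM (a : M) : Set B := {b | RM B L (cM L b) a}

end Interpretation

/-- The structure `M` represents `B` and the set of all its ultrafilters. -/
structure IsBAStructure (B : Type u) [BooleanAlgebra B] (L : FirstOrder.Language.{u, u}) (M : Type u)
    [(voc B L).Structure M] : Prop where
  P_eq : {x : M | PM B L x} = Set.range (cM L : B → M)
  c_injective : Function.Injective (cM L : B → M)
  R_sub : ∀ x y : M, RM B L x y → PM B L x ∧ QM B L y
  isUltra : ∀ a : M, QM B L a → IsUltra (ufM B L a)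
  uf_injOn : Set.InjOn (ufM B L) {a : M | QM B L a}
  exists_unique : ∀ U : Set B, IsUltra U → ∃! a : M, QM B L a ∧ ufM B L a = U

/-- The sentences of `𝕃_{λ⁺,κ}[B]`: a vocabulary with at most `λ` symbols in addition to `c_b`
(`b ∈ B`), `P`, `Q`, `R`, and a sentence of `𝕃_{λ⁺,κ}` in the vocabulary `voc B L`. -/
structure BASentence (lam κ : Cardinal.{u}) (B : Type u) : Type (u + 1) where
  L : FirstOrder.Language.{u, u}
  card_le : L.card ≤ lam
  sentence : InfSentence (Order.succ lam) κ (voc B L)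

section Spectra

variable {lam κ : Cardinal.{u}} {B : Type u} [BooleanAlgebra B]

/-- `spec¹_ψ[B]`: the cardinalities of the members of `Mod¹_ψ[B]`, that is, of the models of `ψ`
that represent `B` and the set of all its ultrafilters. -/
def spec1 (ψ : BASentence lam κ B) : Set Cardinal.{u} :=
  {μ | ∃ (M : Type u) (_ : (voc B ψ.L).Structure M),
    IsModel M ψ.sentence ∧ IsBAStructure B ψ.L M ∧ #M = μ}

/-- `spec²_ψ[B]`: the cardinalities of the members of `Mod²_ψ[B]`, that is, of the members `M` of
`Mod¹_ψ[B]` with `‖M‖ = ‖M‖^{<κ}`. -/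
def spec2 (ψ : BASentence lam κ B) : Set Cardinal.{u} :=
  {μ | ∃ (M : Type u) (_ : (voc B ψ.L).Structure M),
    IsModel M ψ.sentence ∧ IsBAStructure B ψ.L M ∧ #M = #M ^< κ ∧ #M = μ}

end Spectra

/-- The class of all `spec¹_ψ[B]`, `ψ ∈ 𝕃_{λ⁺,κ}[B]`. -/
def baSpectra1 (lam κ : Cardinal.{u}) (B : Type u) [BooleanAlgebra B] :
    Set (Set Cardinal.{u}) :=
  {S | ∃ ψ : BASentence lam κ B, S = spec1 ψ}

/-- The class of all `spec²_ψ[B]`, `ψ ∈ 𝕃_{λ⁺,κ}[B]`. -/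
def baSpectra2 (lam κ : Cardinal.{u}) (B : Type u) [BooleanAlgebra B] :
    Set (Set Cardinal.{u}) :=
  {S | ∃ ψ : BASentence lam κ B, S = spec2 ψ}

/-- The class of all `spec²_ψ[B]`, `ψ ∈ 𝕃_{λ⁺,κ}[B]`, where `B` runs over all Boolean algebras of
cardinality at most `λ`. -/
def allBASpectra (lam κ : Cardinal.{u}) : Set (Set Cardinal.{u}) :=
  {S | ∃ (B : Type u) (_ : BooleanAlgebra B), #B ≤ lam ∧ ∃ ψ : BASentence lam κ B, S = spec2 ψ}

/-- `H(𝕃_{Λ,κ})`. -/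
noncomputable def hanfInf (Λ κ : Cardinal.{u}) : Cardinal.{u} := hanf (infSpectra Λ κ)

/-- `H(𝕃_{λ⁺,κ}[B])`. -/
noncomputable def hanfB (lam κ : Cardinal.{u}) (B : Type u) [BooleanAlgebra B] : Cardinal.{u} :=
  hanf (baSpectra2 lam κ B)

/-- `H(𝕃^ba_{λ⁺,κ})`. -/
noncomputable def hanfBa (lam κ : Cardinal.{u}) : Cardinal.{u} := hanf (allBASpectra lam κ)

/-! ### The free Boolean algebra -/

/-- The Boolean algebra freely generated by `λ` generators, as the field of sets of subsets of an
index set `λ.out` of cardinality `λ` that is generated by the sets `{X | i ∈ X}`. -/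
abbrev FreeBA (lam : Cardinal.{u}) : Type u :=
  BooleanSubalgebra.closure (Set.range fun i : lam.out => {X : Set lam.out | i ∈ X})

/-- The free generators. -/
def FreeBA.gen (lam : Cardinal.{u}) (i : lam.out) : FreeBA lam :=
  ⟨{X | i ∈ X}, BooleanSubalgebra.subset_closure ⟨i, rfl⟩⟩

/-- Every map of the generators into a Boolean algebra extends to a unique homomorphism. -/
theorem FreeBA.existsUnique_lift (lam : Cardinal.{u}) {C : Type u} [BooleanAlgebra C]
    (f : lam.out → C) :
    ∃! g : BoundedLatticeHom (FreeBA lam) C, ∀ i, g (FreeBA.gen lam i) = f i := by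
  classical
  let G : BooleanSubalgebra (Set (Set lam.out) × C) :=
    BooleanSubalgebra.closure (Set.range fun i : lam.out => ({X | i ∈ X}, f i))
  have sep : ∀ s c, (s, c) ∈ G → s = ∅ → c = ⊥ := by
    intro s c hG hs
    by_contra hc
    have hdisj : Disjoint ((Order.PFilter.principal c : Order.PFilter C) : Set C)
        ((⊥ : Order.Ideal C) : Set C) := by
      rw [Set.disjoint_left]
      intro x hx hx'
      have h1 : c ≤ x := hx
      have h2 : x = ⊥ := le_bot_iff.1 hx'
      exact hc (le_bot_iff.1 (h2 ▸ h1))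
    obtain ⟨J, hJ, -, hJd⟩ := DistribLattice.prime_ideal_of_disjoint_filter_ideal hdisj
    have hcJ : c ∉ J := fun h => Set.disjoint_left.1 hJd (show c ≤ c from le_rfl) h
    have key : ∀ p ∈ G, ({i | f i ∉ J} ∈ p.1 ↔ p.2 ∉ J) := by
      intro p hp
      induction hp using BooleanSubalgebra.closure_bot_sup_induction with
      | mem x hx => obtain ⟨i, rfl⟩ := hx; rfl
      | bot => simp
      | sup x hx y hy ihx ihy =>
        change (_ ∈ x.1 ∪ y.1) ↔ x.2 ⊔ y.2 ∉ J
        rw [Order.Ideal.sup_mem_iff, Set.mem_union, ihx, ihy]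
        tauto
      | compl x hx ih =>
        change (_ ∉ x.1) ↔ x.2ᶜ ∉ J
        rw [ih, not_not]
        constructor
        · intro h1 h2
          exact hJ.toIsProper.notMem_of_compl_mem h2 h1
        · intro h1
          exact (hJ.mem_or_compl_mem).resolve_right h1
    exact (key _ hG).2 hcJ |> fun h => by simp [hs] at h
  have func : ∀ s c c', (s, c) ∈ G → (s, c') ∈ G → c = c' := by
    intro s c c' h h'
    have h1 := sep _ _ (G.sdiff_mem h h') (sdiff_self (a := s))
    have h2 := sep _ _ (G.sdiff_mem h' h) (sdiff_self (a := s))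
    exact le_antisymm (sdiff_eq_bot_iff.1 h1) (sdiff_eq_bot_iff.1 h2)
  have total : ∀ s : FreeBA lam, ∃ c, (s.1, c) ∈ G := by
    rintro ⟨s, hs⟩
    induction hs using BooleanSubalgebra.closure_bot_sup_induction with
    | mem x hx => obtain ⟨i, rfl⟩ := hx; exact ⟨f i, BooleanSubalgebra.subset_closure ⟨i, rfl⟩⟩
    | bot => exact ⟨⊥, G.bot_mem⟩
    | sup x hx y hy ihx ihy =>
      obtain ⟨c, hc⟩ := ihx
      obtain ⟨d, hd⟩ := ihy
      exact ⟨c ⊔ d, G.sup_mem hc hd⟩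
    | compl x hx ih =>
      obtain ⟨c, hc⟩ := ih
      exact ⟨cᶜ, G.compl_mem hc⟩
  choose g hg using total
  let gh : BoundedLatticeHom (FreeBA lam) C :=
    { toFun := g
      map_sup' := fun a b => func _ _ _ (hg _) (G.sup_mem (hg a) (hg b))
      map_inf' := fun a b => func _ _ _ (hg _) (G.inf_mem (hg a) (hg b))
      map_top' := func _ _ _ (hg _) G.top_mem
      map_bot' := func _ _ _ (hg _) G.bot_mem }
  refine ⟨gh, fun i => func _ _ _ (hg _) (BooleanSubalgebra.subset_closure ⟨i, rfl⟩), ?_⟩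
  intro k hk
  refine DFunLike.ext _ _ ?_
  rintro ⟨s, hs⟩
  refine func s _ _ ?_ (hg ⟨s, hs⟩)
  induction hs using BooleanSubalgebra.closure_bot_sup_induction with
  | mem x hx =>
    obtain ⟨i, rfl⟩ := hx
    have := hk i
    rw [FreeBA.gen] at this
    rw [this]
    exact BooleanSubalgebra.subset_closure ⟨i, rfl⟩
  | bot => exact (map_bot k).symm ▸ G.bot_mem
  | sup x hx y hy ihx ihy =>
    have h1 : k (⟨x, hx⟩ ⊔ ⟨y, hy⟩ : FreeBA lam) = k ⟨x, hx⟩ ⊔ k ⟨y, hy⟩ :=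
      k.map_sup' (⟨x, hx⟩ : FreeBA lam) ⟨y, hy⟩
    have h2 := G.sup_mem ihx ihy
    rw [Prod.mk_sup_mk, ← h1] at h2
    exact h2
  | compl x hx ih =>
    have := map_compl' k (⟨x, hx⟩ : FreeBA lam)
    exact this.symm ▸ G.compl_mem ih

end HanfBA

/-!
Every construction with sentences rests on one device: a structure `M` that contains a family `N_x`,
`x ∈ M`, of structures for another vocabulary (`auxLang`). Satisfaction of a formula in `N_x` can be
written down in `M` by relativizing quantifiers (`Definable.parRealize`). If `M` represents a
Boolean algebra `B` together with all its ultrafilters, and `C` is a quotient of `B`, then `M` can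
also express that `N_x` represents `C` together with *all* its ultrafilters: these are the
ultrafilters of `B` that are saturated for the quotient map, so that it suffices to quantify over
`Q` (`parFull_iff`). This is what makes the logics with a Boolean algebra as flexible as ordinary
infinitary logic, although the class of ultrafilters is not definable by short conjunctions.

*Spectra.* With `N_x = M` for all `x`, a spectrum can be restricted to `μ ≥ λ`, or to `μ = μ ^< κ`
by adding codes for short sequences. With a proper part `N` of `M`, in terms of whose short
sequences the elements of `M` are named, one gets `{μ ^< κ : μ ∈ spec}`; regularity of `κ` enters
through `(μ ^< κ) ^< κ = μ ^< κ` (`powerlt_powerlt`). It follows that the two kinds of spectra have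
the same Hanf number. If the elements of `M` are determined by subsets of `N`, then `2 ^ μ` is
obtained from `μ` (`exists_baSpectra1_power`), so that the Hanf number is a strong limit. If `M` is
ordered and each initial segment lies in some `N_x`, then `|M|` is at most the supremum of the
spectrum, provided that this supremum is not attained (`exists_baSpectra1_sSup`); hence suprema of
bounded spectra are themselves bounded by, and different from, the Hanf number.

*Comparison.* A sentence about a quotient of `B`, or about no Boolean algebra at all, is simulated
by a sentence about `B` whose models are larger by at most `|B| + 2 ^ |B|`; every algebra of
cardinality at most `λ` is a quotient of the free one. Up to the names of the symbols there are at
most `2 ^ λ` sentences, and with conjunctions of length `2 ^ λ` one can list all ultrafilters; so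
the disjoint union of models of maximal cardinality, one for each sentence whose spectrum has a
greatest element, is described by one sentence of `𝕃_{(2^λ)⁺,κ}` with bounded spectrum. Its
cardinality reaches the Hanf number because the latter is a strong limit
(`exists_infSpectra_hanf_le`).

*The lower bound for `κ = ℵ₀`.* The free Boolean algebra has `2 ^ λ` ultrafilters, and a sequence of
ultrafilters can be coded by a single ultrafilter, since `λ × ℕ ≃ λ`. Hence a sentence of
`𝕃_{λ⁺,ℵ₀}` can express that a linear order whose initial segments embed into `Q` is a well-order:
all `ω`-sequences in `Q` are coded, and none of them is to be descending. Its order type is then at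
most `(2 ^ λ)⁺`, and a structure that consists of that many layers, each of which is a set of
subsets of the lower ones, may have cardinality `ℶ_δ` for `δ = (2 ^ λ)⁺`, but there is a bound on
the cardinalities (`Layered`, `beth_lt_hanf`).

*The upper bound for `κ = ℵ₀`.* This is Morley's argument. If the spectrum of a sentence of
`𝕃_{λ⁺,ℵ₀}` is unbounded below `ℶ_δ`, `δ = (2 ^ λ)⁺`, then the Erdős–Rado theorem gives, for one
length `n` after the other, large sets in models whose increasing `n`-tuples all have the same type
with respect to Skolem terms; as there are only `2 ^ λ` types, the type can be chosen independently
of the model (`exists_homogeneous`). Such a coherent family of types is realized by indiscernible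
sequences of every order type, and the Skolem terms in these form arbitrarily large models
(`exists_model_of_coherent`). Since there are at most `2 ^ λ` sentences and `δ` is regular, the
bounded spectra have a common bound below `ℶ_δ` (`hanfInf_lt_beth`).
-/

universe w w'

namespace HanfBA

/-! ### Free variables and definable conditions -/

theorem term_realize_congr {L : FirstOrder.Language.{u, u}} {α : Type w} [DecidableEq α]
    {M : Type u}
    [L.Structure M] (t : L.Term α) {v v' : α → M} (h : ∀ x ∈ t.varFinset, v x = v' x) :
    t.realize v = t.realize v' := by
  induction t with
  | var a => exact h a (by simp [FirstOrder.Language.Term.varFinset])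
  | func f ts ih =>
    refine congrArg _ (funext fun i => ih i fun x hx => h x ?_)
    simp only [FirstOrder.Language.Term.varFinset, Finset.mem_biUnion, Finset.mem_univ, true_and]
    exact ⟨i, hx⟩

theorem term_varFinset_relabel_subset {L : FirstOrder.Language.{u, u}} {α : Type w} {β : Type w'}
    [DecidableEq β] (t : L.Term α) (e : α → β) :
    ((t.relabel e).varFinset : Set β) ⊆ Set.range e := by
  induction t with
  | var a => simp [FirstOrder.Language.Term.varFinset, FirstOrder.Language.Term.relabel]
  | func f ts ih =>
    intro x hx
    simp only [FirstOrder.Language.Term.varFinset, FirstOrder.Language.Term.relabel,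
      Finset.coe_biUnion,
      Finset.coe_univ, Set.mem_univ, Set.iUnion_true, Set.mem_iUnion] at hx
    obtain ⟨i, hi⟩ := hx
    exact ih i hi

variable {Λ κ : Cardinal.{u}} {L : FirstOrder.Language.{u, u}}

/-- Satisfaction depends only on the values of the free variables. -/
theorem InfFormula.realize_congr {M : Type u} [L.Structure M] (φ : InfFormula Λ κ L) :
    ∀ {v v' : Var κ → M}, (∀ x ∈ φ.freeVars, v x = v' x) → (φ.Realize v ↔ φ.Realize v') := by
  classical
  induction φ with
  | equal t₁ t₂ =>
    intro v v' h
    simp only [Realize]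
    rw [term_realize_congr t₁ (v' := v') fun x hx => h x ?_,
      term_realize_congr t₂ (v' := v') fun x hx => h x ?_]
    · simp only [freeVars, Set.mem_union, Finset.mem_coe]
      right; convert hx
    · simp only [freeVars, Set.mem_union, Finset.mem_coe]
      left; convert hx
  | rel R ts =>
    intro v v' h
    simp only [Realize]
    rw [show (fun i => (ts i).realize v) = fun i => (ts i).realize v' from
      funext fun i => term_realize_congr (ts i) fun x hx => h x ?_]
    simp only [freeVars, Set.mem_iUnion, Finset.mem_coe]
    exact ⟨i, by convert hx⟩
  | neg φ ih => intro v v' h; exact not_congr (ih h)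
  | conj γ φ ih =>
    intro v v' h
    exact forall_congr' fun i => ih i fun x hx => h x (Set.mem_iUnion.2 ⟨i, hx⟩)
  | ex s hs φ ih =>
    have key : ∀ {v v' : Var κ → M}, (∀ x ∈ (ex s hs φ).freeVars, v x = v' x) →
        (ex s hs φ).Realize v → (ex s hs φ).Realize v' := by
      classical
      rintro v v' h ⟨w, hw, hφ⟩
      refine ⟨fun x => if x ∈ s then w x else v' x, fun x hx => by simp [hx], (ih ?_).1 hφ⟩
      intro x hx
      by_cases hxs : x ∈ s
      · simp [hxs]
      · simp only [hxs, if_false]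
        rw [hw x hxs]
        exact h x ⟨hx, hxs⟩
    exact fun {v v'} h => ⟨key h, key fun x hx => (h x hx).symm⟩

/-- A condition `F` on structures and tuples indexed by `α` is definable if it is given, for every
assignment of variables to the elements of `α` that leaves enough variables unused, by a formula of
the logic with no further free variables. -/
def Definable (Λ κ : Cardinal.{u}) (L : FirstOrder.Language.{u, u}) (α : Type w)
    (F : ∀ (M : Type u) [L.Structure M], (α → M) → Prop) : Prop :=
  ∀ e : α → Var κ, #(Set.range e) < κ → ∃ φ : InfFormula Λ κ L, φ.freeVars ⊆ Set.range e ∧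
    ∀ (M : Type u) [L.Structure M] (v : Var κ → M), φ.Realize v ↔ F M fun a => v (e a)

/-- An operation on structures that is given by a term. -/
def TermDefinable (L : FirstOrder.Language.{u, u}) (α : Type w)
    (g : ∀ (M : Type u) [L.Structure M], (α → M) → M) : Prop :=
  ∃ t : L.Term α, ∀ (M : Type u) [L.Structure M] (v : α → M), t.realize v = g M v

namespace TermDefinable

variable {α : Type w}

theorem var (a : α) : TermDefinable L α fun _ _ v => v a :=
  ⟨.var a, fun _ _ _ => rfl⟩

theorem func {n : ℕ} (f : L.Functions n) {g : Fin n → ∀ (M : Type u) [L.Structure M], (α → M) → M}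
    (h : ∀ i, TermDefinable L α (g i)) :
    TermDefinable L α fun M _ v => FirstOrder.Language.Structure.funMap f fun i => g i M v := by
  choose t ht using h
  refine ⟨.func f t, fun M _ v => ?_⟩
  simp only [FirstOrder.Language.Term.realize_func, ht]

theorem func₀ (f : L.Functions 0) :
    TermDefinable L α fun M _ _ => FirstOrder.Language.Structure.funMap f (![] : Fin 0 → M) := by
  refine ⟨.func f ![], fun M _ v => ?_⟩
  simp only [FirstOrder.Language.Term.realize_func]
  exact congrArg _ (Subsingleton.elim _ _)

theorem func₁ (f : L.Functions 1) {g : ∀ (M : Type u) [L.Structure M], (α → M) → M}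
    (h : TermDefinable L α g) :
    TermDefinable L α fun M _ v => FirstOrder.Language.Structure.funMap f ![g M v] := by
  obtain ⟨t, ht⟩ := h
  refine ⟨.func f ![t], fun M _ v => ?_⟩
  simp only [FirstOrder.Language.Term.realize_func]
  refine congrArg _ (funext fun i => ?_)
  fin_cases i; exact ht M v

end TermDefinable

/-- The set of indices of a conjunction can be any type of size less than `Λ`. -/
theorem exists_Iio_equiv {ι : Type w} (h : lift.{u} #ι < lift.{w} Λ) :
    ∃ γ : Λ.ord.ToType, Nonempty (Set.Iio γ ≃ ι) := by
  obtain ⟨c, hc⟩ : ∃ c : Cardinal.{u}, lift.{w} c = lift.{u} #ι :=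
    Cardinal.mem_range_lift_of_le h.le
  rw [← hc, lift_lt] at h
  have h1 : c.ord < Ordinal.type ((· < ·) : Λ.ord.ToType → Λ.ord.ToType → Prop) := by
    rw [Ordinal.type_toType]
    exact ord_lt_ord.2 h
  refine ⟨Ordinal.enum (· < ·) ⟨c.ord, h1⟩, ?_⟩
  have h2 : #(Set.Iio (Ordinal.enum ((· < ·) : Λ.ord.ToType → Λ.ord.ToType → Prop)
      ⟨c.ord, h1⟩)) = c := by
    have := Ordinal.typein_enum ((· < ·) : Λ.ord.ToType → Λ.ord.ToType → Prop) h1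
    have h3 := congrArg Ordinal.card this
    rw [card_ord] at h3
    exact h3
  have h4 : lift.{w} #(Set.Iio (Ordinal.enum ((· < ·) : Λ.ord.ToType → Λ.ord.ToType → Prop)
      ⟨c.ord, h1⟩)) = lift.{u} #ι := by rw [h2, hc]
  exact Cardinal.lift_mk_eq'.1 h4

namespace Definable

variable {α : Type w} {β : Type w'}

theorem congr {F G : ∀ (M : Type u) [L.Structure M], (α → M) → Prop} (hF : Definable Λ κ L α F)
    (h : ∀ (M : Type u) [L.Structure M] (v : α → M), F M v ↔ G M v) : Definable Λ κ L α G := by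
  intro e he
  obtain ⟨φ, h1, h2⟩ := hF e he
  exact ⟨φ, h1, fun M _ v => (h2 M v).trans (h M _)⟩

theorem reindex {F : ∀ (M : Type u) [L.Structure M], (α → M) → Prop} (hF : Definable Λ κ L α F)
    (f : α → β) : Definable Λ κ L β fun M _ v => F M fun a => v (f a) := by
  intro e he
  have hsub : Set.range (fun a => e (f a)) ⊆ Set.range e := by
    rintro _ ⟨a, rfl⟩; exact ⟨f a, rfl⟩
  obtain ⟨φ, h1, h2⟩ := hF (fun a => e (f a)) ((mk_le_mk_of_subset hsub).trans_lt he)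
  exact ⟨φ, h1.trans hsub, fun M _ v => h2 M v⟩

theorem not {F : ∀ (M : Type u) [L.Structure M], (α → M) → Prop} (hF : Definable Λ κ L α F) :
    Definable Λ κ L α fun M _ v => ¬ F M v := by
  intro e he
  obtain ⟨φ, h1, h2⟩ := hF e he
  exact ⟨.neg φ, h1, fun M _ v => not_congr (h2 M v)⟩

theorem conj {ι : Type w'} (hι : lift.{u} #ι < lift.{w'} Λ)
    {F : ι → ∀ (M : Type u) [L.Structure M], (α → M) → Prop} (hF : ∀ i, Definable Λ κ L α (F i)) :
    Definable Λ κ L α fun M _ v => ∀ i, F i M v := by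
  intro e he
  obtain ⟨γ, ⟨g⟩⟩ := exists_Iio_equiv hι
  choose φ h1 h2 using fun i => hF i e he
  refine ⟨.conj γ fun j => φ (g j), Set.iUnion_subset fun j => h1 _, fun M _ v => ?_⟩
  simp only [InfFormula.Realize, h2]
  exact g.forall_congr_left (p := fun j => F (g j) M _) |>.trans (by simp)

theorem disj {ι : Type w'} (hι : lift.{u} #ι < lift.{w'} Λ)
    {F : ι → ∀ (M : Type u) [L.Structure M], (α → M) → Prop} (hF : ∀ i, Definable Λ κ L α (F i)) :
    Definable Λ κ L α fun M _ v => ∃ i, F i M v :=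
  (conj hι fun i => (hF i).not).not.congr fun M _ v => by push Not; rfl

theorem const (hΛ : ℵ₀ < Λ) (p : Prop) : Definable Λ κ L α fun _ _ _ => p := by
  have hT : Definable Λ κ L α fun (M : Type u) [L.Structure M] (v : α → M) =>
      ∀ i : PEmpty.{1}, i.elim :=
    conj (by simpa using aleph0_pos.trans hΛ) fun i => i.elim
  by_cases hp : p
  · exact hT.congr fun M _ v => ⟨fun _ => hp, fun _ i => i.elim⟩
  · exact hT.not.congr fun M _ v => ⟨fun h => (h fun i => i.elim).elim, fun h => (hp h).elim⟩

theorem and (hΛ : ℵ₀ < Λ) {F G : ∀ (M : Type u) [L.Structure M], (α → M) → Prop}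
    (hF : Definable Λ κ L α F) (hG : Definable Λ κ L α G) :
    Definable Λ κ L α fun M _ v => F M v ∧ G M v := by
  have h : ∀ b : Bool, Definable Λ κ L α (fun M _ v => (bif b then F M v else G M v)) := by
    rintro (_ | _)
    · exact hG
    · exact hF
  refine (conj ?_ h).congr fun M _ v => by simp [and_comm]
  simpa using (natCast_lt_aleph0 (n := 2)).trans hΛ

theorem imp (hΛ : ℵ₀ < Λ) {F G : ∀ (M : Type u) [L.Structure M], (α → M) → Prop}
    (hF : Definable Λ κ L α F) (hG : Definable Λ κ L α G) :
    Definable Λ κ L α fun M _ v => F M v → G M v :=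
  (hF.and hΛ hG.not).not.congr fun M _ v => by tauto

theorem or (hΛ : ℵ₀ < Λ) {F G : ∀ (M : Type u) [L.Structure M], (α → M) → Prop}
    (hF : Definable Λ κ L α F) (hG : Definable Λ κ L α G) :
    Definable Λ κ L α fun M _ v => F M v ∨ G M v :=
  (hF.not.and hΛ hG.not).not.congr fun M _ v => by tauto

theorem iff (hΛ : ℵ₀ < Λ) {F G : ∀ (M : Type u) [L.Structure M], (α → M) → Prop}
    (hF : Definable Λ κ L α F) (hG : Definable Λ κ L α G) :
    Definable Λ κ L α fun M _ v => (F M v ↔ G M v) :=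
  ((hF.imp hΛ hG).and hΛ (hG.imp hΛ hF)).congr fun M _ v => by tauto

theorem eq {g h : ∀ (M : Type u) [L.Structure M], (α → M) → M}
    (hg : TermDefinable L α g) (hh : TermDefinable L α h) :
    Definable Λ κ L α fun M _ v => g M v = h M v := by
  obtain ⟨t, ht⟩ := hg
  obtain ⟨s, hs⟩ := hh
  intro e he
  refine ⟨.equal (t.relabel e) (s.relabel e), Set.union_subset ?_ ?_, fun M _ v => ?_⟩
  · classical
    convert! term_varFinset_relabel_subset t e
  · classical
    convert! term_varFinset_relabel_subset s e
  · simp only [InfFormula.Realize, FirstOrder.Language.Term.realize_relabel]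
    rw [← ht, ← hs]
    rfl

theorem rel {n : ℕ} (R : L.Relations n)
    {g : Fin n → ∀ (M : Type u) [L.Structure M], (α → M) → M}
    (h : ∀ i, TermDefinable L α (g i)) :
    Definable Λ κ L α fun M _ v => FirstOrder.Language.Structure.RelMap R fun i => g i M v := by
  choose t ht using h
  intro e he
  refine ⟨.rel R fun i => (t i).relabel e, Set.iUnion_subset fun i => ?_, fun M _ v => ?_⟩
  · classical
    convert! term_varFinset_relabel_subset (t i) e
  · simp only [InfFormula.Realize, FirstOrder.Language.Term.realize_relabel]
    simp only [← ht]
    rfl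

theorem rel₁ (R : L.Relations 1) {g : ∀ (M : Type u) [L.Structure M], (α → M) → M}
    (h : TermDefinable L α g) :
    Definable Λ κ L α fun M _ v => FirstOrder.Language.Structure.RelMap R ![g M v] := by
  refine (rel R (g := fun _ => g) fun _ => h).congr fun M _ v => ?_
  rw [show (fun _ => g M v) = ![g M v] from funext fun i => by fin_cases i; rfl]

theorem rel₂ (R : L.Relations 2) {g h : ∀ (M : Type u) [L.Structure M], (α → M) → M}
    (hg : TermDefinable L α g) (hh : TermDefinable L α h) :
    Definable Λ κ L α fun M _ v => FirstOrder.Language.Structure.RelMap R ![g M v, h M v] := by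
  refine (rel R (g := ![g, h]) fun i => ?_).congr fun M _ v => ?_
  · fin_cases i
    · exact hg
    · exact hh
  · rw [show (fun i => (![g, h] : Fin 2 → ∀ (M : Type u) [L.Structure M], (α → M) → M) i M v)
      = ![g M v, h M v] from funext fun i => by fin_cases i <;> rfl]

/-- Quantification over a tuple of fewer than `κ` elements. -/
theorem exBlock (hκ : ℵ₀ ≤ κ) (hβ : lift.{u} #β < lift.{w'} κ)
    {G : ∀ (M : Type u) [L.Structure M], (α → M) → (β → M) → Prop}
    (h : Definable Λ κ L (α ⊕ β) fun M _ v => G M (fun a => v (.inl a)) fun b => v (.inr b)) :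
    Definable Λ κ L α fun M _ v => ∃ x : β → M, G M v x := by
  classical
  intro e he
  obtain ⟨c, hc⟩ : ∃ c : Cardinal.{u}, lift.{w'} c = lift.{u} #β :=
    Cardinal.mem_range_lift_of_le hβ.le
  have hβ' := hβ
  rw [← hc, lift_lt] at hβ'
  -- fewer than `κ` variables are in use, so there is room for a fresh copy of `β`
  have hcompl : #((Set.range e)ᶜ : Set (Var κ)) = κ := by
    have h1 : #(Var κ) = κ := by simp
    have : Infinite (Var κ) := by
      rw [Cardinal.infinite_iff, h1]; exact hκ
    rw [Cardinal.mk_compl_of_infinite _ (by rw [h1]; exact he), h1]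
  obtain ⟨g⟩ : Nonempty (β ↪ ((Set.range e)ᶜ : Set (Var κ))) := by
    rw [← Cardinal.lift_mk_le', hcompl]
    exact hβ.le
  have hg : ∀ b, (g b : Var κ) ∉ Set.range e := fun b => (g b).2
  have hrange : Set.range (Sum.elim e fun b => (g b : Var κ))
      = Set.range e ∪ Set.range fun b => (g b : Var κ) := Set.Sum.elim_range _ _
  have hgc : #(Set.range fun b => (g b : Var κ)) < κ := by
    have h1 : lift.{w'} #(Set.range fun b => (g b : Var κ)) = lift.{u} #β :=
      Cardinal.mk_range_eq_of_injective (fun a b hab => g.injective (Subtype.ext hab))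
    rw [← Cardinal.lift_lt.{u, w'}, h1]
    exact hβ
  obtain ⟨φ, h1, h2⟩ := h (Sum.elim e fun b => (g b : Var κ))
    (by rw [hrange]; exact (mk_union_le _ _).trans_lt (add_lt_of_lt hκ he hgc))
  refine ⟨.ex (Set.range fun b => (g b : Var κ)) hgc φ, ?_, fun M _ v => ?_⟩
  · rw [hrange] at h1
    rintro x ⟨hx, hx'⟩
    exact (h1 hx).resolve_right hx'
  · simp only [InfFormula.Realize, h2, Sum.elim_inl, Sum.elim_inr]
    constructor
    · rintro ⟨w, hw, hG⟩
      refine ⟨fun b => w (g b), ?_⟩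
      rwa [show (fun a => v (e a)) = fun a => w (e a) from
        funext fun a => (hw _ (by rintro ⟨b, hb⟩; exact hg b ⟨a, hb.symm⟩)).symm]
    · rintro ⟨x, hG⟩
      refine ⟨fun y => if hy : ∃ b, (g b : Var κ) = y then x hy.choose else v y, ?_, ?_⟩
      · intro y hy
        simp only [Set.mem_range] at hy
        simp [hy]
      · have h3 : ∀ b, (if hy : ∃ b', (g b' : Var κ) = g b then x hy.choose else
            v (g b)) = x b := by
          intro b
          have hb : ∃ b', (g b' : Var κ) = g b := ⟨b, rfl⟩
          rw [dif_pos hb]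
          exact congrArg x (g.injective (Subtype.ext hb.choose_spec))
        have h4 : ∀ a, (if hy : ∃ b', (g b' : Var κ) = e a then x hy.choose else
              v (e a)) = v (e a) := by
          intro a
          rw [dif_neg]
          rintro ⟨b, hb⟩
          exact hg b ⟨a, hb.symm⟩
        simp only [h3, h4]
        exact hG

theorem allBlock (hκ : ℵ₀ ≤ κ) (hβ : lift.{u} #β < lift.{w'} κ)
    {G : ∀ (M : Type u) [L.Structure M], (α → M) → (β → M) → Prop}
    (h : Definable Λ κ L (α ⊕ β) fun M _ v => G M (fun a => v (.inl a)) fun b => v (.inr b)) :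
    Definable Λ κ L α fun M _ v => ∀ x : β → M, G M v x :=
  (exBlock (G := fun M _ v x => ¬ G M v x) hκ hβ h.not).not.congr fun M _ v => by push Not; rfl

theorem all (hκ : ℵ₀ ≤ κ) {G : ∀ (M : Type u) [L.Structure M], (α → M) → M → Prop}
    (h : Definable Λ κ L (α ⊕ Unit) fun M _ v => G M (fun a => v (.inl a)) (v (.inr ()))) :
    Definable Λ κ L α fun M _ v => ∀ x : M, G M v x :=
  (allBlock (G := fun M _ v x => G M v (x ())) hκ
    (by simpa using one_lt_aleph0.trans_le hκ) h).congr fun M _ v =>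
      ⟨fun h x => h fun _ => x, fun h x => h _⟩

theorem ex (hκ : ℵ₀ ≤ κ) {G : ∀ (M : Type u) [L.Structure M], (α → M) → M → Prop}
    (h : Definable Λ κ L (α ⊕ Unit) fun M _ v => G M (fun a => v (.inl a)) (v (.inr ()))) :
    Definable Λ κ L α fun M _ v => ∃ x : M, G M v x :=
  (exBlock (G := fun M _ v x => G M v (x ())) hκ
    (by simpa using one_lt_aleph0.trans_le hκ) h).congr fun M _ v =>
      ⟨fun ⟨x, hx⟩ => ⟨x (), hx⟩, fun ⟨x, hx⟩ => ⟨fun _ => x, hx⟩⟩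

end Definable

/-- A definable condition on structures is expressed by a sentence. -/
theorem Definable.exists_sentence (hκ : ℵ₀ ≤ κ) {C : ∀ (M : Type u) [L.Structure M], Prop}
    (h : Definable Λ κ L Empty fun M _ _ => C M) :
    ∃ ψ : InfSentence Λ κ L, ∀ (M : Type u) [L.Structure M], IsModel M ψ ↔ Nonempty M ∧ C M := by
  obtain ⟨φ, h1, h2⟩ := h Empty.elim (by simpa using aleph0_pos.trans_le hκ)
  refine ⟨⟨φ, by simpa [Set.range_eq_empty] using h1⟩, fun M _ => and_congr_right fun hM => ?_⟩
  simp only [h2]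
  exact ⟨fun h => h fun _ => hM.some, fun h _ => h⟩

/-! ### Changing the vocabulary -/

theorem mk_Iio_toType_lt {c : Cardinal.{u}} (i : c.ord.ToType) : #(Set.Iio i) < c := by
  simpa using mk_Iio_lt i (by simp)

variable {Λ κ : Cardinal.{u}} {L L' L'' : FirstOrder.Language.{u, u}}

theorem term_varFinset_onTerm {α : Type w} [DecidableEq α] (σ : L →ᴸ L') (t : L.Term α) :
    (σ.onTerm t).varFinset = t.varFinset := by
  induction t with
  | var a => rfl
  | func f ts ih =>
    simp only [FirstOrder.Language.LHom.onTerm, FirstOrder.Language.Term.varFinset, ih]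

namespace InfFormula

/-- The image of a formula under a map of vocabularies. -/
def mapL (σ : L →ᴸ L') : InfFormula Λ κ L → InfFormula Λ κ L'
  | equal t₁ t₂ => equal (σ.onTerm t₁) (σ.onTerm t₂)
  | rel R ts => rel (σ.onRelation R) fun i => σ.onTerm (ts i)
  | neg φ => neg (φ.mapL σ)
  | conj γ φ => conj γ fun i => (φ i).mapL σ
  | ex s hs φ => ex s hs (φ.mapL σ)

theorem freeVars_mapL (σ : L →ᴸ L') (φ : InfFormula Λ κ L) :
    (φ.mapL σ).freeVars = φ.freeVars := by
  classical
  induction φ with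
  | equal t₁ t₂ => simp only [mapL, freeVars, term_varFinset_onTerm]
  | rel R ts => simp only [mapL, freeVars, term_varFinset_onTerm]
  | neg φ ih => exact ih
  | conj γ φ ih => simp only [mapL, freeVars, ih]
  | ex s hs φ ih => simp only [mapL, freeVars, ih]

theorem realize_mapL (σ : L →ᴸ L') {M : Type u} [L.Structure M] [L'.Structure M]
    [σ.IsExpansionOn M] (φ : InfFormula Λ κ L) :
    ∀ v : Var κ → M, (φ.mapL σ).Realize v ↔ φ.Realize v := by
  induction φ with
  | equal t₁ t₂ => intro v; simp only [mapL, Realize, FirstOrder.Language.LHom.realize_onTerm]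
  | rel R ts =>
    intro v
    simp only [mapL, Realize, FirstOrder.Language.LHom.realize_onTerm,
      FirstOrder.Language.LHom.map_onRelation]
  | neg φ ih => intro v; exact not_congr (ih v)
  | conj γ φ ih => intro v; exact forall_congr' fun i => ih i v
  | ex s hs φ ih => intro v; exact exists_congr fun w => and_congr_right fun _ => ih w

end InfFormula

/-- The image of a sentence under a map of vocabularies. -/
def InfSentence.mapL (σ : L →ᴸ L') (ψ : InfSentence Λ κ L) : InfSentence Λ κ L' :=
  ⟨ψ.1.mapL σ, (InfFormula.freeVars_mapL σ ψ.1).trans ψ.2⟩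

theorem isModel_mapL (σ : L →ᴸ L') {M : Type u} [L.Structure M] [L'.Structure M]
    [σ.IsExpansionOn M] (ψ : InfSentence Λ κ L) : IsModel M (ψ.mapL σ) ↔ IsModel M ψ :=
  and_congr_right fun _ => forall_congr' fun v => InfFormula.realize_mapL σ ψ.1 v

/-- A structure for a part of the vocabulary can be expanded, as models are non-empty. -/
theorem exists_expansion {σ : L →ᴸ L'} (hσ : σ.Injective) (M : Type u) [Nonempty M]
    [L.Structure M] : ∃ _ : L'.Structure M, σ.IsExpansionOn M := by
  classical
  inhabit M
  exact ⟨σ.defaultExpansion M, hσ.isExpansionOn_default M⟩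

theorem spec_mapL {σ : L →ᴸ L'} (hσ : σ.Injective) (ψ : InfSentence Λ κ L) :
    spec (ψ.mapL σ) = spec ψ := by
  ext μ
  constructor
  · rintro ⟨M, _, hM, rfl⟩
    let := σ.reduct M
    exact ⟨M, σ.reduct M, (isModel_mapL σ ψ).1 hM, rfl⟩
  · rintro ⟨M, _, hM, rfl⟩
    have := hM.1
    obtain ⟨_, _⟩ := exists_expansion hσ M
    exact ⟨M, _, (isModel_mapL σ ψ).2 hM, rfl⟩

theorem sumMap_id_injective {K : FirstOrder.Language.{u, 0}} {σ : L →ᴸ L'} (hσ : σ.Injective) :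
    ((FirstOrder.Language.LHom.id K).sumMap σ).Injective := by
  constructor
  · intro n
    exact Sum.map_injective.2 ⟨fun _ _ h => h, hσ.onFunction⟩
  · intro n
    exact Sum.map_injective.2 ⟨fun _ _ h => h, hσ.onRelation⟩

theorem isBAStructure_mapL (σ : L →ᴸ L') {B : Type u} [BooleanAlgebra B] {M : Type u}
    [(voc B L).Structure M] [(voc B L').Structure M]
    [h : ((FirstOrder.Language.LHom.id (baLang B)).sumMap σ).IsExpansionOn M] :
    IsBAStructure B L' M ↔ IsBAStructure B L M := by
  have hc : (cM L' : B → M) = cM L := by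
    funext b
    exact h.map_onFunction (Sum.inl (BAFunc.c b)) ![]
  have hP : (PM B L' : M → Prop) = PM B L := by
    funext x
    exact h.map_onRelation (Sum.inl BARel.P) ![x]
  have hQ : (QM B L' : M → Prop) = QM B L := by
    funext x
    exact h.map_onRelation (Sum.inl BARel.Q) ![x]
  have hR : (RM B L' : M → M → Prop) = RM B L := by
    funext x y
    exact h.map_onRelation (Sum.inl BARel.R) ![x, y]
  have hu : (ufM B L' : M → Set B) = ufM B L := by
    funext a
    simp only [ufM, hc, hR]
  constructor
  · rintro ⟨h1, h2, h3, h4, h5, h6⟩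
    rw [hc] at h1 h2
    simp only [hP, hQ, hR, hu] at h1 h3 h4 h5 h6
    exact ⟨h1, h2, h3, h4, h5, h6⟩
  · rintro ⟨h1, h2, h3, h4, h5, h6⟩
    rw [← hc] at h1 h2
    simp only [← hP, ← hQ, ← hR, ← hu] at h1 h3 h4 h5 h6
    exact ⟨h1, h2, h3, h4, h5, h6⟩

/-- The vocabulary whose function symbols of each arity, and also its predicates, are indexed by
`X`. Every vocabulary of at most `#X` symbols embeds into it. -/
def univLang (X : Type u) : FirstOrder.Language.{u, u} := ⟨fun _ => X, fun _ => X⟩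

theorem exists_lhom_univLang {X : Type u} (h : L.card ≤ #X) :
    ∃ σ : L →ᴸ univLang X, σ.Injective := by
  obtain ⟨g⟩ : Nonempty (L.Symbols ↪ X) := h
  refine ⟨⟨fun n f => g (.inl ⟨n, f⟩), fun n r => g (.inr ⟨n, r⟩)⟩, ⟨?_, ?_⟩⟩
  · intro n f f' hff
    have := g.injective hff
    simpa using this
  · intro n f f' hff
    have := g.injective hff
    simpa using this

theorem card_univLang {X : Type u} (h : ℵ₀ ≤ #X) : (univLang X).card = #X := by
  rw [FirstOrder.Language.card_eq_card_functions_add_card_relations]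
  simp [univLang, h, add_eq_self h]

theorem spec1_mapL {lam : Cardinal.{u}} {B : Type u} [BooleanAlgebra B] (ψ : BASentence lam κ B)
    {σ : ψ.L →ᴸ L'} (hσ : σ.Injective) (hL : L'.card ≤ lam) :
    spec1 (⟨L', hL, ψ.sentence.mapL ((FirstOrder.Language.LHom.id (baLang B)).sumMap σ)⟩ :
      BASentence lam κ B) = spec1 ψ := by
  ext μ
  constructor
  · rintro ⟨M, _, hM, hB, rfl⟩
    let := ((FirstOrder.Language.LHom.id (baLang B)).sumMap σ).reduct M
    exact ⟨M, ((FirstOrder.Language.LHom.id (baLang B)).sumMap σ).reduct M,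
      (isModel_mapL _ ψ.sentence).1 hM, (isBAStructure_mapL σ).1 hB, rfl⟩
  · rintro ⟨M, _, hM, hB, rfl⟩
    have := hM.1
    obtain ⟨_, _⟩ := exists_expansion (sumMap_id_injective (K := baLang B) hσ) M
    exact ⟨M, _, (isModel_mapL _ ψ.sentence).2 hM, (isBAStructure_mapL σ).2 hB, rfl⟩

/-- The part of a vocabulary that consists of the symbols in `A`. -/
def subLang (L : FirstOrder.Language.{u, u}) (A : Set L.Symbols) : FirstOrder.Language.{u, u} :=
  ⟨fun n => {f : L.Functions n // Sum.inl ⟨n, f⟩ ∈ A},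
    fun n => {r : L.Relations n // Sum.inr ⟨n, r⟩ ∈ A}⟩

/-- The inclusion of a part of a vocabulary. -/
def subLangIncl (L : FirstOrder.Language.{u, u}) (A : Set L.Symbols) : subLang L A →ᴸ L :=
  ⟨fun _ f => f.1, fun _ r => r.1⟩

theorem subLangIncl_injective (A : Set L.Symbols) : (subLangIncl L A).Injective :=
  ⟨@fun _ => Subtype.val_injective, @fun _ => Subtype.val_injective⟩

theorem card_subLang_le (A : Set L.Symbols) : (subLang L A).card ≤ #A := by
  refine mk_le_of_injective (f := fun s : (subLang L A).Symbols => match s with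
    | .inl ⟨n, f⟩ => (⟨.inl ⟨n, f.1⟩, f.2⟩ : A)
    | .inr ⟨n, f⟩ => (⟨.inr ⟨n, f.1⟩, f.2⟩ : A)) ?_
  rintro (⟨n, f, hf⟩ | ⟨n, f, hf⟩) (⟨m, g, hg⟩ | ⟨m, g, hg⟩) h
  · simp only [Subtype.mk.injEq, Sum.inl.injEq, Sigma.mk.injEq] at h
    obtain ⟨rfl, h⟩ := h
    obtain rfl := eq_of_heq h
    rfl
  · simp at h
  · simp at h
  · simp only [Subtype.mk.injEq, Sum.inr.injEq, Sigma.mk.injEq] at h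
    obtain ⟨rfl, h⟩ := h
    obtain rfl := eq_of_heq h
    rfl

theorem term_mem_range_subLang {α : Type w} (t : L.Term α) : ∃ A : Set L.Symbols, #A ≤ ℵ₀ ∧
    ∀ A', A ⊆ A' → t ∈ Set.range ((subLangIncl L A').onTerm : _ → L.Term α) := by
  induction t with
  | var a => exact ⟨∅, by simp, fun A' _ => ⟨.var a, rfl⟩⟩
  | @func n f ts ih =>
    choose A hA h using ih
    refine ⟨insert (.inl ⟨n, f⟩) (⋃ i, A i), ?_, ?_⟩
    · rw [Cardinal.le_aleph0_iff_set_countable]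
      exact (Set.countable_iUnion fun i =>
        Cardinal.le_aleph0_iff_set_countable.1 (hA i)).insert _
    · intro A' hA'
      choose s hs using fun i => h i A' fun x hx => hA' (Or.inr (Set.mem_iUnion.2 ⟨i, hx⟩))
      exact ⟨.func (⟨f, hA' (Or.inl rfl)⟩ : (subLang L A').Functions n) s, by
        simp only [FirstOrder.Language.LHom.onTerm, hs]; rfl⟩

/-- A formula of `𝕃_{λ⁺,κ}` has at most `λ` symbols. -/
theorem InfFormula.mem_range_subLang {lam : Cardinal.{u}} (hlam : ℵ₀ ≤ lam)
    (φ : InfFormula (Order.succ lam) κ L) : ∃ A : Set L.Symbols, #A ≤ lam ∧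
    ∀ A', A ⊆ A' → φ ∈ Set.range (InfFormula.mapL (subLangIncl L A') :
      InfFormula (Order.succ lam) κ _ → _) := by
  induction φ with
  | equal t₁ t₂ =>
    obtain ⟨A, hA, h⟩ := term_mem_range_subLang t₁
    obtain ⟨B, hB, h'⟩ := term_mem_range_subLang t₂
    refine ⟨A ∪ B, (mk_union_le _ _).trans (add_le_of_le hlam (hA.trans hlam) (hB.trans hlam)), ?_⟩
    intro A' hA'
    obtain ⟨s, hs⟩ := h A' (Set.subset_union_left.trans hA')
    obtain ⟨s', hs'⟩ := h' A' (Set.subset_union_right.trans hA')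
    exact ⟨.equal s s', by simp only [mapL, hs, hs']⟩
  | @rel n R ts =>
    choose A hA h using fun i => term_mem_range_subLang (ts i)
    refine ⟨insert (.inr ⟨n, R⟩) (⋃ i, A i), le_trans ?_ hlam, ?_⟩
    · rw [Cardinal.le_aleph0_iff_set_countable]
      exact (Set.countable_iUnion fun i =>
        Cardinal.le_aleph0_iff_set_countable.1 (hA i)).insert _
    · intro A' hA'
      choose s hs using fun i => h i A' fun x hx => hA' (Or.inr (Set.mem_iUnion.2 ⟨i, hx⟩))
      exact ⟨.rel (⟨R, hA' (Or.inl rfl)⟩ : (subLang L A').Relations n) s, by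
        simp only [mapL, hs]; rfl⟩
  | neg φ ih =>
    obtain ⟨A, hA, h⟩ := ih
    refine ⟨A, hA, fun A' hA' => ?_⟩
    obtain ⟨s, hs⟩ := h A' hA'
    exact ⟨.neg s, by simp only [mapL, hs]⟩
  | conj γ φ ih =>
    choose A hA h using ih
    refine ⟨⋃ i, A i, ?_, ?_⟩
    · refine (mk_iUnion_le _).trans (mul_le_of_le hlam ?_ (ciSup_le' hA))
      exact Order.lt_succ_iff.1 (mk_Iio_toType_lt γ)
    · intro A' hA'
      choose s hs using fun i => h i A' fun x hx => hA' (Set.mem_iUnion.2 ⟨i, hx⟩)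
      exact ⟨.conj γ s, by simp only [mapL, hs]⟩
  | ex s hs φ ih =>
    obtain ⟨A, hA, h⟩ := ih
    refine ⟨A, hA, fun A' hA' => ?_⟩
    obtain ⟨t, ht⟩ := h A' hA'
    exact ⟨.ex s hs t, by simp only [mapL, ht]⟩

/-- Every spectrum of `𝕃_{λ⁺,κ}` is the spectrum of a sentence in a vocabulary of at most `λ`
symbols. -/
theorem exists_small_vocabulary {lam : Cardinal.{u}} (hlam : ℵ₀ ≤ lam)
    (ψ : InfSentence (Order.succ lam) κ L) : ∃ (L₀ : FirstOrder.Language.{u, u})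
      (ψ₀ : InfSentence (Order.succ lam) κ L₀), L₀.card ≤ lam ∧ spec ψ₀ = spec ψ := by
  obtain ⟨A, hA, h⟩ := ψ.1.mem_range_subLang hlam
  obtain ⟨φ, hφ⟩ := h A subset_rfl
  have h0 : φ.freeVars = ∅ := by rw [← InfFormula.freeVars_mapL (subLangIncl L A), hφ, ψ.2]
  let ψ₀ : InfSentence (Order.succ lam) κ (subLang L A) := ⟨φ, h0⟩
  have hψ : ψ₀.mapL (subLangIncl L A) = ψ := Subtype.ext hφ
  exact ⟨subLang L A, ψ₀, (card_subLang_le A).trans hA,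
    hψ ▸ (spec_mapL (subLangIncl_injective A) ψ₀).symm⟩

/-! ### The number of sentences -/

/-- There are at most `2 ^ c` well-founded trees whose branchings are of size at most `c` and whose
nodes carry one of `2 ^ c` labels. -/
theorem mk_wtype_le {α : Type u} {β : α → Type u} {c : Cardinal.{u}} (hc : ℵ₀ ≤ c)
    (hα : #α ≤ 2 ^ c) (hβ : ∀ a, #(β a) ≤ c) : #(WType β) ≤ 2 ^ c := by
  have h2 : ℵ₀ ≤ (2 : Cardinal.{u}) ^ c := hc.trans (cantor c).le
  refine WType.cardinalMk_le_of_le ?_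
  calc (Cardinal.sum fun a : α => (2 ^ c) ^ #(β a)) ≤
        Cardinal.sum fun _ : α => (2 : Cardinal.{u}) ^ c := by
        refine Cardinal.sum_le_sum _ _ fun a => ?_
        rw [← power_mul]
        exact power_le_power_left two_ne_zero (mul_le_of_le hc le_rfl (hβ a))
    _ = #α * 2 ^ c := by simp
    _ ≤ 2 ^ c := mul_le_of_le h2 hα le_rfl

theorem mk_infFormula_le {lam : Cardinal.{u}} (hlam : ℵ₀ ≤ lam) (hκ : κ ≤ Order.succ lam)
    (hL : L.card ≤ 2 ^ lam) : #(InfFormula (Order.succ lam) κ L) ≤ 2 ^ lam := by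
  have h2 : ℵ₀ ≤ (2 : Cardinal.{u}) ^ lam := hlam.trans (cantor lam).le
  have hs : Order.succ lam ≤ 2 ^ lam := Order.succ_le_of_lt (cantor lam)
  have hvar : #(Var κ) ≤ 2 ^ lam := by simpa using hκ.trans hs
  have hterm : #(L.Term (Var κ)) ≤ 2 ^ lam := by
    refine FirstOrder.Language.Term.card_le.trans (max_le h2 ?_)
    rw [mk_sum, lift_id, lift_id]
    refine add_le_of_le h2 hvar (le_trans ?_ hL)
    rw [FirstOrder.Language.card]
    exact mk_le_of_injective (f := Sum.inl) Sum.inl_injective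
  let A : Type u := ((L.Term (Var κ) × L.Term (Var κ)) ⊕
    (Σ n, L.Relations n × (Fin n → L.Term (Var κ)))) ⊕
    ((Option (Order.succ lam).ord.ToType) ⊕ {s : Set (Var κ) // #s < κ})
  let ar : A → Type u := fun a => match a with
    | .inl _ => PEmpty
    | .inr (.inl none) => PUnit
    | .inr (.inl (some γ)) => Set.Iio γ
    | .inr (.inr _) => PUnit
  let f : WType ar → InfFormula (Order.succ lam) κ L := WType.elim _ fun x => match x with
    | ⟨.inl (.inl p), _⟩ => .equal p.1 p.2
    | ⟨.inl (.inr p), _⟩ => .rel p.2.1 p.2.2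
    | ⟨.inr (.inl none), g⟩ => .neg (g PUnit.unit)
    | ⟨.inr (.inl (some γ)), g⟩ => .conj γ g
    | ⟨.inr (.inr s), g⟩ => .ex s.1 s.2 (g PUnit.unit)
  have hf : Function.Surjective f := by
    intro φ
    induction φ with
    | equal t₁ t₂ => exact ⟨WType.mk (.inl (.inl (t₁, t₂))) PEmpty.elim, rfl⟩
    | rel R ts => exact ⟨WType.mk (.inl (.inr ⟨_, R, ts⟩)) PEmpty.elim, rfl⟩
    | neg φ ih =>
      obtain ⟨x, rfl⟩ := ih
      exact ⟨WType.mk (.inr (.inl none)) fun _ => x, rfl⟩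
    | conj γ φ ih =>
      choose x hx using ih
      exact ⟨WType.mk (.inr (.inl (some γ))) x, by rw [← funext hx]; rfl⟩
    | ex s hs φ ih =>
      obtain ⟨x, rfl⟩ := ih
      exact ⟨WType.mk (.inr (.inr ⟨s, hs⟩)) fun _ => x, rfl⟩
  refine (mk_le_of_surjective hf).trans (mk_wtype_le hlam ?_ ?_)
  · have hrel : #(Σ n, L.Relations n × (Fin n → L.Term (Var κ))) ≤ 2 ^ lam := by
      have h1 : #((Σ n, L.Relations n) × List (L.Term (Var κ))) ≤ 2 ^ lam := by
        rw [mk_prod, lift_id, lift_id]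
        refine mul_le_of_le h2 (le_trans ?_ hL) ((mk_list_le_max _).trans (max_le h2 hterm))
        rw [FirstOrder.Language.card]
        exact mk_le_of_injective (f := Sum.inr) Sum.inr_injective
      refine le_trans (mk_le_of_injective
        (f := fun p : Σ n, L.Relations n × (Fin n → L.Term (Var κ)) =>
          (((⟨p.1, p.2.1⟩, List.ofFn p.2.2) :
            (Σ n, L.Relations n) × List (L.Term (Var κ))))) ?_) h1
      rintro ⟨n, R, ts⟩ ⟨m, R', ts'⟩ h
      simp only [Prod.mk.injEq, Sigma.mk.injEq] at h
      obtain ⟨⟨rfl, h⟩, h'⟩ := h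
      obtain rfl := eq_of_heq h
      obtain rfl := List.ofFn_injective h'
      rfl
    have hset : #{s : Set (Var κ) // #s < κ} ≤ 2 ^ lam := by
      refine (mk_le_of_injective (f := fun s : {s : Set (Var κ) // #s < κ} =>
        (⟨s.1, Order.lt_succ_iff.1 (s.2.trans_le hκ)⟩ : {s : Set (Var κ) // #s ≤ lam})) ?_).trans
        ((mk_bounded_set_le _ _).trans ?_)
      · intro s t h
        simpa [Subtype.ext_iff] using h
      · refine (power_le_power_right (max_le hvar h2)).trans ?_
        rw [← power_mul, mul_eq_self hlam]
    simp only [A, mk_sum, lift_id, mk_prod, mk_option]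
    have h1 : (1 : Cardinal.{u}) ≤ 2 ^ lam := one_lt_aleph0.le.trans h2
    refine add_le_of_le h2 (add_le_of_le h2 (mul_le_of_le h2 hterm hterm) hrel)
      (add_le_of_le h2 (add_le_of_le h2 ?_ h1) hset)
    rw [mk_ord_toType]; exact hs
  · rintro (_ | (_ | γ) | _)
    · simp [ar]
    · simpa [ar] using one_lt_aleph0.le.trans hlam
    · exact Order.lt_succ_iff.1 (mk_Iio_toType_lt γ)
    · simpa [ar] using one_lt_aleph0.le.trans hlam

/-! ### Comparing Hanf numbers -/

theorem isHanfBound_hanf {𝒮 : Set (Set Cardinal.{u})} {μ : Cardinal.{u}} (h : IsHanfBound 𝒮 μ) :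
    IsHanfBound 𝒮 (hanf 𝒮) :=
  csInf_mem (s := {μ | IsHanfBound 𝒮 μ}) ⟨μ, h⟩

theorem hanf_le {𝒮 : Set (Set Cardinal.{u})} {μ : Cardinal.{u}} (h : IsHanfBound 𝒮 μ) :
    hanf 𝒮 ≤ μ :=
  csInf_le' h

/-- A set-indexed class of spectra has a Hanf bound. -/
theorem exists_isHanfBound {𝒮 : Set (Set Cardinal.{u})} {ι : Type u} (f : ι → Set Cardinal.{u})
    (h : 𝒮 ⊆ Set.range f) : ∃ μ, IsHanfBound 𝒮 μ := by
  refine ⟨⨆ i, Order.succ (sSup (f i)), ?_⟩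
  rintro S hS ⟨χ, hχ, hle⟩ hb
  obtain ⟨i, rfl⟩ := h hS
  have h1 : Order.succ (sSup (f i)) ≤ χ :=
    (le_ciSup (f := fun i => Order.succ (sSup (f i))) Cardinal.bddAbove_of_small i).trans hle
  exact absurd (le_csSup hb hχ) (not_le.2 (Order.succ_le_iff.1 h1))

/-- Every member of a bounded spectrum in `𝒮` is at most some member of a bounded spectrum
in `𝒮'`. -/
def Dominated (𝒮 𝒮' : Set (Set Cardinal.{u})) : Prop :=
  ∀ S ∈ 𝒮, BddAbove S → ∀ χ ∈ S, ∃ S' ∈ 𝒮', BddAbove S' ∧ ∃ χ' ∈ S', χ ≤ χ'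

theorem Dominated.isHanfBound {𝒮 𝒮' : Set (Set Cardinal.{u})} (h : Dominated 𝒮 𝒮')
    {μ : Cardinal.{u}} (hμ : IsHanfBound 𝒮' μ) : IsHanfBound 𝒮 μ := by
  rintro S hS ⟨χ, hχ, hle⟩ hb
  obtain ⟨S', hS', hb', χ', hχ', hle'⟩ := h S hS hb χ hχ
  exact hμ S' hS' ⟨χ', hχ', hle.trans hle'⟩ hb'

theorem Dominated.of_subset {𝒮 𝒮' : Set (Set Cardinal.{u})} (h : 𝒮 ⊆ 𝒮') : Dominated 𝒮 𝒮' :=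
  fun S hS hb χ hχ => ⟨S, h hS, hb, χ, hχ, le_rfl⟩

theorem Dominated.trans {𝒮 𝒮' 𝒮'' : Set (Set Cardinal.{u})} (h : Dominated 𝒮 𝒮')
    (h' : Dominated 𝒮' 𝒮'') : Dominated 𝒮 𝒮'' := by
  intro S hS hb χ hχ
  obtain ⟨S', hS', hb', χ', hχ', hle'⟩ := h S hS hb χ hχ
  obtain ⟨S'', hS'', hb'', χ'', hχ'', hle''⟩ := h' S' hS' hb' χ' hχ'
  exact ⟨S'', hS'', hb'', χ'', hχ'', hle'.trans hle''⟩

theorem Dominated.hanf_le_hanf {𝒮 𝒮' : Set (Set Cardinal.{u})} (h : Dominated 𝒮 𝒮')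
    (h' : ∃ μ, IsHanfBound 𝒮' μ) : hanf 𝒮 ≤ hanf 𝒮' :=
  hanf_le (h.isHanfBound (isHanfBound_hanf h'.choose_spec))

/-- Members of bounded spectra are below the Hanf number. -/
theorem lt_hanf {𝒮 : Set (Set Cardinal.{u})} (h : ∃ μ, IsHanfBound 𝒮 μ) {S : Set Cardinal.{u}}
    (hS : S ∈ 𝒮) (hb : BddAbove S) {χ : Cardinal.{u}} (hχ : χ ∈ S) : χ < hanf 𝒮 := by
  by_contra hle
  exact isHanfBound_hanf h.choose_spec S hS ⟨χ, hχ, not_lt.1 hle⟩ hb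

theorem exists_of_lt_hanf {𝒮 : Set (Set Cardinal.{u})} {μ : Cardinal.{u}} (h : μ < hanf 𝒮) :
    ∃ S ∈ 𝒮, BddAbove S ∧ ∃ χ ∈ S, μ ≤ χ := by
  by_contra hc
  refine absurd (hanf_le (𝒮 := 𝒮) (μ := μ) ?_) (not_le.2 h)
  rintro S hS hχ hb
  exact hc ⟨S, hS, hb, hχ⟩

theorem baSpectra1_subset_range {lam : Cardinal.{u}} (hlam : ℵ₀ ≤ lam) (B : Type u)
    [BooleanAlgebra B] : baSpectra1 lam κ B ⊆ Set.range
      fun ψ : InfSentence (Order.succ lam) κ (voc B (univLang lam.out)) =>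
        spec1 (⟨univLang lam.out, (by rw [card_univLang (by simpa using hlam), mk_out]), ψ⟩ :
          BASentence lam κ B) := by
  rintro _ ⟨ψ, rfl⟩
  obtain ⟨σ, hσ⟩ := exists_lhom_univLang (X := lam.out) (by simpa using ψ.card_le)
  exact ⟨_, spec1_mapL ψ hσ _⟩

theorem exists_isHanfBound_baSpectra1 {lam : Cardinal.{u}} (hlam : ℵ₀ ≤ lam) (B : Type u)
    [BooleanAlgebra B] : ∃ μ, IsHanfBound (baSpectra1 lam κ B) μ :=
  exists_isHanfBound _ (baSpectra1_subset_range hlam B)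

/-! ### Families of structures inside a structure -/

/-- The function symbols of `auxLang`. -/
inductive AuxFunc (T : Type u) (L : FirstOrder.Language.{u, u}) : ℕ → Type u
  | par {n : ℕ} (f : L.Functions n) : AuxFunc T L (n + 1)
  | un (t : T) : AuxFunc T L 1
  | cst (t : T) : AuxFunc T L 0

/-- The relation symbols of `auxLang`. -/
inductive AuxRel (T : Type u) (L : FirstOrder.Language.{u, u}) : ℕ → Type u
  | par {n : ℕ} (r : L.Relations n) : AuxRel T L (n + 1)
  | mem : AuxRel T L 2
  | bin (t : T) : AuxRel T L 2

/-- A vocabulary for structures `M` that contain a family `N_x`, `x ∈ M`, of `L`-structures: a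
binary predicate for `y ∈ N_x`, and for each symbol of `L` a symbol with an additional argument `x`.
In addition there are unary function symbols, individual constants and binary predicates that are
indexed by `T`. -/
def auxLang (T : Type u) (L : FirstOrder.Language.{u, u}) : FirstOrder.Language.{u, u} :=
  ⟨AuxFunc T L, AuxRel T L⟩

theorem card_auxLang_le {T : Type u} {L : FirstOrder.Language.{u, u}} {lam : Cardinal.{u}}
    (hlam : ℵ₀ ≤ lam) (hT : #T ≤ lam) (hL : L.card ≤ lam) : (auxLang T L).card ≤ lam := by
  have hinj : #(auxLang T L).Symbols ≤ #(L.Symbols ⊕ Option (T ⊕ T ⊕ T)) := by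
    refine mk_le_of_injective (f := fun s : (auxLang T L).Symbols => match s with
      | .inl ⟨_, .par (n := n) f⟩ => .inl (.inl ⟨n, f⟩)
      | .inl ⟨_, .un t⟩ => .inr (some (.inl t))
      | .inl ⟨_, .cst t⟩ => .inr (some (.inr (.inl t)))
      | .inr ⟨_, .par (n := n) f⟩ => .inl (.inr ⟨n, f⟩)
      | .inr ⟨_, .mem⟩ => .inr none
      | .inr ⟨_, .bin t⟩ => .inr (some (.inr (.inr t)))) ?_
    rintro (⟨n, f | t | t⟩ | ⟨n, f | _ | t⟩) (⟨m, f' | t' | t'⟩ | ⟨m, f' | _ | t'⟩) h <;>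
      simp at h <;> (try obtain ⟨rfl, h⟩ := h) <;> (try obtain rfl := eq_of_heq h) <;> rfl
  refine hinj.trans ?_
  simp only [mk_sum, lift_id, mk_option]
  exact add_le_of_le hlam hL (add_le_of_le hlam (add_le_of_le hlam hT (add_le_of_le hlam hT hT))
    (one_lt_aleph0.le.trans hlam))

theorem card_baLang_le {B : Type u} {lam : Cardinal.{u}} (hlam : ℵ₀ ≤ lam) (hB : #B ≤ lam) :
    (baLang B).card ≤ lam := by
  have hinj : #(baLang B).Symbols ≤ #(B ⊕ ULift.{u} (Fin 3)) := by
    refine mk_le_of_injective (f := fun s : (baLang B).Symbols => match s with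
      | .inl ⟨_, .c b⟩ => .inl b
      | .inr ⟨_, .P⟩ => .inr ⟨0⟩
      | .inr ⟨_, .Q⟩ => .inr ⟨1⟩
      | .inr ⟨_, .R⟩ => .inr ⟨2⟩) ?_
    rintro (⟨n, ⟨b⟩⟩ | ⟨n, _ | _ | _⟩) (⟨m, ⟨b'⟩⟩ | ⟨m, _ | _ | _⟩) h <;> simp at h <;>
      (try subst h) <;> rfl
  refine hinj.trans ?_
  simp only [mk_sum, lift_id]
  exact add_le_of_le hlam hB (by simpa using (natCast_lt_aleph0 (n := 3)).le.trans hlam)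

theorem card_voc_le {B : Type u} {L : FirstOrder.Language.{u, u}} {lam : Cardinal.{u}}
    (hlam : ℵ₀ ≤ lam) (hB : #B ≤ lam) (hL : L.card ≤ lam) : (voc B L).card ≤ lam := by
  rw [voc, FirstOrder.Language.card_sum]
  simpa using add_le_of_le hlam (card_baLang_le hlam hB) hL

section Interpretations

variable (B T : Type u) (L : FirstOrder.Language.{u, u}) {M : Type u}
  [(voc B (auxLang T L)).Structure M]

/-- `parF f x` is the interpretation of the function symbol `f` in `N_x`. -/
def parF {n : ℕ} (f : L.Functions n) (x : M) (v : Fin n → M) : M :=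
  FirstOrder.Language.Structure.funMap (L := voc B (auxLang T L)) (n := n + 1)
    (Sum.inr (AuxFunc.par f)) (Fin.cons x v)

/-- `parR r x` is the interpretation of the predicate `r` in `N_x`. -/
def parR {n : ℕ} (r : L.Relations n) (x : M) (v : Fin n → M) : Prop :=
  FirstOrder.Language.Structure.RelMap (L := voc B (auxLang T L)) (n := n + 1)
    (Sum.inr (AuxRel.par r)) (Fin.cons x v)

/-- `EM x y` says that `y` belongs to `N_x`. -/
def EM (x y : M) : Prop :=
  FirstOrder.Language.Structure.RelMap (L := voc B (auxLang T L)) (n := 2)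
    (Sum.inr AuxRel.mem) ![x, y]

variable {T}

/-- The interpretation of the unary function symbol with index `t`. -/
def unM (t : T) (x : M) : M :=
  FirstOrder.Language.Structure.funMap (L := voc B (auxLang T L)) (n := 1)
    (Sum.inr (AuxFunc.un t)) ![x]

/-- The interpretation of the individual constant with index `t`. -/
def cstM (t : T) : M :=
  FirstOrder.Language.Structure.funMap (L := voc B (auxLang T L)) (n := 0)
    (Sum.inr (AuxFunc.cst t)) ![]

/-- The interpretation of the binary predicate with index `t`. -/
def binM (t : T) (x y : M) : Prop :=
  FirstOrder.Language.Structure.RelMap (L := voc B (auxLang T L)) (n := 2)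
    (Sum.inr (AuxRel.bin t)) ![x, y]

end Interpretations

section Definability

variable {Λ κ : Cardinal.{u}} {B T : Type u} {L : FirstOrder.Language.{u, u}} {α : Type w}

namespace TermDefinable

theorem c (L : FirstOrder.Language.{u, u}) (b : B) :
    TermDefinable (voc B L) α fun _ _ _ => cM L b := func₀ _

theorem un (t : T) {g : ∀ (M : Type u) [(voc B (auxLang T L)).Structure M], (α → M) → M}
    (h : TermDefinable (voc B (auxLang T L)) α g) :
    TermDefinable (voc B (auxLang T L)) α fun M _ v => unM B L t (g M v) := func₁ _ h

theorem cst (t : T) : TermDefinable (voc B (auxLang T L)) α fun _ _ _ => cstM B L t := func₀ _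

theorem par {n : ℕ} (f : L.Functions n)
    {g : ∀ (M : Type u) [(voc B (auxLang T L)).Structure M], (α → M) → M}
    {h : ∀ (M : Type u) [(voc B (auxLang T L)).Structure M], (α → M) → Fin n → M}
    (hg : TermDefinable (voc B (auxLang T L)) α g)
    (hh : ∀ i, TermDefinable (voc B (auxLang T L)) α fun M _ v => h M v i) :
    TermDefinable (voc B (auxLang T L)) α fun M _ v => parF B T L f (g M v) (h M v) := by
  have h1 : ∀ i : Fin (n + 1), TermDefinable (voc B (auxLang T L)) α fun M _ v =>
      (Fin.cons (g M v) (h M v) : Fin (n + 1) → M) i := by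
    intro i
    refine Fin.cases ?_ (fun i => ?_) i
    · simpa using hg
    · simpa using hh i
  exact func (L := voc B (auxLang T L)) (Sum.inr (AuxFunc.par f)) h1

end TermDefinable

namespace Definable

variable {g h : ∀ (M : Type u) [(voc B (auxLang T L)).Structure M], (α → M) → M}

theorem P {g : ∀ (M : Type u) [(voc B L).Structure M], (α → M) → M}
    (hg : TermDefinable (voc B L) α g) :
    Definable Λ κ (voc B L) α fun M _ v => PM B L (g M v) :=
  rel₁ _ hg

theorem Q {g : ∀ (M : Type u) [(voc B L).Structure M], (α → M) → M}
    (hg : TermDefinable (voc B L) α g) :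
    Definable Λ κ (voc B L) α fun M _ v => QM B L (g M v) :=
  rel₁ _ hg

theorem R {g h : ∀ (M : Type u) [(voc B L).Structure M], (α → M) → M}
    (hg : TermDefinable (voc B L) α g) (hh : TermDefinable (voc B L) α h) :
    Definable Λ κ (voc B L) α fun M _ v => RM B L (g M v) (h M v) :=
  rel₂ _ hg hh

theorem E (hg : TermDefinable (voc B (auxLang T L)) α g)
    (hh : TermDefinable (voc B (auxLang T L)) α h) :
    Definable Λ κ (voc B (auxLang T L)) α fun M _ v => EM B T L (g M v) (h M v) :=
  rel₂ _ hg hh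

theorem bin (t : T) (hg : TermDefinable (voc B (auxLang T L)) α g)
    (hh : TermDefinable (voc B (auxLang T L)) α h) :
    Definable Λ κ (voc B (auxLang T L)) α fun M _ v => binM B L t (g M v) (h M v) :=
  rel₂ _ hg hh

theorem par {n : ℕ} (r : L.Relations n)
    {k : ∀ (M : Type u) [(voc B (auxLang T L)).Structure M], (α → M) → Fin n → M}
    (hg : TermDefinable (voc B (auxLang T L)) α g)
    (hk : ∀ i, TermDefinable (voc B (auxLang T L)) α fun M _ v => k M v i) :
    Definable Λ κ (voc B (auxLang T L)) α fun M _ v => parR B T L r (g M v) (k M v) := by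
  have h1 : ∀ i : Fin (n + 1), TermDefinable (voc B (auxLang T L)) α fun M _ v =>
      (Fin.cons (g M v) (k M v) : Fin (n + 1) → M) i := by
    intro i
    refine Fin.cases ?_ (fun i => ?_) i
    · simpa using hg
    · simpa using hk i
  exact rel (L := voc B (auxLang T L)) (Sum.inr (AuxRel.par r)) h1

end Definable

end Definability

section Relativization

variable {Λ κ : Cardinal.{u}} (B T : Type u) {L : FirstOrder.Language.{u, u}} {M : Type u}
  [(voc B (auxLang T L)).Structure M]

/-- The value of a term in `N_x`. -/
def parTerm {α : Type w} (x : M) : L.Term α → (α → M) → M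
  | .var a, v => v a
  | .func f ts, v => parF B T L f x fun i => parTerm x (ts i) v

/-- Satisfaction of a formula in `N_x`, expressed in the surrounding structure: quantifiers are
restricted to `N_x`. -/
def ParRealize (x : M) : InfFormula Λ κ L → (Var κ → M) → Prop
  | .equal t₁ t₂, v => parTerm B T x t₁ v = parTerm B T x t₂ v
  | .rel r ts, v => parR B T L r x fun i => parTerm B T x (ts i) v
  | .neg φ, v => ¬ ParRealize x φ v
  | .conj _ φ, v => ∀ i, ParRealize x (φ i) v
  | .ex s _ φ, v => ∃ w : Var κ → M, (∀ y, y ∉ s → w y = v y) ∧ (∀ y ∈ s, EM B T L x (w y)) ∧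
      ParRealize x φ w

variable (L) in
/-- `j` is an isomorphism of the `L`-structure `A` onto `N_x`. -/
structure ParRep (x : M) (A : Type u) [L.Structure A] (j : A → M) : Prop where
  injective : Function.Injective j
  mem_iff : ∀ y, EM B T L x y ↔ y ∈ Set.range j
  map_fun : ∀ {n : ℕ} (f : L.Functions n) (v : Fin n → A),
    parF B T L f x (fun i => j (v i)) = j (FirstOrder.Language.Structure.funMap f v)
  map_rel : ∀ {n : ℕ} (r : L.Relations n) (v : Fin n → A),
    parR B T L r x (fun i => j (v i)) ↔ FirstOrder.Language.Structure.RelMap r v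

variable {B T}

theorem ParRep.parTerm_eq {x : M} {A : Type u} [L.Structure A] {j : A → M}
    (h : ParRep B T L x A j) {α : Type w} (t : L.Term α) (v : α → A) :
    parTerm B T x t (fun a => j (v a)) = j (t.realize v) := by
  induction t with
  | var a => rfl
  | func f ts ih =>
    simp only [parTerm, ih, FirstOrder.Language.Term.realize_func]
    exact h.map_fun f _

theorem ParRep.parRealize_iff {x : M} {A : Type u} [L.Structure A] {j : A → M}
    (h : ParRep B T L x A j) (φ : InfFormula Λ κ L) :
    ∀ v : Var κ → A, ParRealize B T x φ (fun a => j (v a)) ↔ φ.Realize v := by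
  classical
  induction φ with
  | equal t₁ t₂ =>
    intro v
    simp only [ParRealize, InfFormula.Realize, h.parTerm_eq]
    exact h.injective.eq_iff
  | rel r ts =>
    intro v
    simp only [ParRealize, InfFormula.Realize, h.parTerm_eq]
    exact h.map_rel r _
  | neg φ ih => intro v; exact not_congr (ih v)
  | conj γ φ ih => intro v; exact forall_congr' fun i => ih i v
  | ex s hs φ ih =>
    intro v
    constructor
    · rintro ⟨w, h1, h2, h3⟩
      choose g hg using fun y hy => (h.mem_iff _).1 (h2 y hy)
      refine ⟨fun y => if hy : y ∈ s then g y hy else v y, fun y hy => by simp [hy], (ih _).1 ?_⟩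
      convert h3 using 2 with y
      by_cases hy : y ∈ s
      · simp [hy, hg y hy]
      · simp [hy, h1 y hy]
    · rintro ⟨w, h1, h3⟩
      exact ⟨fun a => j (w a), fun y hy => congrArg j (h1 y hy),
        fun y _ => (h.mem_iff _).2 ⟨_, rfl⟩,
        (ih w).2 h3⟩

theorem parTerm_congr {α : Type w} [DecidableEq α] (x : M) (t : L.Term α) {v v' : α → M}
    (h : ∀ a ∈ t.varFinset, v a = v' a) : parTerm B T x t v = parTerm B T x t v' := by
  induction t with
  | var a => exact h a (by simp [FirstOrder.Language.Term.varFinset])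
  | func f ts ih =>
    refine congrArg (parF B T L f x) (funext fun i => ih i fun a ha => h a ?_)
    simp only [FirstOrder.Language.Term.varFinset, Finset.mem_biUnion, Finset.mem_univ, true_and]
    exact ⟨i, ha⟩

theorem parRealize_congr (x : M) (φ : InfFormula Λ κ L) : ∀ {v v' : Var κ → M},
    (∀ y ∈ φ.freeVars, v y = v' y) → (ParRealize B T x φ v ↔ ParRealize B T x φ v') := by
  classical
  induction φ with
  | equal t₁ t₂ =>
    intro v v' h
    simp only [ParRealize]
    rw [parTerm_congr x t₁ (v' := v') fun a ha => h a ?_,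
      parTerm_congr x t₂ (v' := v') fun a ha => h a ?_]
    · simp only [InfFormula.freeVars, Set.mem_union, Finset.mem_coe]
      right; convert ha
    · simp only [InfFormula.freeVars, Set.mem_union, Finset.mem_coe]
      left; convert ha
  | rel R ts =>
    intro v v' h
    simp only [ParRealize]
    rw [show (fun i => parTerm B T x (ts i) v) = fun i => parTerm B T x (ts i) v' from
      funext fun i => parTerm_congr x (ts i) fun a ha => h a ?_]
    simp only [InfFormula.freeVars, Set.mem_iUnion, Finset.mem_coe]
    exact ⟨i, by convert ha⟩
  | neg φ ih => intro v v' h; exact not_congr (ih h)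
  | conj γ φ ih =>
    intro v v' h
    exact forall_congr' fun i => ih i fun a ha => h a (Set.mem_iUnion.2 ⟨i, ha⟩)
  | ex s hs φ ih =>
    have key : ∀ {v v' : Var κ → M}, (∀ a ∈ (InfFormula.ex s hs φ).freeVars, v a = v' a) →
        ParRealize B T x (.ex s hs φ) v → ParRealize B T x (.ex s hs φ) v' := by
      rintro v v' h ⟨w, hw, hE, hφ⟩
      refine ⟨fun a => if a ∈ s then w a else v' a, fun a ha => by simp [ha],
        fun a ha => by simpa [ha] using hE a ha, (ih ?_).1 hφ⟩
      intro a ha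
      by_cases has : a ∈ s
      · simp [has]
      · simp only [has, if_false]
        rw [hw a has]
        exact h a ⟨ha, has⟩
    exact fun {v v'} h => ⟨key h, key fun a ha => (h a ha).symm⟩

theorem TermDefinable.parTerm {α : Type w} {β : Type w'} (t : L.Term β)
    {g : ∀ (M : Type u) [(voc B (auxLang T L)).Structure M], (α → M) → M}
    {k : ∀ (M : Type u) [(voc B (auxLang T L)).Structure M], (α → M) → β → M}
    (hg : TermDefinable (voc B (auxLang T L)) α g)
    (hk : ∀ i, TermDefinable (voc B (auxLang T L)) α fun M _ v => k M v i) :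
    TermDefinable (voc B (auxLang T L)) α fun M _ v => parTerm B T (g M v) t (k M v) := by
  induction t with
  | var a => exact hk a
  | func f ts ih => exact TermDefinable.par f hg ih

open Classical in
/-- The assignment that maps the variables in `s` to the given values and the other ones to `x`. -/
noncomputable def extendVal {κ : Cardinal.{u}} {M : Type u} {s : Set (Var κ)} (x : M) (v : s → M) :
    Var κ → M :=
  fun y => if h : y ∈ s then v ⟨y, h⟩ else x

/-- Satisfaction in `N_x` is definable, with `x` as an additional parameter. Recursion on `φ` produces
the relativization of `φ` to `N_x`. -/
theorem Definable.parRealize {Λ₀ : Cardinal.{u}} (hκ : ℵ₀ ≤ κ) (hΛ : ℵ₀ < Λ) (hκΛ : κ ≤ Λ)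
    (hΛ₀ : Λ₀ ≤ Λ) (φ : InfFormula Λ₀ κ L) :
    ∀ s : Set (Var κ), φ.freeVars ⊆ s → Definable Λ κ (voc B (auxLang T L)) (Unit ⊕ s)
      fun _ _ v => ParRealize B T (v (.inl ())) φ
        (extendVal (v (.inl ())) fun y => v (.inr y)) := by
  classical
  have hterm : ∀ (s : Set (Var κ)) (y : Var κ),
      TermDefinable (voc B (auxLang T L)) (Unit ⊕ s) fun _ _ v =>
        extendVal (v (.inl ())) (fun y : s => v (.inr y)) y := by
    intro s y
    by_cases hy : y ∈ s
    · simp only [extendVal, hy, dif_pos]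
      exact .var _
    · simp only [extendVal, hy, dif_neg, not_false_eq_true]
      exact .var _
  induction φ with
  | equal t₁ t₂ =>
    intro s _
    exact .eq (.parTerm t₁ (.var _) (hterm s)) (.parTerm t₂ (.var _) (hterm s))
  | rel r ts =>
    intro s _
    exact .par r (.var _) fun i => .parTerm (ts i) (.var _) (hterm s)
  | neg φ ih => intro s hs; exact (ih s hs).not
  | conj γ φ ih =>
    intro s hs
    refine .conj ?_ fun i => ih i s fun y hy => hs (Set.mem_iUnion.2 ⟨i, hy⟩)
    rw [lift_id, lift_id]
    exact (mk_Iio_toType_lt γ).trans_le hΛ₀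
  | ex t ht φ ih =>
    intro s hs
    have hs' : φ.freeVars ⊆ s ∪ t := fun y hy => by
      by_cases hyt : y ∈ t
      · exact Or.inr hyt
      · exact Or.inl (hs ⟨hy, hyt⟩)
    let f : Unit ⊕ (s ∪ t : Set (Var κ)) → (Unit ⊕ s) ⊕ t := fun a => match a with
      | .inl _ => .inl (.inl ())
      | .inr y => if h : y.1 ∈ t then .inr ⟨y.1, h⟩ else
          .inl (.inr ⟨y.1, y.2.resolve_right h⟩)
    have h1 : Definable Λ κ (voc B (auxLang T L)) ((Unit ⊕ s) ⊕ t) fun M _ v =>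
        (∀ y : t, EM B T L (v (.inl (.inl ()))) (v (.inr y))) ∧
          ParRealize B T (v (.inl (.inl ()))) φ
            (extendVal (v (.inl (.inl ()))) fun y => v (f (.inr y))) :=
      .and hΛ
        (.conj (by rw [lift_id, lift_id]; exact ht.trans_le hκΛ) fun y => .E (.var _) (.var _))
        ((ih _ hs').reindex f)
    refine (exBlock (G := fun M _ v x => (∀ y : t, EM B T L (v (.inl ())) (x y)) ∧
          ParRealize B T (v (.inl ())) φ (extendVal (v (.inl ())) fun y : (s ∪ t : Set (Var κ)) =>
            if h : y.1 ∈ t then x ⟨y.1, h⟩ else v (.inr ⟨y.1, y.2.resolve_right h⟩)))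
      hκ (by rw [lift_id, lift_id]; exact ht) (h1.congr fun M _ v => ?_)).congr fun M _ v => ?_
    · refine and_congr_right fun _ => ?_
      apply iff_of_eq
      congr 2
      funext y
      simp only [f]
      split_ifs <;> rfl
    · constructor
      · rintro ⟨x, hx, h2⟩
        refine ⟨_, fun y hy => ?_, fun y hy => ?_, h2⟩
        · by_cases hys : y ∈ s
          · simp [extendVal, hys, hy]
          · simp [extendVal, hys, hy]
        · simpa [extendVal, hy] using hx ⟨y, hy⟩
      · rintro ⟨w, hw, hE, h2⟩
        refine ⟨fun y => w y, fun y => hE y y.2, ?_⟩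
        convert h2 using 2
        funext y
        by_cases hyt : y ∈ t
        · simp [extendVal, hyt]
        · by_cases hys : y ∈ s <;> simp [extendVal, hyt, hys, hw y hyt]

end Relativization

/-! ### Definability of the members of a family that are models of a sentence -/

section ParModel

variable {Λ Λ₀ κ : Cardinal.{u}} (B T : Type u) {L : FirstOrder.Language.{u, u}} {M : Type u}
  [(voc B (auxLang T L)).Structure M]

/-- `N_x` is an `L`-structure and a model of `ψ`. -/
def ParModel (ψ : InfSentence Λ₀ κ L) (x : M) : Prop :=
  ∃ (A : Type u) (_ : L.Structure A) (j : A → M), ParRep B T L x A j ∧ IsModel A ψ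

variable (L) in
/-- `N_x` is closed under the functions of `L`. -/
def ParClosed (x : M) : Prop :=
  ∀ (f : Σ n, L.Functions n) (v : Fin f.1 → M), (∀ i, EM B T L x (v i)) →
    EM B T L x (parF B T L f.2 x v)

variable {B T}

theorem ParRep.parClosed {x : M} {A : Type u} [L.Structure A] {j : A → M}
    (h : ParRep B T L x A j) : ParClosed B T L x := by
  rintro ⟨n, f⟩ v hv
  choose a ha using fun i => (h.mem_iff _).1 (hv i)
  obtain rfl : (fun i => j (a i)) = v := funext ha
  rw [h.map_fun]
  exact (h.mem_iff _).2 ⟨_, rfl⟩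

theorem ParClosed.exists_parRep {x : M} (h : ParClosed B T L x) :
    ∃ _ : L.Structure {y // EM B T L x y}, ParRep B T L x {y // EM B T L x y} Subtype.val := by
  let S : L.Structure {y // EM B T L x y} :=
    ⟨fun {n} f v => ⟨_, h ⟨n, f⟩ (fun i => (v i).1) fun i => (v i).2⟩,
      fun {n} r v => parR B T L r x fun i => (v i).1⟩
  exact ⟨S, Subtype.val_injective, fun y => by simp, fun f v => rfl, fun r v => Iff.rfl⟩

theorem parModel_iff (ψ : InfSentence Λ₀ κ L) (x : M) : ParModel B T ψ x ↔
    ParClosed B T L x ∧ (∃ y, EM B T L x y) ∧ ParRealize B T x ψ.1 fun _ => x := by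
  have hc : ∀ v : Var κ → M, ParRealize B T x ψ.1 v ↔ ParRealize B T x ψ.1 fun _ => x := fun v =>
    parRealize_congr x ψ.1 fun y hy => by rw [ψ.2] at hy; exact hy.elim
  constructor
  · rintro ⟨A, _, j, h, hA⟩
    obtain ⟨a⟩ := hA.1
    refine ⟨h.parClosed, ⟨j a, (h.mem_iff _).2 ⟨a, rfl⟩⟩, ?_⟩
    exact (hc _).1 ((h.parRealize_iff ψ.1 fun _ => a).2 (hA.2 _))
  · rintro ⟨h1, ⟨y, hy⟩, h2⟩
    obtain ⟨_, h⟩ := h1.exists_parRep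
    exact ⟨_, _, _, h, ⟨⟨y, hy⟩⟩, fun v => (h.parRealize_iff ψ.1 v).1 ((hc _).2 h2)⟩

theorem Definable.parModel (hκ : ℵ₀ ≤ κ) (hΛ : ℵ₀ < Λ) (hκΛ : κ ≤ Λ) (hΛ₀ : Λ₀ ≤ Λ)
    (hL : L.card < Λ) (ψ : InfSentence Λ₀ κ L) {α : Type w}
    {g : ∀ (M : Type u) [(voc B (auxLang T L)).Structure M], (α → M) → M}
    (hg : TermDefinable (voc B (auxLang T L)) α g) :
    Definable Λ κ (voc B (auxLang T L)) α fun M _ v => ParModel B T ψ (g M v) := by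
  have h0 : Definable Λ κ (voc B (auxLang T L)) Unit fun _ _ v => ParModel B T ψ (v ()) := by
    have hF : #(Σ n, L.Functions n) < Λ := lt_of_le_of_lt
      (mk_le_of_injective (f := Sum.inl) Sum.inl_injective) hL
    have h1 : Definable Λ κ (voc B (auxLang T L)) Unit fun _ _ v => ParClosed B T L (v ()) := by
      refine .conj (by simpa using hF) fun f => .allBlock hκ ?_ (.imp hΛ (.conj ?_ fun i =>
        .E (.var _) (.var _)) (.E (.var _) (.par f.2 (.var _) fun i => .var _)))
      · simpa using natCast_lt_aleph0.trans_le hκ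
      · simpa using natCast_lt_aleph0.trans hΛ
    have h2 : Definable Λ κ (voc B (auxLang T L)) Unit fun M _ v =>
        ∃ y : M, EM B T L (v ()) y := .ex hκ (.E (.var _) (.var _))
    have h3 : Definable Λ κ (voc B (auxLang T L)) Unit fun M _ v =>
        ParRealize B T (v ()) ψ.1 fun _ => v () := by
      refine ((Definable.parRealize hκ hΛ hκΛ hΛ₀ ψ.1 ∅ (by rw [ψ.2])).reindex
        (fun _ => () : Unit ⊕ (∅ : Set (Var κ)) → Unit)).congr fun M _ v => ?_
      apply iff_of_eq
      congr 1
      funext y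
      simp [extendVal]
    exact (h1.and hΛ (h2.and hΛ h3)).congr fun M _ v => (parModel_iff ψ _).symm
  have h1 : Definable Λ κ (voc B (auxLang T L)) α fun M _ v =>
      ∃ y : M, y = g M v ∧ ParModel B T ψ y := by
    refine .ex hκ (.and hΛ (.eq (.var _) ?_) (h0.reindex fun _ => Sum.inr ()))
    obtain ⟨t, ht⟩ := hg
    exact ⟨t.relabel Sum.inl, fun M _ v => by
      rw [FirstOrder.Language.Term.realize_relabel]; exact ht M _⟩
  exact h1.congr fun M _ v => by simp

end ParModel

section ParBA

variable {Λ Λ₀ κ : Cardinal.{u}} {B T C : Type u} [BooleanAlgebra C]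
  {L : FirstOrder.Language.{u, u}} {M : Type u} [(voc B (auxLang T (voc C L))).Structure M]

set_option linter.unusedSectionVars false

variable (B T L) in
/-- The constant `c_b` of `N_x`. -/
def parc (x : M) (b : C) : M := parF B T (voc C L) (n := 0) (Sum.inl (BAFunc.c b)) x ![]

variable (B T C L) in
/-- The predicate `P` of `N_x`. -/
def parP (x y : M) : Prop := parR B T (voc C L) (n := 1) (Sum.inl BARel.P) x ![y]

variable (B T C L) in
/-- The predicate `Q` of `N_x`. -/
def parQ (x y : M) : Prop := parR B T (voc C L) (n := 1) (Sum.inl BARel.Q) x ![y]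

variable (B T C L) in
/-- The predicate `R` of `N_x`. -/
def parRR (x y z : M) : Prop := parR B T (voc C L) (n := 2) (Sum.inl BARel.R) x ![y, z]

variable (B T C L) in
/-- The set of all `b` with `c_b R y` in `N_x`. -/
def parUf (x y : M) : Set C := {b | parRR B T C L x (parc B T L x b) y}

variable (B T C L) in
/-- `N_x` represents the Boolean algebra `C` and some of its ultrafilters. -/
structure ParBasic (x : M) : Prop where
  P_iff : ∀ y, EM B T (voc C L) x y → (parP B T C L x y ↔ ∃ b : C, y = parc B T L x b)
  c_inj : ∀ b b' : C, b ≠ b' → parc B T L x b ≠ parc B T L x b'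
  R_sub : ∀ y z, EM B T (voc C L) x y → EM B T (voc C L) x z → parRR B T C L x y z →
    parP B T C L x y ∧ parQ B T C L x z
  isUltra : ∀ y, EM B T (voc C L) x y → parQ B T C L x y → IsUltra (parUf B T C L x y)
  inj : ∀ y z, EM B T (voc C L) x y → EM B T (voc C L) x z → parQ B T C L x y →
    parQ B T C L x z → (∀ b, b ∈ parUf B T C L x y ↔ b ∈ parUf B T C L x z) → y = z

variable (B T C L) in
/-- Every ultrafilter of `C` is represented in `N_x`. -/
def ParFull (x : M) : Prop :=
  ∀ U : Set C, IsUltra U → ∃ y, EM B T (voc C L) x y ∧ parQ B T C L x y ∧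
    ∀ b, b ∈ parUf B T C L x y ↔ b ∈ U

/-- `N_x` represents `C` and all its ultrafilters if and only if this holds for its isomorphic
copies. -/
theorem ParRep.isBAStructure_iff {x : M} {A : Type u} [(voc C L).Structure A] {j : A → M}
    (h : ParRep B T (voc C L) x A j) :
    IsBAStructure C L A ↔ ParBasic B T C L x ∧ ParFull B T C L x := by
  have hc : ∀ b : C, j (cM L b) = parc B T L x b := fun b =>
    (h.map_fun (n := 0) (Sum.inl (BAFunc.c b)) ![]).symm.trans
      (congrArg _ (Subsingleton.elim _ _))
  have hP : ∀ a, parP B T C L x (j a) ↔ PM C L a := fun a =>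
    (iff_of_eq (congrArg (parR B T (voc C L) (n := 1) (Sum.inl BARel.P) x)
      (funext fun i => by fin_cases i; rfl))).trans (h.map_rel (n := 1) (Sum.inl BARel.P) ![a])
  have hQ : ∀ a, parQ B T C L x (j a) ↔ QM C L a := fun a =>
    (iff_of_eq (congrArg (parR B T (voc C L) (n := 1) (Sum.inl BARel.Q) x)
      (funext fun i => by fin_cases i; rfl))).trans (h.map_rel (n := 1) (Sum.inl BARel.Q) ![a])
  have hR : ∀ a a', parRR B T C L x (j a) (j a') ↔ RM C L a a' := fun a a' =>
    (iff_of_eq (congrArg (parR B T (voc C L) (n := 2) (Sum.inl BARel.R) x)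
      (funext fun i => by fin_cases i <;> rfl))).trans
        (h.map_rel (n := 2) (Sum.inl BARel.R) ![a, a'])
  have hE : ∀ a, EM B T (voc C L) x (j a) := fun a => (h.mem_iff _).2 ⟨a, rfl⟩
  have hu : ∀ a, parUf B T C L x (j a) = ufM C L a := fun a => by
    ext b
    simp only [parUf, ufM, Set.mem_ofPred_eq, ← hc, hR]
  constructor
  · intro hA
    refine ⟨⟨?_, ?_, ?_, ?_, ?_⟩, ?_⟩
    · intro y hy
      obtain ⟨a, rfl⟩ := (h.mem_iff _).1 hy
      rw [hP]
      have : PM C L a ↔ a ∈ Set.range (cM L : C → A) := by rw [← hA.P_eq]; rfl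
      rw [this]
      simp only [← hc, h.injective.eq_iff, Set.mem_range, eq_comm]
    · intro b b' hb
      rw [← hc, ← hc]
      exact h.injective.ne (hA.c_injective.ne hb)
    · intro y z hy hz hyz
      obtain ⟨a, rfl⟩ := (h.mem_iff _).1 hy
      obtain ⟨a', rfl⟩ := (h.mem_iff _).1 hz
      rw [hP, hQ]
      exact hA.R_sub _ _ ((hR _ _).1 hyz)
    · intro y hy hq
      obtain ⟨a, rfl⟩ := (h.mem_iff _).1 hy
      rw [hu]
      exact hA.isUltra a ((hQ a).1 hq)
    · intro y z hy hz hqy hqz hyz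
      obtain ⟨a, rfl⟩ := (h.mem_iff _).1 hy
      obtain ⟨a', rfl⟩ := (h.mem_iff _).1 hz
      rw [hu, hu] at hyz
      exact congrArg j (hA.uf_injOn ((hQ a).1 hqy) ((hQ a').1 hqz) (Set.ext hyz))
    · intro U hU
      obtain ⟨a, ⟨hq, rfl⟩, -⟩ := hA.exists_unique U hU
      exact ⟨j a, hE a, (hQ a).2 hq, fun b => by rw [hu]⟩
  · rintro ⟨hb, hf⟩
    have hinj : Set.InjOn (ufM C L) {a : A | QM C L a} := by
      intro a ha a' ha' haa
      refine h.injective (hb.inj _ _ (hE a) (hE a') ((hQ a).2 ha) ((hQ a').2 ha') fun b => ?_)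
      rw [hu, hu, haa]
    refine ⟨?_, ?_, ?_, ?_, hinj, ?_⟩
    · ext a
      rw [Set.mem_ofPred_eq, ← hP, hb.P_iff _ (hE a)]
      simp only [← hc, h.injective.eq_iff, Set.mem_range, eq_comm]
    · intro b b' hbb
      by_contra hne
      exact hb.c_inj b b' hne (by rw [← hc, ← hc, hbb])
    · intro a a' haa
      have := hb.R_sub _ _ (hE a) (hE a') ((hR _ _).2 haa)
      rwa [hP, hQ] at this
    · intro a ha
      rw [← hu]
      exact hb.isUltra _ (hE a) ((hQ a).2 ha)
    · intro U hU
      obtain ⟨y, hy, hq, hU'⟩ := hf U hU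
      obtain ⟨a, rfl⟩ := (h.mem_iff _).1 hy
      rw [hu] at hU'
      refine ⟨a, ⟨(hQ a).1 hq, Set.ext hU'⟩, fun a' ha' => hinj ha'.1 ((hQ a).1 hq) ?_⟩
      rw [ha'.2, Set.ext hU']

variable (B T) in
/-- `N_x` is a model of `ψ` that represents `C` and all its ultrafilters. -/
def ParGood (ψ : InfSentence Λ₀ κ (voc C L)) (x : M) : Prop :=
  ∃ (A : Type u) (_ : (voc C L).Structure A) (j : A → M), ParRep B T (voc C L) x A j ∧
    IsModel A ψ ∧ IsBAStructure C L A

theorem parGood_iff (ψ : InfSentence Λ₀ κ (voc C L)) (x : M) : ParGood B T ψ x ↔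
    ParModel B T ψ x ∧ ParBasic B T C L x ∧ ParFull B T C L x := by
  constructor
  · rintro ⟨A, _, j, h, hA, hC⟩
    exact ⟨⟨A, _, j, h, hA⟩, h.isBAStructure_iff.1 hC⟩
  · rintro ⟨⟨A, _, j, h, hA⟩, hC⟩
    exact ⟨A, _, j, h, hA, h.isBAStructure_iff.2 hC⟩

namespace Definable

variable {α : Type w}

theorem isUltra {L' : FirstOrder.Language.{u, u}} (hΛ : ℵ₀ < Λ) (hC : #C < Λ)
    {F : C → ∀ (M : Type u) [L'.Structure M], (α → M) → Prop}
    (hF : ∀ b, Definable Λ κ L' α (F b)) :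
    Definable Λ κ L' α fun M _ v => IsUltra {b | F b M v} := by
  have hC' : lift.{u} #C < lift.{u} Λ := by simpa using hC
  have h : Definable Λ κ L' α fun M _ v => F ⊤ M v ∧ ¬ F ⊥ M v ∧
      (∀ a, F a M v → ∀ b, a ≤ b → F b M v) ∧ (∀ a, F a M v → ∀ b, F b M v → F (a ⊓ b) M v) ∧
      ∀ a, F a M v ∨ F aᶜ M v := by
    refine .and hΛ (hF _) (.and hΛ (hF _).not (.and hΛ (.conj hC' fun a => .imp hΛ (hF a)
      (.conj hC' fun b => .imp hΛ (.const hΛ _) (hF b))) (.and hΛ (.conj hC' fun a =>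
      .imp hΛ (hF a) (.conj hC' fun b => .imp hΛ (hF b) (hF _))) (.conj hC' fun a =>
      .or hΛ (hF _) (hF _)))))
  exact h.congr fun M _ v => ⟨fun ⟨h1, h2, h3, h4, h5⟩ => ⟨h1, h2, h3, h4, h5⟩,
    fun h => ⟨h.top_mem, h.bot_notMem, h.mem_of_le, h.inf_mem, h.mem_or_compl_mem⟩⟩

variable {g k l : ∀ (M : Type u) [(voc B (auxLang T (voc C L))).Structure M], (α → M) → M}

theorem _root_.HanfBA.TermDefinable.parc (b : C)
    (hg : TermDefinable (voc B (auxLang T (voc C L))) α g) :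
    TermDefinable (voc B (auxLang T (voc C L))) α fun M _ v => parc B T L (g M v) b :=
  .par _ hg fun i => i.elim0

theorem parP (hg : TermDefinable (voc B (auxLang T (voc C L))) α g)
    (hk : TermDefinable (voc B (auxLang T (voc C L))) α k) :
    Definable Λ κ (voc B (auxLang T (voc C L))) α fun M _ v => parP B T C L (g M v) (k M v) :=
  .par _ hg fun i => by fin_cases i; exact hk

theorem parQ (hg : TermDefinable (voc B (auxLang T (voc C L))) α g)
    (hk : TermDefinable (voc B (auxLang T (voc C L))) α k) :
    Definable Λ κ (voc B (auxLang T (voc C L))) α fun M _ v => parQ B T C L (g M v) (k M v) :=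
  .par _ hg fun i => by fin_cases i; exact hk

theorem parRR (hg : TermDefinable (voc B (auxLang T (voc C L))) α g)
    (hk : TermDefinable (voc B (auxLang T (voc C L))) α k)
    (hl : TermDefinable (voc B (auxLang T (voc C L))) α l) :
    Definable Λ κ (voc B (auxLang T (voc C L))) α fun M _ v =>
      parRR B T C L (g M v) (k M v) (l M v) :=
  .par _ hg fun i => by
    fin_cases i
    · exact hk
    · exact hl

theorem mem_parUf (b : C) (hg : TermDefinable (voc B (auxLang T (voc C L))) α g)
    (hk : TermDefinable (voc B (auxLang T (voc C L))) α k) :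
    Definable Λ κ (voc B (auxLang T (voc C L))) α fun M _ v =>
      b ∈ parUf B T C L (g M v) (k M v) :=
  parRR hg (.parc b hg) hk

theorem parBasic (hκ : ℵ₀ ≤ κ) (hΛ : ℵ₀ < Λ) (hC : #C < Λ) :
    Definable Λ κ (voc B (auxLang T (voc C L))) Unit fun _ _ v => ParBasic B T C L (v ()) := by
  have hC' : lift.{u} #C < lift.{u} Λ := by simpa using hC
  have h1 : Definable Λ κ (voc B (auxLang T (voc C L))) Unit fun M _ v =>
      ∀ y : M, EM B T (voc C L) (v ()) y →
        (HanfBA.parP B T C L (v ()) y ↔ ∃ b : C, y = HanfBA.parc B T L (v ()) b) :=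
    .all hκ (.imp hΛ (.E (.var _) (.var _)) (.iff hΛ (.parP (.var _) (.var _))
      (.disj hC' fun b => .eq (.var _) (.parc b (.var _)))))
  have h2 : Definable Λ κ (voc B (auxLang T (voc C L))) Unit fun M _ v =>
      ∀ b b' : C, b ≠ b' → HanfBA.parc B T L (v ()) b ≠ HanfBA.parc B T L (v ()) b' :=
    .conj hC' fun b => .conj hC' fun b' => .imp hΛ (.const hΛ _)
      (.not (.eq (.parc b (.var _)) (.parc b' (.var _))))
  have h3 : Definable Λ κ (voc B (auxLang T (voc C L))) Unit fun M _ v =>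
      ∀ y z : M, EM B T (voc C L) (v ()) y → EM B T (voc C L) (v ()) z →
        HanfBA.parRR B T C L (v ()) y z →
          HanfBA.parP B T C L (v ()) y ∧ HanfBA.parQ B T C L (v ()) z :=
    .all hκ (.all hκ (.imp hΛ (.E (.var _) (.var _)) (.imp hΛ (.E (.var _) (.var _))
      (.imp hΛ (.parRR (.var _) (.var _) (.var _)) (.and hΛ (.parP (.var _) (.var _))
        (.parQ (.var _) (.var _)))))))
  have h4 : Definable Λ κ (voc B (auxLang T (voc C L))) Unit fun M _ v =>
      ∀ y : M, EM B T (voc C L) (v ()) y → HanfBA.parQ B T C L (v ()) y →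
        IsUltra {b | b ∈ parUf B T C L (v ()) y} :=
    .all hκ (.imp hΛ (.E (.var _) (.var _)) (.imp hΛ (.parQ (.var _) (.var _))
      (.isUltra hΛ hC fun b => .mem_parUf b (.var _) (.var _))))
  have h5 : Definable Λ κ (voc B (auxLang T (voc C L))) Unit fun M _ v =>
      ∀ y z : M, EM B T (voc C L) (v ()) y → EM B T (voc C L) (v ()) z →
        HanfBA.parQ B T C L (v ()) y → HanfBA.parQ B T C L (v ()) z →
        (∀ b, b ∈ parUf B T C L (v ()) y ↔ b ∈ parUf B T C L (v ()) z) → y = z :=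
    .all hκ (.all hκ (.imp hΛ (.E (.var _) (.var _)) (.imp hΛ (.E (.var _) (.var _))
      (.imp hΛ (.parQ (.var _) (.var _)) (.imp hΛ (.parQ (.var _) (.var _)) (.imp hΛ
        (.conj hC' fun b => .iff hΛ (.mem_parUf b (.var _) (.var _))
          (.mem_parUf b (.var _) (.var _))) (.eq (.var _) (.var _))))))))
  exact (h1.and hΛ (h2.and hΛ (h3.and hΛ (h4.and hΛ h5)))).congr fun M _ v =>
    ⟨fun ⟨h1, h2, h3, h4, h5⟩ => ⟨h1, h2, h3, h4, h5⟩, fun ⟨h1, h2, h3, h4, h5⟩ =>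
      ⟨h1, h2, h3, h4, h5⟩⟩

/-- When the conjunctions are long enough, one can speak about all ultrafilters of `C` by listing
them. -/
theorem parFull (hκ : ℵ₀ ≤ κ) (hΛ : ℵ₀ < Λ) (hC : 2 ^ #C < Λ) :
    Definable Λ κ (voc B (auxLang T (voc C L))) Unit fun _ _ v => ParFull B T C L (v ()) := by
  have hC' : lift.{u} #C < lift.{u} Λ := by simpa using (cantor _).trans hC
  have h1 : Definable Λ κ (voc B (auxLang T (voc C L))) Unit fun M _ v =>
      ∀ U : Set C, IsUltra U → ∃ y : M, EM B T (voc C L) (v ()) y ∧ HanfBA.parQ B T C L (v ()) y ∧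
        ∀ b, b ∈ parUf B T C L (v ()) y ↔ b ∈ U :=
    .conj (by simpa using hC) fun U => .imp hΛ (.const hΛ _) (.ex hκ (.and hΛ (.E (.var _) (.var _))
      (.and hΛ (.parQ (.var _) (.var _)) (.conj hC' fun b => .iff hΛ
        (.mem_parUf b (.var _) (.var _)) (.const hΛ _)))))
  exact h1

end Definable

theorem IsUltra.mem_compl_iff {U : Set C} (hU : IsUltra U) (a : C) : aᶜ ∈ U ↔ a ∉ U := by
  refine ⟨fun h h' => hU.bot_notMem ?_, fun h => (hU.mem_or_compl_mem a).resolve_left h⟩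
  have := hU.inf_mem _ h' _ h
  rwa [inf_compl_self] at this

variable {D : Type u} [BooleanAlgebra D]

theorem IsUltra.preimage {U : Set C} (hU : IsUltra U) (π : BoundedLatticeHom D C) :
    IsUltra (π ⁻¹' U) where
  top_mem := by simpa using hU.top_mem
  bot_notMem := by simpa using hU.bot_notMem
  mem_of_le := fun a ha b hab => hU.mem_of_le _ ha _ (OrderHomClass.mono π hab)
  inf_mem := fun a ha b hb => by
    rw [Set.mem_preimage, map_inf]
    exact hU.inf_mem _ ha _ hb
  mem_or_compl_mem := fun a => by
    rw [Set.mem_preimage, Set.mem_preimage, map_compl']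
    exact hU.mem_or_compl_mem _

/-- An ultrafilter of `D` that is saturated for `π : D → C` comes from an ultrafilter of `C`. -/
theorem IsUltra.image {V : Set D} (hV : IsUltra V) {π : BoundedLatticeHom D C}
    (hπ : Function.Surjective π) (hs : ∀ d d', π d = π d' → d ∈ V → d' ∈ V) :
    IsUltra (π '' V) ∧ ∀ d, π d ∈ π '' V ↔ d ∈ V := by
  have key : ∀ d, π d ∈ π '' V ↔ d ∈ V :=
    fun d => ⟨fun ⟨d', hd', h⟩ => hs d' d h hd', fun h => ⟨d, h, rfl⟩⟩
  refine ⟨⟨?_, ?_, ?_, ?_, ?_⟩, key⟩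
  · rw [← map_top π, key]; exact hV.top_mem
  · rw [← map_bot π, key]; exact hV.bot_notMem
  · rintro _ ⟨d, hd, rfl⟩ b hb
    obtain ⟨d', rfl⟩ := hπ b
    rw [← sup_eq_right.2 hb, ← map_sup, key]
    exact hV.mem_of_le _ hd _ le_sup_left
  · rintro _ ⟨d, hd, rfl⟩ _ ⟨d', hd', rfl⟩
    rw [← map_inf, key]
    exact hV.inf_mem _ hd _ hd'
  · intro b
    obtain ⟨d, rfl⟩ := hπ b
    rw [← map_compl', key, key]
    exact hV.mem_or_compl_mem d

end ParBA

section Quotient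

variable {Λ Λ₀ κ : Cardinal.{u}} {B T C : Type u} [BooleanAlgebra B] [BooleanAlgebra C]
  {L : FirstOrder.Language.{u, u}} {M : Type u} [(voc B (auxLang T (voc C L))).Structure M]

/-- If `C` is a quotient of `B` and all ultrafilters of `B` are represented, then "all
ultrafilters of `C` are represented" can be expressed by quantifying over `Q`. -/
theorem parFull_iff (hM : IsBAStructure B (auxLang T (voc C L)) M) {π : BoundedLatticeHom B C}
    (hπ : Function.Surjective π) (x : M) : ParFull B T C L x ↔
      ∀ q : M, QM B (auxLang T (voc C L)) q →
        (∀ b b' : B, π b = π b' → RM B (auxLang T (voc C L)) (cM (auxLang T (voc C L)) b) q →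
          RM B (auxLang T (voc C L)) (cM (auxLang T (voc C L)) b') q) →
        ∃ y, EM B T (voc C L) x y ∧ parQ B T C L x y ∧ ∀ b : B,
          π b ∈ parUf B T C L x y ↔ RM B (auxLang T (voc C L)) (cM (auxLang T (voc C L)) b) q := by
  constructor
  · intro h q hq hs
    obtain ⟨h1, h2⟩ := (hM.isUltra q hq).image hπ hs
    obtain ⟨y, hy, hy', h3⟩ := h _ h1
    exact ⟨y, hy, hy', fun b => (h3 _).trans (h2 b)⟩
  · intro h U hU
    obtain ⟨q, ⟨hq, hqU⟩, -⟩ := hM.exists_unique _ (hU.preimage π)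
    have hq' : ∀ b, RM B (auxLang T (voc C L)) (cM (auxLang T (voc C L)) b) q ↔ π b ∈ U :=
      fun b => by
      have : b ∈ ufM B (auxLang T (voc C L)) q ↔ b ∈ π ⁻¹' U := by rw [hqU]
      exact this
    obtain ⟨y, hy, hy', h3⟩ := h q hq fun b b' hb h => by rwa [hq', ← hb, ← hq']
    refine ⟨y, hy, hy', fun c => ?_⟩
    obtain ⟨b, rfl⟩ := hπ c
    rw [h3, hq']

/-- `ParGood` is definable relative to the class of structures that represent all ultrafilters
of `B`, if `C` is a quotient of `B`. -/
theorem Definable.exists_parGood (hκ : ℵ₀ ≤ κ) (hΛ : ℵ₀ < Λ) (hκΛ : κ ≤ Λ) (hΛ₀ : Λ₀ ≤ Λ)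
    (hL : (voc C L).card < Λ) (hB : #B < Λ) (hC : #C < Λ) {π : BoundedLatticeHom B C}
    (hπ : Function.Surjective π) (ψ : InfSentence Λ₀ κ (voc C L)) :
    ∃ G : ∀ (M : Type u) [(voc B (auxLang T (voc C L))).Structure M], (Unit → M) → Prop,
      Definable Λ κ (voc B (auxLang T (voc C L))) Unit G ∧
      ∀ (M : Type u) [(voc B (auxLang T (voc C L))).Structure M],
        IsBAStructure B (auxLang T (voc C L)) M → ∀ x : M,
          G M (fun _ => x) ↔ ParGood B T ψ x := by
  have hB' : lift.{u} #B < lift.{u} Λ := by simpa using hB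
  have hf : Definable Λ κ (voc B (auxLang T (voc C L))) Unit fun M _ v =>
      ∀ q : M, QM B (auxLang T (voc C L)) q →
        (∀ b b' : B, π b = π b' → RM B (auxLang T (voc C L)) (cM (auxLang T (voc C L)) b) q →
          RM B (auxLang T (voc C L)) (cM (auxLang T (voc C L)) b') q) →
        ∃ y, EM B T (voc C L) (v ()) y ∧ HanfBA.parQ B T C L (v ()) y ∧ ∀ b : B,
          π b ∈ parUf B T C L (v ()) y ↔
            RM B (auxLang T (voc C L)) (cM (auxLang T (voc C L)) b) q :=
    .all hκ (.imp hΛ (.Q (.var _)) (.imp hΛ (.conj hB' fun b => .conj hB' fun b' =>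
      .imp hΛ (.const hΛ _) (.imp hΛ (.R (.c _ b) (.var _)) (.R (.c _ b') (.var _))))
      (.ex hκ (.and hΛ (.E (.var _) (.var _)) (.and hΛ (.parQ (.var _) (.var _))
        (.conj hB' fun b => .iff hΛ (.mem_parUf _ (.var _) (.var _)) (.R (.c _ b) (.var _))))))))
  refine ⟨_, .and hΛ (.parModel hκ hΛ hκΛ hΛ₀ hL ψ (.var ())) (.and hΛ (.parBasic hκ hΛ hC) hf), ?_⟩
  intro M _ hM x
  rw [parGood_iff, parFull_iff hM hπ]

end Quotient

/-! ### Constructing structures and sentences -/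

section Build

variable {B T : Type u} {L : FirstOrder.Language.{u, u}} {M : Type u}

/-- The symbols of the vocabulary can be interpreted freely; in particular, any family of
`L`-structures that are embedded into `M` as sets can be chosen as the family `N_x`. -/
theorem exists_structure (c : B → M) (P Q : M → Prop) (R : M → M → Prop) (N : M → Type u)
    [∀ x, L.Structure (N x)] (j : ∀ x, N x → M) (hj : ∀ x, Function.Injective (j x))
    (un : T → M → M) (cst : T → M) (bin : T → M → M → Prop) :
    ∃ _ : (voc B (auxLang T L)).Structure M,
      (∀ b, cM (auxLang T L) b = c b) ∧ (∀ x, PM B (auxLang T L) x ↔ P x) ∧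
      (∀ x, QM B (auxLang T L) x ↔ Q x) ∧ (∀ x y, RM B (auxLang T L) x y ↔ R x y) ∧
      (∀ x, ParRep B T L x (N x) (j x)) ∧ (∀ t x, unM B L t x = un t x) ∧
      (∀ t, cstM B L t = cst t) ∧ ∀ t x y, binM B L t x y ↔ bin t x y := by
  classical
  let S : (voc B (auxLang T L)).Structure M :=
    { funMap := fun {n} f => match n, f with
        | _, .inl (.c b) => fun _ => c b
        | _, .inr (.par f) => fun v => if h : ∃ a, ∀ i, j (v 0) (a i) = v i.succ then
            j (v 0) (FirstOrder.Language.Structure.funMap f h.choose) else v 0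
        | _, .inr (.un t) => fun v => un t (v 0)
        | _, .inr (.cst t) => fun _ => cst t
      RelMap := fun {n} r => match n, r with
        | _, .inl .P => fun v => P (v 0)
        | _, .inl .Q => fun v => Q (v 0)
        | _, .inl .R => fun v => R (v 0) (v 1)
        | _, .inr (.par r) => fun v => ∃ a, (∀ i, j (v 0) (a i) = v i.succ) ∧
            FirstOrder.Language.Structure.RelMap r a
        | _, .inr .mem => fun v => v 1 ∈ Set.range (j (v 0))
        | _, .inr (.bin t) => fun v => bin t (v 0) (v 1) }
  refine ⟨S, fun _ => rfl, fun _ => Iff.rfl, fun _ => Iff.rfl, fun _ _ => Iff.rfl, fun x => ?_,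
    fun _ _ => rfl, fun _ => rfl, fun _ _ _ => Iff.rfl⟩
  refine ⟨hj x, fun y => Iff.rfl, fun {n} f v => ?_, fun {n} r v => ?_⟩
  · change (if h : ∃ a : Fin n → N x, ∀ i, j x (a i) = j x (v i) then
      j x (FirstOrder.Language.Structure.funMap f h.choose) else x) = _
    have h : ∃ a : Fin n → N x, ∀ i, j x (a i) = j x (v i) := ⟨v, fun _ => rfl⟩
    rw [dif_pos h]
    congr 2
    exact funext fun i => hj x (h.choose_spec i)
  · change (∃ a : Fin n → N x, (∀ i, j x (a i) = j x (v i)) ∧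
      FirstOrder.Language.Structure.RelMap r a) ↔ _
    constructor
    · rintro ⟨a, h1, h2⟩
      rwa [← show a = v from funext fun i => hj x (h1 i)]
    · exact fun h => ⟨v, fun _ => rfl, h⟩

/-- Any embeddings of `B` and of the set of its ultrafilters into `M` can serve as `P` and `Q`; the
other symbols of the vocabulary can be interpreted freely. -/
theorem exists_baStructure [BooleanAlgebra B] (c : B ↪ M) (k : {U : Set B // IsUltra U} ↪ M)
    (N : M → Type u) [∀ x, L.Structure (N x)] (j : ∀ x, N x → M)
    (hj : ∀ x, Function.Injective (j x)) (un : T → M → M) (cst : T → M)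
    (bin : T → M → M → Prop) :
    ∃ _ : (voc B (auxLang T L)).Structure M, IsBAStructure B (auxLang T L) M ∧
      (∀ b, cM (auxLang T L) b = c b) ∧ (∀ x, QM B (auxLang T L) x ↔ x ∈ Set.range k) ∧
      (∀ U, ufM B (auxLang T L) (k U) = U.1) ∧ (∀ x, ParRep B T L x (N x) (j x)) ∧
      (∀ t x, unM B L t x = un t x) ∧ (∀ t, cstM B L t = cst t) ∧
      ∀ t x y, binM B L t x y ↔ bin t x y := by
  obtain ⟨S, hc, hP, hQ, hR, h⟩ := exists_structure (L := L) (T := T) c (fun x => x ∈ Set.range c)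
    (fun x => x ∈ Set.range k) (fun x y => ∃ b U, x = c b ∧ y = k U ∧ b ∈ U.1) N j hj un cst bin
  have hu : ∀ U, ufM B (auxLang T L) (k U) = U.1 := by
    intro U
    ext b
    simp only [ufM, Set.mem_ofPred_eq, hR, hc]
    constructor
    · rintro ⟨b', U', hb, hU, h⟩
      rwa [c.injective hb, k.injective hU]
    · exact fun h => ⟨b, U, rfl, rfl, h⟩
  have hinj : Set.InjOn (ufM B (auxLang T L)) {a : M | QM B (auxLang T L) a} := by
    intro a ha a' ha' h
    obtain ⟨U, rfl⟩ := (hQ a).1 ha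
    obtain ⟨U', rfl⟩ := (hQ a').1 ha'
    rw [hu, hu] at h
    rw [Subtype.ext h]
  have hc' : (cM (auxLang T L) : B → M) = c := funext hc
  refine ⟨S, ?_, hc, hQ, hu, h⟩
  refine ⟨?_, ?_, ?_, ?_, hinj, ?_⟩
  · ext x
    simp only [Set.mem_ofPred_eq, hP, hc']
  · rw [hc']; exact c.injective
  · intro x y h
    obtain ⟨b, U, rfl, rfl, -⟩ := (hR x y).1 h
    exact ⟨(hP _).2 ⟨b, rfl⟩, (hQ _).2 ⟨U, rfl⟩⟩
  · intro a ha
    obtain ⟨U, rfl⟩ := (hQ a).1 ha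
    rw [hu]; exact U.2
  · intro U hU
    refine ⟨k ⟨U, hU⟩, ⟨(hQ _).2 ⟨_, rfl⟩, hu _⟩, fun a ha => ?_⟩
    exact hinj ha.1 ((hQ _).2 ⟨_, rfl⟩) (ha.2.trans (hu ⟨U, hU⟩).symm)

end Build

section Cardinalities

variable {B T : Type u} {L : FirstOrder.Language.{u, u}} {M : Type u}

theorem IsBAStructure.mk_le [BooleanAlgebra B] [(voc B L).Structure M] (h : IsBAStructure B L M) :
    #B ≤ #M :=
  mk_le_of_injective h.c_injective

theorem IsBAStructure.mk_ultra_le [BooleanAlgebra B] [(voc B L).Structure M]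
    (h : IsBAStructure B L M) : #{U : Set B // IsUltra U} ≤ #M := by
  choose k hk using fun U : {U : Set B // IsUltra U} => (h.exists_unique U.1 U.2).exists
  refine mk_le_of_injective (f := k) fun U U' hU => Subtype.ext ?_
  rw [← (hk U).2, ← (hk U').2, hU]

theorem IsBAStructure.mk_P_le [BooleanAlgebra B] [(voc B L).Structure M]
    (h : IsBAStructure B L M) : #{x : M | PM B L x} ≤ #B := by
  rw [h.P_eq]; exact mk_range_le

theorem IsBAStructure.mk_Q_le [BooleanAlgebra B] [(voc B L).Structure M]
    (h : IsBAStructure B L M) : #{x : M | QM B L x} ≤ 2 ^ #B := by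
  rw [← mk_set]
  exact mk_le_of_injective (f := fun x : {x : M | QM B L x} => ufM B L x.1)
    fun x y hxy => Subtype.ext (h.uf_injOn x.2 y.2 hxy)

theorem ParRep.mk_eq [(voc B (auxLang T L)).Structure M] {x : M} {A : Type u} [L.Structure A]
    {j : A → M} (h : ParRep B T L x A j) : #{y | EM B T L x y} = #A := by
  have : {y | EM B T L x y} = Set.range j := Set.ext h.mem_iff
  rw [this, mk_range_eq j h.injective]

/-- If `M = N_x ∪ P ∪ Q` then the cardinality of `M` is bounded in terms of the one of `N_x`. -/
theorem mk_le_of_cover [BooleanAlgebra B] [(voc B (auxLang T L)).Structure M]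
    (hM : IsBAStructure B (auxLang T L) M) (x : M) (hx : ∀ y, EM B T L x y ∨
      PM B (auxLang T L) y ∨ QM B (auxLang T L) y) :
    #M ≤ #{y | EM B T L x y} + (#B + 2 ^ #B) := by
  have h1 : (Set.univ : Set M) = {y | EM B T L x y} ∪
      ({y | PM B (auxLang T L) y} ∪ {y | QM B (auxLang T L) y}) := by
    ext y; simpa using hx y
  rw [← mk_univ, h1]
  exact (mk_union_le _ _).trans (add_le_add le_rfl ((mk_union_le _ _).trans
    (add_le_add hM.mk_P_le hM.mk_Q_le)))

end Cardinalities

section Sentences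

variable {lam κ : Cardinal.{u}} {B : Type u} [BooleanAlgebra B]

/-- A definable condition `D` gives a sentence whose models are the structures that satisfy `D`. -/
theorem exists_baSentence (hκ : ℵ₀ ≤ κ) {L : FirstOrder.Language.{u, u}} (hL : L.card ≤ lam)
    {D : ∀ (M : Type u) [(voc B L).Structure M], Prop}
    (h : Definable (Order.succ lam) κ (voc B L) Empty fun M _ _ => D M) :
    ∃ ψ : BASentence lam κ B, spec1 ψ = {μ | ∃ (M : Type u) (_ : (voc B L).Structure M),
      Nonempty M ∧ IsBAStructure B L M ∧ D M ∧ #M = μ} := by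
  obtain ⟨ψ, hψ⟩ := h.exists_sentence hκ
  refine ⟨⟨L, hL, ψ⟩, ?_⟩
  ext μ
  constructor
  · rintro ⟨M, _, hM, hB, rfl⟩
    exact ⟨M, _, hM.1, hB, ((hψ M).1 hM).2, rfl⟩
  · rintro ⟨M, _, hM, hB, hD, rfl⟩
    exact ⟨M, _, (hψ M).2 ⟨hM, hD⟩, hB, rfl⟩

/-- Sentences that say that all members of the family are models of `ψ`, where `ψ` speaks about a
quotient of `B`, and that a definable condition `D` holds. -/
theorem exists_baSentence_family (hlam : ℵ₀ ≤ lam) (hκ : ℵ₀ ≤ κ) (hκlam : κ ≤ Order.succ lam)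
    (hB : #B ≤ lam) {C : Type u} [BooleanAlgebra C] {π : BoundedLatticeHom B C}
    (hπ : Function.Surjective π) (ψ : BASentence lam κ C) {T : Type u} (hT : #T ≤ lam)
    {D : ∀ (M : Type u) [(voc B (auxLang T (voc C ψ.L))).Structure M], Prop}
    (hD : Definable (Order.succ lam) κ (voc B (auxLang T (voc C ψ.L))) Empty fun M _ _ => D M) :
    ∃ ψ' : BASentence lam κ B, spec1 ψ' = {μ | ∃ (M : Type u)
      (_ : (voc B (auxLang T (voc C ψ.L))).Structure M), Nonempty M ∧
        IsBAStructure B (auxLang T (voc C ψ.L)) M ∧ (∀ x : M, ParGood B T ψ.sentence x) ∧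
          D M ∧ #M = μ} := by
  have hC : #C ≤ lam := (mk_le_of_surjective hπ).trans hB
  have hL : (voc C ψ.L).card ≤ lam := card_voc_le hlam hC ψ.card_le
  have hΛ : ℵ₀ < Order.succ lam := Order.lt_succ_iff.2 hlam
  obtain ⟨G, hG, hG'⟩ := Definable.exists_parGood (T := T) hκ hΛ hκlam le_rfl
    (Order.lt_succ_iff.2 hL) (Order.lt_succ_iff.2 hB) (Order.lt_succ_iff.2 hC) hπ ψ.sentence
  have h1 : Definable (Order.succ lam) κ (voc B (auxLang T (voc C ψ.L))) Empty
      fun M _ _ => (∀ x : M, G M fun _ => x) ∧ D M :=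
    .and hΛ (.all hκ (hG.reindex fun _ => Sum.inr ())) hD
  obtain ⟨ψ', hψ'⟩ := exists_baSentence hκ (card_auxLang_le hlam hT hL) h1
  refine ⟨ψ', hψ'.trans ?_⟩
  ext μ
  constructor
  · rintro ⟨M, _, hM, hB', ⟨h1, h2⟩, h3⟩
    exact ⟨M, _, hM, hB', fun x => (hG' M hB' x).1 (h1 x), h2, h3⟩
  · rintro ⟨M, _, hM, hB', h1, h2, h3⟩
    exact ⟨M, _, hM, hB', ⟨fun x => (hG' M hB' x).2 (h1 x), h2⟩, h3⟩

end Sentences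

/-! ### Cardinal arithmetic of `μ ^< κ` -/

theorem mk_le_card_of_ord_lt {X : Type u} {o : Ordinal.{u}} (f : X → Ordinal.{u})
    (hf : Function.Injective f) (h : ∀ x, f x < o) : #X ≤ o.card := by
  rw [← Cardinal.mk_toType o]
  exact mk_le_of_injective (f := fun x => Ordinal.ToType.mk ⟨f x, h x⟩)
    fun x y hxy => hf (congrArg Subtype.val (Ordinal.ToType.mk.injective hxy))

/-- The exponents `θ < κ`, as a family of types. -/
theorem exists_exponents {lam κ : Cardinal.{u}} (hlam : ℵ₀ ≤ lam) (hκ : κ ≤ Order.succ lam) :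
    ∃ (Θ : Type u) (A : Θ → Type u), #Θ ≤ lam ∧ #Θ ≤ κ ∧ (∀ i, #(A i) < κ) ∧
      ∀ θ < κ, ∃ i, #(A i) = θ := by
  let e := equivShrink (Set.Iio κ)
  have hinj : Function.Injective fun i : Shrink.{u} (Set.Iio κ) => (e.symm i).1.ord := fun i j h =>
    e.symm.injective (Subtype.ext (ord_injective h))
  refine ⟨Shrink.{u} (Set.Iio κ), fun i => (e.symm i).1.out, ?_, ?_, ?_, ?_⟩
  · have := mk_le_card_of_ord_lt (o := Order.succ lam.ord) _ hinj fun i => by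
      rw [Order.lt_succ_iff]
      exact ord_le_ord.2 (Order.lt_succ_iff.1 ((e.symm i).2.trans_le hκ))
    refine this.trans ?_
    rw [Order.succ_eq_add_one, Ordinal.card_add_one, card_ord, add_one_eq hlam]
  · have := mk_le_card_of_ord_lt (o := κ.ord) _ hinj fun i => ord_lt_ord.2 (e.symm i).2
    rwa [card_ord] at this
  · intro i; rw [mk_out]; exact (e.symm i).2
  · intro θ hθ
    exact ⟨e ⟨θ, hθ⟩, by simp⟩

theorem self_le_powerlt {μ κ : Cardinal.{u}} (hκ : ℵ₀ ≤ κ) : μ ≤ μ ^< κ := by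
  have := le_powerlt μ (one_lt_aleph0.trans_le hκ)
  rwa [power_one] at this

theorem one_le_powerlt {μ κ : Cardinal.{u}} (hκ : ℵ₀ ≤ κ) : 1 ≤ μ ^< κ := by
  have := le_powerlt μ (aleph0_pos.trans_le hκ)
  rwa [power_zero] at this

theorem le_powerlt_of_two_le {μ κ : Cardinal.{u}} (hμ : 2 ≤ μ) : κ ≤ μ ^< κ := by
  refine le_of_forall_lt fun c hc => ?_
  exact (cantor c).trans_le ((power_le_power_right hμ).trans (le_powerlt μ hc))

theorem powerlt_le_powerlt_right {μ ν κ : Cardinal.{u}} (h : μ ≤ ν) : μ ^< κ ≤ ν ^< κ :=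
  powerlt_le.2 fun _ hx => (power_le_power_right h).trans (le_powerlt ν hx)

theorem one_powerlt {κ : Cardinal.{u}} (hκ : ℵ₀ ≤ κ) : (1 : Cardinal.{u}) ^< κ = 1 :=
  le_antisymm (powerlt_le.2 fun _ _ => by simp) (one_le_powerlt hκ)

theorem sum_power_le {κ μ : Cardinal.{u}} (hκ : ℵ₀ ≤ κ) (hμ : 2 ≤ μ) {Θ : Type u} (hΘ : #Θ ≤ κ)
    {f : Θ → Cardinal.{u}} (hf : ∀ i, f i ≤ μ ^< κ) : Cardinal.sum f ≤ μ ^< κ := by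
  have h1 : κ ≤ μ ^< κ := le_powerlt_of_two_le hμ
  refine (Cardinal.sum_le_sum _ (fun _ => μ ^< κ) hf).trans ?_
  rw [Cardinal.sum_const, lift_id, lift_id]
  exact mul_le_of_le (hκ.trans h1) (hΘ.trans h1) le_rfl

/-- In a well-order, there are at most `c` elements with fewer than `c` predecessors. -/
theorem mk_lt_le {o : Ordinal.{u}} (c : Cardinal.{u}) :
    #{x : o.ToType | #(Set.Iio x) < c} ≤ c := by
  have := mk_le_card_of_ord_lt (X := {x : o.ToType | #(Set.Iio x) < c}) (o := c.ord)
    (fun x => Ordinal.typein (α := o.ToType) (· < ·) x.1)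
    (fun x y h => Subtype.ext (Ordinal.typein_injective _ h)) fun x => by
      rw [lt_ord]; exact x.2
  rwa [card_ord] at this

/-- A function from `σ < κ` to `μ ^< κ` maps into some `μ ^ θ`, `θ < κ`, as `κ` is regular. So there
are at most `κ * sup (μ ^ θ) ^ σ ≤ μ ^< κ` such functions. -/
theorem powerlt_powerlt {lam κ : Cardinal.{u}} (hlam : ℵ₀ ≤ lam) (hκ : κ.IsRegular)
    (hκlam : κ ≤ Order.succ lam) (μ : Cardinal.{u}) : (μ ^< κ) ^< κ = μ ^< κ := by
  have hκ0 := hκ.aleph0_le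
  refine le_antisymm ?_ (self_le_powerlt hκ0)
  rcases lt_or_ge μ 2 with h2 | h2
  · have h1 : μ ^< κ ≤ 1 := powerlt_le.2 fun x _ => by
      have : μ ≤ 1 := by
        rw [← Order.lt_succ_iff]
        refine h2.trans_le ?_
        rw [← one_add_one_eq_two]
        exact Cardinal.add_one_le_of_lt (Order.lt_succ 1)
      simpa using power_le_power_right (c := x) this
    calc (μ ^< κ) ^< κ ≤ 1 ^< κ := powerlt_le_powerlt_right h1
      _ = 1 := one_powerlt hκ0
      _ ≤ μ ^< κ := one_le_powerlt hκ0
  obtain ⟨Θ, A, -, hΘ, hA, hA'⟩ := exists_exponents hlam hκlam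
  refine powerlt_le.2 fun σ hσ => ?_
  -- a function from `σ` to the ordinals below `ν` is bounded in cardinality by some `μ ^ θ`
  set ν := μ ^< κ with hν
  let V := ν.ord.ToType
  let Z : Θ → Set V := fun i => {v | #(Set.Iio v) < μ ^ #(A i)}
  have hcover : ∀ f : σ.out → V, ∃ i, ∀ s, f s ∈ Z i := by
    intro f
    have h1 : ∀ s, ∃ θ < κ, #(Set.Iio (f s)) < μ ^ θ := by
      intro s
      by_contra hc
      push Not at hc
      exact absurd (powerlt_le.2 hc) (not_le.2 (mk_Iio_toType_lt (f s)))
    choose θ hθ hfθ using h1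
    have hsup : iSup θ < κ := iSup_lt_of_lt_cof_ord (by simpa [hκ.cof_ord] using hσ) hθ
    obtain ⟨i, hi⟩ := hA' _ hsup
    refine ⟨i, fun s => (hfθ s).trans_le ?_⟩
    rw [hi]
    exact power_le_power_left (by rintro rfl; simp at h2) (le_ciSup Cardinal.bddAbove_of_small s)
  choose i hi using hcover
  have hinj : Function.Injective fun f : σ.out → V =>
      (⟨i f, fun s => ⟨f s, hi f s⟩⟩ : Σ i, σ.out → Z i) := by
    intro f g h
    have h2 : ∀ p q : Σ i, σ.out → Z i, p = q → ∀ s, (p.2 s).1 = (q.2 s).1 := by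
      rintro p _ rfl s; rfl
    exact funext fun s => h2 _ _ h s
  have h1 := mk_le_of_injective hinj
  rw [← power_def, mk_sigma, mk_out, mk_ord_toType] at h1
  refine h1.trans (sum_power_le hκ0 h2 hΘ fun i => ?_)
  rw [← power_def, mk_out]
  refine (power_le_power_right (mk_lt_le _)).trans ?_
  rw [← power_mul]
  exact le_powerlt μ (mul_lt_of_lt hκ0 (hA i) hσ)

/-! ### Manipulation of spectra -/

section Manipulation

variable {lam κ : Cardinal.{u}} {B : Type u}

section

variable {C T : Type u} [BooleanAlgebra C] {M : Type u}

theorem ParGood.mem_spec1 {ψ : BASentence lam κ C} [(voc B (auxLang T (voc C ψ.L))).Structure M]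
    {x : M} (h : ParGood B T ψ.sentence x) : #{y | EM B T (voc C ψ.L) x y} ∈ spec1 ψ := by
  obtain ⟨A, _, j, h, hA, hC⟩ := h
  exact ⟨A, _, hA, hC, h.mk_eq.symm⟩

end

/-- Every family of fewer than `κ` elements of `M` (of one of the lengths `#(A i)`) is coded by an
element of `M`, by means of the unary functions with indices `e ⟨i, a⟩`. -/
def PowClosed {Θ : Type u} (A : Θ → Type u) {T : Type u} (e : (Σ i, A i) → T) (B : Type u)
    (L : FirstOrder.Language.{u, u}) (M : Type u) [(voc B (auxLang T L)).Structure M] : Prop :=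
  ∀ i, ∀ f : A i → M, ∃ y, ∀ a, unM B L (e ⟨i, a⟩) y = f a

theorem Definable.powClosed {Λ : Cardinal.{u}} {α : Type w} {L : FirstOrder.Language.{u, u}}
    (hκ : ℵ₀ ≤ κ) (hκΛ : κ ≤ Λ) {Θ : Type u} {A : Θ → Type u} {T : Type u} (e : (Σ i, A i) → T)
    (hΘ : #Θ < Λ) (hA : ∀ i, #(A i) < κ) :
    Definable Λ κ (voc B (auxLang T L)) α fun M _ _ => PowClosed A e B L M :=
  .conj (by simpa using hΘ) fun i => .allBlock hκ (by simpa using hA i) (.ex hκ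
    (.conj (by simpa using (hA i).trans_le hκΛ) fun a => .eq (.un _ (.var _)) (.var _)))

theorem PowClosed.powerlt_eq {Θ : Type u} {A : Θ → Type u} {T : Type u} {e : (Σ i, A i) → T}
    {L : FirstOrder.Language.{u, u}} {M : Type u} [(voc B (auxLang T L)).Structure M]
    (hκ : ℵ₀ ≤ κ) (hA : ∀ θ < κ, ∃ i, #(A i) = θ) (h : PowClosed A e B L M) : #M ^< κ = #M := by
  refine le_antisymm (powerlt_le.2 fun θ hθ => ?_) (self_le_powerlt hκ)
  obtain ⟨i, rfl⟩ := hA θ hθ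
  rw [power_def]
  exact mk_le_of_surjective (f := fun (y : M) a => unM B L (e ⟨i, a⟩) y)
    fun f => (h i f).imp fun y hy => funext hy

theorem exists_coding {Θ : Type u} {A : Θ → Type u} {M : Type u} [Nonempty M]
    (h : #M ^< κ ≤ #M) (hA : ∀ i, #(A i) < κ) :
    ∃ F : (Σ i, A i) → M → M, ∀ i, ∀ f : A i → M, ∃ y, ∀ a, F ⟨i, a⟩ y = f a := by
  have h1 : ∀ i, ∃ g : M → A i → M, Function.Surjective g := by
    intro i
    have h2 : #(A i → M) ≤ #M := by
      rw [← power_def]; exact (le_powerlt _ (hA i)).trans h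
    obtain ⟨g⟩ := h2
    exact ⟨Function.invFun g, Function.invFun_surjective g.injective⟩
  choose g hg using h1
  refine ⟨fun p y => g p.1 y p.2, fun i f => ?_⟩
  obtain ⟨y, rfl⟩ := hg i f
  exact ⟨y, fun _ => rfl⟩

theorem mk_sigma_le_of_le {lam : Cardinal.{u}} (hlam : ℵ₀ ≤ lam) {Θ : Type u} {A : Θ → Type u}
    (hΘ : #Θ ≤ lam) (hA : ∀ i, #(A i) ≤ lam) : #(Σ i, A i) ≤ lam := by
  rw [mk_sigma]
  refine (Cardinal.sum_le_sum _ (fun _ => lam) hA).trans ?_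
  rw [Cardinal.sum_const, lift_id, lift_id]
  exact mul_le_of_le hlam hΘ le_rfl

variable [BooleanAlgebra B]

theorem id_surjective : Function.Surjective (BoundedLatticeHom.id B) := fun b => ⟨b, rfl⟩

/-- The spectrum can be restricted to the cardinals `μ` with `μ = μ ^< κ`. -/
theorem exists_spec1_eq_closed (hlam : ℵ₀ ≤ lam) (hκ : ℵ₀ ≤ κ) (hκlam : κ ≤ Order.succ lam)
    (hB : #B ≤ lam) (ψ : BASentence lam κ B) : ∃ ψ' : BASentence lam κ B,
      spec1 ψ' = {μ | μ = μ ^< κ ∧ μ ∈ spec1 ψ} := by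
  obtain ⟨Θ, A, hΘ, -, hA, hA'⟩ := exists_exponents hlam hκlam
  have hΛ : ℵ₀ < Order.succ lam := Order.lt_succ_iff.2 hlam
  have hT : #(Σ i, A i) ≤ lam :=
    mk_sigma_le_of_le hlam hΘ fun i => Order.lt_succ_iff.1 ((hA i).trans_le hκlam)
  obtain ⟨ψ', h⟩ := exists_baSentence_family hlam hκ hκlam hB id_surjective ψ hT
    (D := fun M _ => (∀ x y : M, EM B (Σ i, A i) (voc B ψ.L) x y) ∧
      PowClosed A id B (voc B ψ.L) M)
    (.and hΛ (.all hκ (.all hκ (.E (.var _) (.var _))))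
      (.powClosed hκ hκlam id (Order.lt_succ_iff.2 hΘ) hA))
  refine ⟨ψ', h.trans ?_⟩
  ext μ
  constructor
  · rintro ⟨M, _, ⟨x⟩, hM, hG, ⟨hE, hP⟩, rfl⟩
    refine ⟨(hP.powerlt_eq hκ hA').symm, ?_⟩
    have := (hG x).mem_spec1
    simpa [hE] using this
  · rintro ⟨hμ, M, _, hM, hC, rfl⟩
    have := hM.1
    obtain ⟨F, hF⟩ := exists_coding hμ.ge hA
    obtain ⟨c⟩ := hC.mk_le
    obtain ⟨k⟩ := hC.mk_ultra_le
    obtain ⟨S, hS, -, -, -, hN, hun, -, -⟩ := exists_baStructure (L := voc B ψ.L) c k (fun _ => M)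
      (fun _ => id) (fun _ => Function.injective_id) F (fun _ => this.some) (fun _ _ _ => True)
    refine ⟨M, S, this, hS, fun x => ⟨M, _, _, hN x, hM, hC⟩, ⟨fun x y => ?_, fun i f => ?_⟩, rfl⟩
    · rw [(hN x).mem_iff]; exact ⟨y, rfl⟩
    · obtain ⟨y, hy⟩ := hF i f
      exact ⟨y, fun a => (hun _ _).trans (hy a)⟩

/-- The spectrum can be restricted to the cardinals `μ ≥ λ`. -/
theorem exists_spec1_eq_ge (hlam : ℵ₀ ≤ lam) (hκ : ℵ₀ ≤ κ) (hκlam : κ ≤ Order.succ lam)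
    (hB : #B ≤ lam) (ψ : BASentence lam κ B) : ∃ ψ' : BASentence lam κ B,
      spec1 ψ' = {μ | lam ≤ μ ∧ μ ∈ spec1 ψ} := by
  have hΛ : ℵ₀ < Order.succ lam := Order.lt_succ_iff.2 hlam
  have hT : #lam.out ≤ lam := by rw [mk_out]
  have hT' : lift.{u} #lam.out < lift.{u} (Order.succ lam) := by simp
  obtain ⟨ψ', h⟩ := exists_baSentence_family hlam hκ hκlam hB id_surjective ψ hT
    (D := fun M _ => (∀ x y : M, EM B lam.out (voc B ψ.L) x y) ∧
      ∀ t t' : lam.out, t ≠ t' → (cstM B (voc B ψ.L) t : M) ≠ cstM B (voc B ψ.L) t')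
    (.and hΛ (.all hκ (.all hκ (.E (.var _) (.var _)))) (.conj hT' fun t => .conj hT' fun t' =>
      .imp hΛ (.const hΛ _) (.not (.eq (.cst t) (.cst t')))))
  refine ⟨ψ', h.trans ?_⟩
  ext μ
  constructor
  · rintro ⟨M, _, ⟨x⟩, hM, hG, ⟨hE, hD⟩, rfl⟩
    refine ⟨?_, ?_⟩
    · conv_lhs => rw [← mk_out lam]
      refine mk_le_of_injective (f := fun t : lam.out => (cstM B (voc B ψ.L) t : M)) ?_
      intro t t' ht
      by_contra hne
      exact hD t t' hne ht
    · have := (hG x).mem_spec1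
      simpa [hE] using this
  · rintro ⟨hμ, M, _, hM, hC, rfl⟩
    have := hM.1
    rw [← mk_out lam] at hμ
    obtain ⟨d⟩ := hμ
    obtain ⟨c⟩ := hC.mk_le
    obtain ⟨k⟩ := hC.mk_ultra_le
    obtain ⟨S, hS, -, -, -, hN, -, hcst, -⟩ := exists_baStructure (L := voc B ψ.L) c k (fun _ => M)
      (fun _ => id) (fun _ => Function.injective_id) (fun _ => id) d (fun _ _ _ => True)
    refine ⟨M, S, this, hS, fun x => ⟨M, _, _, hN x, hM, hC⟩, ⟨fun x y => ?_, fun t t' h => ?_⟩,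
      rfl⟩
    · rw [(hN x).mem_iff]; exact ⟨y, rfl⟩
    · rw [hcst, hcst]; exact d.injective.ne h

/-- There is a sentence whose spectrum consists of the cardinals `μ ^< κ` with `μ` in the given
spectrum. Its models contain a model `N` of the given sentence, have a code for each sequence of
length less than `κ`, and each of their elements is determined by such a sequence of elements of
`N`. -/
theorem exists_spec1_eq_powerlt (hlam : ℵ₀ ≤ lam) (hκ : κ.IsRegular) (hκlam : κ ≤ Order.succ lam)
    (hB : #B ≤ lam) (ψ : BASentence lam κ B) : ∃ ψ' : BASentence lam κ B,
      spec1 ψ' = {ν | ∃ μ ∈ spec1 ψ, ν = μ ^< κ} := by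
  classical
  obtain ⟨Θ, A, hΘ, hΘκ, hA, hA'⟩ := exists_exponents hlam hκlam
  have hκ0 := hκ.aleph0_le
  have hΛ : ℵ₀ < Order.succ lam := Order.lt_succ_iff.2 hlam
  have hAl : ∀ i, #(A i) ≤ lam := fun i => Order.lt_succ_iff.1 ((hA i).trans_le hκlam)
  have hS : #(Σ i, A i) ≤ lam := mk_sigma_le_of_le hlam hΘ hAl
  have hT : #((Σ i, A i) ⊕ (Σ i, A i) ⊕ Θ) ≤ lam := by
    simp only [mk_sum, lift_id]
    exact add_le_of_le hlam hS (add_le_of_le hlam hS hΘ)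
  have hΘ' : lift.{u} #Θ < lift.{u} (Order.succ lam) := by simpa using hΘ
  have hA'' : ∀ i, lift.{u} #(A i) < lift.{u} (Order.succ lam) := fun i => by simpa using hAl i
  let e : (Σ i, A i) → (Σ i, A i) ⊕ (Σ i, A i) ⊕ Θ := Sum.inl
  let g : (Σ i, A i) → (Σ i, A i) ⊕ (Σ i, A i) ⊕ Θ := fun p => .inr (.inl p)
  let s : Θ → (Σ i, A i) ⊕ (Σ i, A i) ⊕ Θ := fun p => .inr (.inr p)
  obtain ⟨ψ', h⟩ := exists_baSentence_family hlam hκ0 hκlam hB id_surjective ψ hT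
    (D := fun M _ => (∀ x y z : M, EM B _ (voc B ψ.L) x z → EM B _ (voc B ψ.L) y z) ∧
      PowClosed A e B (voc B ψ.L) M ∧ (∀ y : M, ∃ i, binM B (voc B ψ.L) (s i) y y) ∧
      (∀ i, ∀ a : A i, ∀ y x : M, EM B _ (voc B ψ.L) x (unM B (voc B ψ.L) (g ⟨i, a⟩) y)) ∧
      (∀ i, ∀ y z : M, binM B (voc B ψ.L) (s i) y y → binM B (voc B ψ.L) (s i) z z →
        (∀ a : A i, unM B (voc B ψ.L) (g ⟨i, a⟩) y = unM B (voc B ψ.L) (g ⟨i, a⟩) z) → y = z) ∧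
      ((∃ x y z : M, EM B _ (voc B ψ.L) x y ∧ EM B _ (voc B ψ.L) x z ∧ y ≠ z) ∨
        ∀ y z : M, y = z))
    (.and hΛ (.all hκ0 (.all hκ0 (.all hκ0 (.imp hΛ (.E (.var _) (.var _))
        (.E (.var _) (.var _))))))
      (.and hΛ (.powClosed hκ0 hκlam e (Order.lt_succ_iff.2 hΘ) hA) (.and hΛ
        (.all hκ0 (.disj hΘ' fun i => .bin _ (.var _) (.var _))) (.and hΛ
        (.conj hΘ' fun i => .conj (hA'' i) fun a => .all hκ0 (.all hκ0
          (.E (.var _) (.un _ (.var _))))) (.and hΛ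
        (.conj hΘ' fun i => .all hκ0 (.all hκ0 (.imp hΛ (.bin _ (.var _) (.var _)) (.imp hΛ
          (.bin _ (.var _) (.var _)) (.imp hΛ (.conj (hA'' i) fun a => .eq (.un _ (.var _))
            (.un _ (.var _))) (.eq (.var _) (.var _)))))))
        (.or hΛ (.ex hκ0 (.ex hκ0 (.ex hκ0 (.and hΛ (.E (.var _) (.var _)) (.and hΛ
          (.E (.var _) (.var _)) (.not (.eq (.var _) (.var _))))))))
          (.all hκ0 (.all hκ0 (.eq (.var _) (.var _))))))))))
  -- The six conditions: all `N_x` are the same set `N`; short sequences are coded; each element has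
  -- a sort `i`; the functions `g` map into `N`; an element of sort `i` is determined by the values
  -- of the functions `g ⟨i, a⟩`; and `N` has two elements unless `M` has only one (otherwise sorts
  -- could make `M` larger than `1 ^< κ = 1`).
  refine ⟨ψ', h.trans ?_⟩
  ext ν
  constructor
  · rintro ⟨M, _, ⟨x⟩, hM, hG, ⟨h1, h2, h3, h4, h5, h6⟩, rfl⟩
    refine ⟨_, (hG x).mem_spec1, le_antisymm ?_ ?_⟩
    · rcases h6 with ⟨x', y, z, hy, hz, hyz⟩ | h6
      · have hN : 2 ≤ #{y | EM B ((Σ i, A i) ⊕ (Σ i, A i) ⊕ Θ) (voc B ψ.L) x y} := by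
          rw [Cardinal.two_le_iff]
          exact ⟨⟨y, h1 x' x y hy⟩, ⟨z, h1 x' x z hz⟩, fun h => hyz (congrArg Subtype.val h)⟩
        choose i hi using h3
        have hle : #M ≤ #(Σ i, A i → {y | EM B ((Σ i, A i) ⊕ (Σ i, A i) ⊕ Θ) (voc B ψ.L) x y}) := by
          refine mk_le_of_injective (f := fun y => ⟨i y, fun a => ⟨_, h4 (i y) a y x⟩⟩) ?_
          intro y z hyz
          have key : ∀ p q : Σ i, A i → {y | EM B ((Σ i, A i) ⊕ (Σ i, A i) ⊕ Θ) (voc B ψ.L) x y},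
              p = q → ∃ h : p.1 = q.1, ∀ a, (p.2 a).1 = (q.2 (h ▸ a)).1 := by
            rintro p _ rfl; exact ⟨rfl, fun _ => rfl⟩
          obtain ⟨hi', hf⟩ := key _ _ hyz
          simp only at hi' hf
          refine h5 (i y) y z (hi y) (hi' ▸ hi z) fun a => (hf a).trans ?_
          generalize i z = iz at hi'
          subst hi'
          rfl
        refine hle.trans ?_
        rw [mk_sigma]
        refine sum_power_le hκ0 hN hΘκ fun i => ?_
        rw [← power_def]
        exact le_powerlt _ (hA i)
      · have : Subsingleton M := ⟨h6⟩
        exact (Cardinal.le_one_iff_subsingleton.2 this).trans (one_le_powerlt hκ0)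
    · rw [← h2.powerlt_eq hκ0 hA']
      exact powerlt_le_powerlt_right (mk_set_le _)
  · rintro ⟨μ, ⟨N, _, hN, hC, rfl⟩, rfl⟩
    have hN0 := hN.1
    have hle : #N ≤ #(#N ^< κ).out := by rw [mk_out]; exact self_le_powerlt hκ0
    obtain ⟨j⟩ := id hle
    have hM : Nonempty (#N ^< κ).out := hN0.map j
    obtain ⟨F, hF⟩ := exists_coding (κ := κ) (M := (#N ^< κ).out)
      (by rw [mk_out, powerlt_powerlt hlam hκ hκlam]) hA
    obtain ⟨c⟩ := hC.mk_le.trans hle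
    obtain ⟨k⟩ := hC.mk_ultra_le.trans hle
    obtain ⟨q⟩ : Nonempty ((#N ^< κ).out ↪ Σ i, A i → N) := by
      rw [← Cardinal.le_def, mk_out]
      refine powerlt_le.2 fun θ hθ => ?_
      obtain ⟨i, rfl⟩ := hA' θ hθ
      rw [power_def]
      exact mk_le_of_injective (f := fun f => (⟨i, f⟩ : Σ i, A i → N)) fun f f' h => by
        simpa using h
    obtain ⟨S, hS, -, -, -, hN', hun, -, hbin⟩ := exists_baStructure (L := voc B ψ.L) c k
      (fun _ => N)
      (fun _ => j) (fun _ => j.injective)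
      (fun t : (Σ i, A i) ⊕ (Σ i, A i) ⊕ Θ => match t with
        | .inl p => F p
        | .inr (.inl p) => fun y => if h : p.1 = (q y).1 then j ((q y).2 (h ▸ p.2)) else j hN0.some
        | .inr (.inr _) => id) (fun _ => hM.some)
      (fun t y _ => match t with
        | .inr (.inr i) => i = (q y).1
        | _ => True)
    have hE : ∀ x y, EM B ((Σ i, A i) ⊕ (Σ i, A i) ⊕ Θ) (voc B ψ.L) x y ↔ y ∈ Set.range j :=
      fun x => (hN' x).mem_iff
    refine ⟨_, S, hM, hS, fun x => ⟨N, _, _, hN' x, hN, hC⟩, ⟨?_, ?_, ?_, ?_, ?_, ?_⟩, mk_out _⟩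
    · intro x y z h; rwa [hE] at h ⊢
    · intro i f
      obtain ⟨y, hy⟩ := hF i f
      exact ⟨y, fun a => (hun _ _).trans (hy a)⟩
    · exact fun y => ⟨(q y).1, (hbin _ _ _).2 rfl⟩
    · intro i a y x
      rw [hE, hun]
      simp only [g]
      split_ifs
      · exact ⟨_, rfl⟩
      · exact ⟨_, rfl⟩
    · intro i y z hy hz h
      have hy' : i = (q y).1 := (hbin _ _ _).1 hy
      have hz' : i = (q z).1 := (hbin _ _ _).1 hz
      have h' : ∀ a : A i, (q y).2 (hy' ▸ a) = (q z).2 (hz' ▸ a) := by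
        intro a
        have := h a
        rw [hun, hun] at this
        simp only [g, dif_pos hy', dif_pos hz'] at this
        exact j.injective this
      refine q.injective ?_
      generalize q y = p at hy' h'
      generalize q z = r at hz' h'
      obtain ⟨p1, p2⟩ := p
      obtain ⟨r1, r2⟩ := r
      dsimp only at hy' hz' h'
      subst hy'
      subst hz'
      exact congrArg _ (funext h')
    · rcases subsingleton_or_nontrivial N with hsub | hnon
      · right
        have h1 : #(#N ^< κ).out ≤ 1 := by
          rw [mk_out]
          exact (powerlt_le_powerlt_right (Cardinal.le_one_iff_subsingleton.2 hsub)).trans_eq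
            (one_powerlt hκ0)
        exact (Cardinal.le_one_iff_subsingleton.1 h1).elim
      · left
        obtain ⟨a, b, hab⟩ := hnon.exists_pair_ne
        exact ⟨hM.some, j a, j b, (hE _ _).2 ⟨a, rfl⟩, (hE _ _).2 ⟨b, rfl⟩, j.injective.ne hab⟩

end Manipulation

/-! ### Comparing classes of spectra -/

section Comparison

variable {lam κ : Cardinal.{u}} {B : Type u} [BooleanAlgebra B]

theorem spec2_eq (ψ : BASentence lam κ B) : spec2 ψ = {μ | μ = μ ^< κ ∧ μ ∈ spec1 ψ} := by
  ext μ
  constructor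
  · rintro ⟨M, _, hM, hC, hκ, rfl⟩
    exact ⟨hκ, M, _, hM, hC, rfl⟩
  · rintro ⟨hκ, M, _, hM, hC, rfl⟩
    exact ⟨M, _, hM, hC, hκ, rfl⟩

theorem baSpectra2_subset (hlam : ℵ₀ ≤ lam) (hκ : ℵ₀ ≤ κ) (hκlam : κ ≤ Order.succ lam)
    (hB : #B ≤ lam) : baSpectra2 lam κ B ⊆ baSpectra1 lam κ B := by
  rintro _ ⟨ψ, rfl⟩
  obtain ⟨ψ', h⟩ := exists_spec1_eq_closed hlam hκ hκlam hB ψ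
  exact ⟨ψ', by rw [h, spec2_eq]⟩

theorem powerlt_mono_bdd {S : Set Cardinal.{u}} (h : BddAbove S) :
    BddAbove {ν | ∃ μ ∈ S, ν = μ ^< κ} := by
  obtain ⟨σ, hσ⟩ := h
  refine ⟨σ ^< κ, ?_⟩
  rintro _ ⟨μ, hμ, rfl⟩
  exact powerlt_le_powerlt_right (hσ hμ)

/-- The spectrum `{μ ^< κ : μ ∈ S}` is of the second kind, and `μ ≤ μ ^< κ`. -/
theorem dominated_baSpectra1_baSpectra2 (hlam : ℵ₀ ≤ lam) (hκ : κ.IsRegular)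
    (hκlam : κ ≤ Order.succ lam) (hB : #B ≤ lam) :
    Dominated (baSpectra1 lam κ B) (baSpectra2 lam κ B) := by
  rintro _ ⟨ψ, rfl⟩ hb χ hχ
  obtain ⟨ψ', h⟩ := exists_spec1_eq_powerlt hlam hκ hκlam hB ψ
  have h2 : spec2 ψ' = spec1 ψ' := by
    rw [spec2_eq]
    ext μ
    refine ⟨fun h => h.2, fun hμ => ⟨?_, hμ⟩⟩
    rw [h] at hμ
    obtain ⟨ν, -, rfl⟩ := hμ
    rw [powerlt_powerlt hlam hκ hκlam]
  refine ⟨spec2 ψ', ⟨ψ', rfl⟩, ?_, χ ^< κ, ?_, self_le_powerlt hκ.aleph0_le⟩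
  · rw [h2, h]; exact powerlt_mono_bdd hb
  · rw [h2, h]; exact ⟨χ, hχ, rfl⟩

/-- A structure that consists of an `L`-structure `A`, of `B`, and of the ultrafilters of `B`; all
`N_x` are equal to `A`. -/
theorem covered_of_sum {A T : Type u} {L : FirstOrder.Language.{u, u}}
    [L.Structure A] (hA : Nonempty A) :
    ∃ (_ : (voc B (auxLang T L)).Structure (A ⊕ B ⊕ {U : Set B // IsUltra U})),
      IsBAStructure B (auxLang T L) (A ⊕ B ⊕ {U : Set B // IsUltra U}) ∧
      (∀ x, ParRep B T L x A (Sum.inl : A → A ⊕ B ⊕ {U : Set B // IsUltra U})) ∧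
      ∀ x y : A ⊕ B ⊕ {U : Set B // IsUltra U}, EM B T L x y ∨
        PM B (auxLang T L) y ∨ QM B (auxLang T L) y := by
  obtain ⟨S, hS, hc, hQ, -, hN, -, -, -⟩ := exists_baStructure (B := B) (T := T) (L := L)
    (M := A ⊕ B ⊕ {U : Set B // IsUltra U})
    ⟨fun b => .inr (.inl b), fun b b' h => by simpa using h⟩
    ⟨fun b => .inr (.inr b), fun b b' h => by simpa using h⟩ (fun _ => A) (fun _ => Sum.inl)
    (fun _ => Sum.inl_injective) (fun _ => id) (fun _ => .inl hA.some) (fun _ _ _ => True)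
  refine ⟨S, hS, hN, fun x y => ?_⟩
  rcases y with a | b | U
  · exact Or.inl (((hN x).mem_iff _).2 ⟨a, rfl⟩)
  · refine Or.inr (Or.inl ?_)
    have : (Sum.inr (Sum.inl b) : A ⊕ B ⊕ {U : Set B // IsUltra U}) ∈
        Set.range (cM (auxLang T L) : B → _) := ⟨b, hc b⟩
    rwa [← hS.P_eq] at this
  · exact Or.inr (Or.inr ((hQ _).2 ⟨U, rfl⟩))

/-- Sentences without Boolean algebra can be simulated: a model consists of a model of the given
sentence, `B`, and the ultrafilters of `B`. -/
theorem dominated_infSpectra (hlam : ℵ₀ ≤ lam) (hκ : ℵ₀ ≤ κ) (hκlam : κ ≤ Order.succ lam) :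
    Dominated (infSpectra (Order.succ lam) κ) (baSpectra1 lam κ B) := by
  rintro _ ⟨L', ψ', rfl⟩ hb χ hχ
  obtain ⟨L, ψ, hL, hspec⟩ := exists_small_vocabulary hlam ψ'
  rw [← hspec] at hb hχ
  have hΛ : ℵ₀ < Order.succ lam := Order.lt_succ_iff.2 hlam
  obtain ⟨φ, hφ⟩ := exists_baSentence (B := B) hκ
    (card_auxLang_le (T := PEmpty.{u + 1}) hlam (by simp) hL)
    (D := fun M _ => (∀ x : M, ParModel B PEmpty.{u + 1} ψ x) ∧ ∀ x y : M,
      EM B PEmpty.{u + 1} L x y ∨ PM B (auxLang PEmpty.{u + 1} L) y ∨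
        QM B (auxLang PEmpty.{u + 1} L) y)
    (.and hΛ (.all hκ (.parModel hκ hΛ hκlam le_rfl (Order.lt_succ_iff.2 hL) ψ (.var _)))
      (.all hκ (.all hκ (.or hΛ (.E (.var _) (.var _)) (.or hΛ (.P (.var _)) (.Q (.var _)))))))
  refine ⟨spec1 φ, ⟨φ, rfl⟩, ?_, ?_⟩
  · obtain ⟨σ, hσ⟩ := hb
    refine ⟨σ + (#B + 2 ^ #B), ?_⟩
    rw [hφ]
    rintro _ ⟨M, _, ⟨x⟩, hM, ⟨h1, h2⟩, rfl⟩
    refine (mk_le_of_cover hM x (h2 x)).trans (add_le_add ?_ le_rfl)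
    obtain ⟨A, _, j, hj, hA⟩ := h1 x
    rw [hj.mk_eq]
    exact hσ ⟨A, _, hA, rfl⟩
  · obtain ⟨A, _, hA, rfl⟩ := hχ
    obtain ⟨S, hS, hN, hcov⟩ := covered_of_sum (B := B) (T := PEmpty.{u + 1}) (L := L) hA.1
    refine ⟨#(A ⊕ B ⊕ {U : Set B // IsUltra U}), ?_, mk_le_of_injective Sum.inl_injective⟩
    rw [hφ]
    exact ⟨_, S, hA.1.map Sum.inl, hS, ⟨fun x => ⟨A, _, _, hN x, hA⟩, hcov⟩, rfl⟩

/-- Sentences about a quotient `C` of `B` can be simulated by sentences about `B`. -/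
theorem dominated_baSpectra1_of_surjective (hlam : ℵ₀ ≤ lam) (hκ : ℵ₀ ≤ κ)
    (hκlam : κ ≤ Order.succ lam) (hB : #B ≤ lam) {C : Type u} [BooleanAlgebra C]
    {π : BoundedLatticeHom B C} (hπ : Function.Surjective π) :
    Dominated (baSpectra1 lam κ C) (baSpectra1 lam κ B) := by
  rintro _ ⟨ψ, rfl⟩ hb χ hχ
  have hΛ : ℵ₀ < Order.succ lam := Order.lt_succ_iff.2 hlam
  obtain ⟨φ, hφ⟩ := exists_baSentence_family hlam hκ hκlam hB hπ ψ (T := PEmpty.{u + 1}) (by simp)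
    (D := fun M _ => ∀ x y : M, EM B PEmpty.{u + 1} (voc C ψ.L) x y ∨
      PM B (auxLang PEmpty.{u + 1} (voc C ψ.L)) y ∨ QM B (auxLang PEmpty.{u + 1} (voc C ψ.L)) y)
    (.all hκ (.all hκ (.or hΛ (.E (.var _) (.var _)) (.or hΛ (.P (.var _)) (.Q (.var _))))))
  refine ⟨spec1 φ, ⟨φ, rfl⟩, ?_, ?_⟩
  · obtain ⟨σ, hσ⟩ := hb
    refine ⟨σ + (#B + 2 ^ #B), ?_⟩
    rw [hφ]
    rintro _ ⟨M, _, ⟨x⟩, hM, h1, h2, rfl⟩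
    exact (mk_le_of_cover hM x (h2 x)).trans (add_le_add (hσ (h1 x).mem_spec1) le_rfl)
  · obtain ⟨A, _, hA, hC, rfl⟩ := hχ
    obtain ⟨S, hS, hN, hcov⟩ := covered_of_sum (B := B) (T := PEmpty.{u + 1}) (L := voc C ψ.L) hA.1
    refine ⟨#(A ⊕ B ⊕ {U : Set B // IsUltra U}), ?_, mk_le_of_injective Sum.inl_injective⟩
    rw [hφ]
    exact ⟨_, S, hA.1.map Sum.inl, hS, fun x => ⟨A, _, _, hN x, hA, hC⟩, hcov, rfl⟩

/-- Power sets: in the models of the new sentence, every element is determined by a subset of a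
model of the given one. -/
theorem exists_baSpectra1_power (hlam : ℵ₀ ≤ lam) (hκ : ℵ₀ ≤ κ) (hκlam : κ ≤ Order.succ lam)
    (hB : #B ≤ lam) {S : Set Cardinal.{u}} (hS : S ∈ baSpectra1 lam κ B) (hb : BddAbove S)
    {χ : Cardinal.{u}} (hχ : χ ∈ S) : ∃ S' ∈ baSpectra1 lam κ B, BddAbove S' ∧ 2 ^ χ ∈ S' := by
  obtain ⟨ψ, rfl⟩ := hS
  have hΛ : ℵ₀ < Order.succ lam := Order.lt_succ_iff.2 hlam
  obtain ⟨φ, hφ⟩ := exists_baSentence_family hlam hκ hκlam hB id_surjective ψ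
    (T := PUnit.{u + 1}) (by simpa using one_lt_aleph0.le.trans hlam)
    (D := fun M _ => ∀ x y z : M, (∀ u : M, EM B PUnit.{u + 1} (voc B ψ.L) x u →
      (binM B (voc B ψ.L) PUnit.unit.{u + 1} y u ↔ binM B (voc B ψ.L) PUnit.unit.{u + 1} z u)) →
        y = z)
    (.all hκ (.all hκ (.all hκ (.imp hΛ (.all hκ (.imp hΛ (.E (.var _) (.var _)) (.iff hΛ
      (.bin _ (.var _) (.var _)) (.bin _ (.var _) (.var _))))) (.eq (.var _) (.var _))))))
  refine ⟨spec1 φ, ⟨φ, rfl⟩, ?_, ?_⟩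
  · obtain ⟨σ, hσ⟩ := hb
    refine ⟨2 ^ σ, ?_⟩
    rw [hφ]
    rintro _ ⟨M, _, ⟨x⟩, hM, h1, h2, rfl⟩
    refine le_trans ?_ (power_le_power_left two_ne_zero (hσ (h1 x).mem_spec1))
    rw [← mk_set]
    refine mk_le_of_injective (f := fun y => {u | binM B (voc B ψ.L) PUnit.unit.{u + 1} y u.1}) ?_
    intro y z hyz
    exact h2 x y z fun u hu => Set.ext_iff.1 hyz ⟨u, hu⟩
  · obtain ⟨A, _, hA, hC, rfl⟩ := hχ
    have hle : #A ≤ #(Set A) := by rw [mk_set]; exact (cantor _).le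
    obtain ⟨c⟩ := hC.mk_le.trans hle
    obtain ⟨k⟩ := hC.mk_ultra_le.trans hle
    obtain ⟨S, hS, -, -, -, hN, -, -, hbin⟩ := exists_baStructure (T := PUnit.{u + 1})
      (L := voc B ψ.L) c k (fun _ => A) (fun _ a => {a}) (fun _ => Set.singleton_injective)
      (fun _ => id) (fun _ => ∅) (fun _ y u => ∃ a, u = {a} ∧ a ∈ y)
    rw [hφ]
    refine ⟨Set A, S, ⟨∅⟩, hS, fun x => ⟨A, _, _, hN x, hA, hC⟩, fun x y z h => ?_, mk_set⟩
    ext a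
    have := h {a} (((hN x).mem_iff _).2 ⟨a, rfl⟩)
    rw [hbin, hbin] at this
    simpa using this

/-- In a well-order of length at least `c`, exactly `c` elements have fewer than `c` predecessors.
-/
theorem mk_initial_eq {o : Ordinal.{u}} {c : Cardinal.{u}} (h : c.ord ≤ o) :
    #{x : o.ToType | #(Set.Iio x) < c} = c := by
  refine le_antisymm (mk_lt_le c) ?_
  obtain ⟨f⟩ : Nonempty (c.ord.ToType ≤i o.ToType) := Ordinal.type_le_iff.1 (by simpa using h)
  have h1 : ∀ y, #(Set.Iio (f y)) < c := by
    intro y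
    rw [← f.image_Iio y]
    exact mk_image_le.trans_lt (mk_Iio_toType_lt y)
  conv_lhs => rw [← mk_ord_toType c]
  exact mk_le_of_injective (f := fun y => (⟨_, h1 y⟩ : {x : o.ToType | #(Set.Iio x) < c}))
    fun y z hyz => f.injective (congrArg Subtype.val hyz)

/-- If any two elements are comparable and every element has fewer than `σ` predecessors, then there
are at most `σ` elements. -/
theorem mk_le_of_total {M : Type u} {σ : Cardinal.{u}} (hσ : ℵ₀ ≤ σ) (r : M → M → Prop)
    (ht : ∀ x y, r x y ∨ x = y ∨ r y x) (hr : ∀ x, #{y | r y x} < σ) : #M ≤ σ := by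
  by_contra hc
  push Not at hc
  obtain ⟨Z, hZ⟩ := le_mk_iff_exists_set.1 hc.le
  have h1 : #(Z ∪ ⋃ z : Z, {y | r y z} : Set M) < #M := by
    refine ((mk_union_le _ _).trans (add_le_of_le hσ hZ.le ?_)).trans_lt hc
    exact (mk_iUnion_le _).trans (mul_le_of_le hσ hZ.le (ciSup_le' fun z => (hr z).le))
  obtain ⟨x, hx⟩ : ∃ x, x ∉ (Z ∪ ⋃ z : Z, {y | r y z} : Set M) := by
    by_contra hall
    push Not at hall
    rw [Set.eq_univ_of_forall hall, mk_univ] at h1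
    exact lt_irrefl _ h1
  have h2 : Z ⊆ {y | r y x} := by
    intro z hz
    rcases ht z x with h | h | h
    · exact h
    · exact absurd (Or.inl (h ▸ hz)) hx
    · exact absurd (Or.inr (Set.mem_iUnion.2 ⟨⟨z, hz⟩, h⟩)) hx
  exact absurd (hZ.ge.trans (mk_le_mk_of_subset h2)) (not_le.2 (hr x))

/-- The supremum of a bounded spectrum is the greatest element of some spectrum. If it does not
belong to the given spectrum, then the models of the new sentence are ordered so that each proper
initial segment is contained in a model of the given one. -/
theorem exists_baSpectra1_sSup (hlam : ℵ₀ ≤ lam) (hκ : ℵ₀ ≤ κ) (hκlam : κ ≤ Order.succ lam)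
    (hB : #B ≤ lam) {S : Set Cardinal.{u}} (hS : S ∈ baSpectra1 lam κ B) (hb : BddAbove S)
    (hne : S.Nonempty) : ∃ S' ∈ baSpectra1 lam κ B, IsGreatest S' (sSup S) := by
  by_cases hmax : sSup S ∈ S
  · exact ⟨S, hS, hmax, fun χ hχ => le_csSup hb hχ⟩
  obtain ⟨ψ, rfl⟩ := hS
  have hΛ : ℵ₀ < Order.succ lam := Order.lt_succ_iff.2 hlam
  obtain ⟨φ, hφ⟩ := exists_baSentence_family hlam hκ hκlam hB id_surjective ψ
    (T := PUnit.{u + 1}) (by simpa using one_lt_aleph0.le.trans hlam)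
    (D := fun M _ => (∀ x y : M, binM B (voc B ψ.L) PUnit.unit.{u + 1} x y ∨ x = y ∨
      binM B (voc B ψ.L) PUnit.unit.{u + 1} y x) ∧ ∀ x y : M,
        binM B (voc B ψ.L) PUnit.unit.{u + 1} y x → EM B PUnit.{u + 1} (voc B ψ.L) x y)
    (.and hΛ (.all hκ (.all hκ (.or hΛ (.bin _ (.var _) (.var _)) (.or hΛ (.eq (.var _) (.var _))
      (.bin _ (.var _) (.var _)))))) (.all hκ (.all hκ (.imp hΛ (.bin _ (.var _) (.var _))
        (.E (.var _) (.var _))))))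
  refine ⟨spec1 φ, ⟨φ, rfl⟩, ?_⟩
  rw [hφ, IsGreatest, and_comm]
  constructor
  · rintro _ ⟨M, _, -, hM, h1, ⟨h2, h3⟩, rfl⟩
    have hlim : Order.IsSuccPrelimit (sSup (spec1 ψ)) := by
      by_contra hlim
      exact hmax (csSup_mem_of_not_isSuccPrelimit hlim)
    have hlt : ∀ χ ∈ spec1 ψ, χ < sSup (spec1 ψ) := fun χ hχ =>
      lt_of_le_of_ne (le_csSup hb hχ) fun h => hmax (h ▸ hχ)
    have hσ : ℵ₀ ≤ sSup (spec1 ψ) := aleph0_le_of_isSuccLimit (Cardinal.isSuccLimit_iff.2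
      ⟨(bot_le.trans_lt (hlt _ hne.some_mem)).ne', hlim⟩)
    exact mk_le_of_total hσ _ h2 fun x =>
      (mk_le_mk_of_subset (h3 x)).trans_lt (hlt _ (h1 x).mem_spec1)
  · set σ := sSup (spec1 ψ)
    have hx : ∀ x : σ.ord.ToType, ∃ (A : Type u) (_ : (voc B ψ.L).Structure A),
        IsModel A ψ.sentence ∧ IsBAStructure B ψ.L A ∧ #(Set.Iio x) < #A := by
      intro x
      obtain ⟨_, ⟨A, _, hA, hC, rfl⟩, h⟩ := exists_lt_of_lt_csSup hne (mk_Iio_toType_lt x)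
      exact ⟨A, _, hA, hC, h⟩
    choose A hAs hA hC hAx using hx
    have hle : ∀ x, #(A x) ≤ σ := fun x => le_csSup hb ⟨A x, _, hA x, hC x, rfl⟩
    have hj : ∀ x, Nonempty (A x ≃ {y : σ.ord.ToType | #(Set.Iio y) < #(A x)}) := fun x => by
      rw [← Cardinal.eq, mk_initial_eq (ord_le_ord.2 (hle x))]
    -- `N_x` is copied onto the initial segment of length `#(A x)`, which contains `x`
    let j := fun x => (hj x).some
    obtain ⟨_, A₀, _, hA₀, hC₀, rfl⟩ := hne
    have hle₀ : #A₀ ≤ #σ.ord.ToType := by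
      rw [mk_ord_toType]; exact le_csSup hb ⟨A₀, _, hA₀, hC₀, rfl⟩
    obtain ⟨c⟩ := hC₀.mk_le.trans hle₀
    obtain ⟨k⟩ := hC₀.mk_ultra_le.trans hle₀
    obtain ⟨i₀⟩ := hle₀
    have hne : Nonempty σ.ord.ToType := hA₀.1.map i₀
    obtain ⟨S, hS, -, -, -, hN, -, -, hbin⟩ := exists_baStructure (T := PUnit.{u + 1})
      (L := voc B ψ.L) c k A (fun x a => (j x a).1)
      (fun x a a' h => (j x).injective (Subtype.ext h))
      (fun _ => id) (fun _ => hne.some) (fun _ => (· < ·))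
    refine ⟨_, S, hne, hS, fun x => ⟨A x, _, _, hN x, hA x, hC x⟩, ⟨fun x y => ?_, fun x y h => ?_⟩,
      mk_ord_toType σ⟩
    · rw [hbin, hbin]; exact lt_trichotomy x y
    · rw [hbin] at h
      rw [(hN x).mem_iff]
      have hy : #(Set.Iio y) < #(A x) :=
        (mk_le_mk_of_subset (Set.Iio_subset_Iio h.le)).trans_lt (hAx x)
      exact ⟨(j x).symm ⟨y, hy⟩, by simp⟩

/-- There are non-empty bounded spectra: take the sentence that says that there is just one element,
which does not mention the Boolean algebra. -/
theorem exists_baSpectra1_nonempty (hlam : ℵ₀ ≤ lam) (hκ : ℵ₀ ≤ κ) (hκlam : κ ≤ Order.succ lam) :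
    ∃ S ∈ baSpectra1 lam κ B, BddAbove S ∧ S.Nonempty := by
  have hΛ : ℵ₀ < Order.succ lam := Order.lt_succ_iff.2 hlam
  let L : FirstOrder.Language.{u, u} := subLang (univLang PUnit) ∅
  have : IsEmpty (Σ n, L.Functions n) := ⟨fun ⟨_, f⟩ => f.2⟩
  obtain ⟨φ, hφ⟩ := Definable.exists_sentence (Λ := Order.succ lam) (L := L) hκ
    (C := fun M _ => ∀ x y : M, x = y) (.all hκ (.all hκ (.eq (.var _) (.var _))))
  have hb : BddAbove (spec φ) := by
    refine ⟨1, ?_⟩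
    rintro _ ⟨M, _, hM, rfl⟩
    exact Cardinal.le_one_iff_subsingleton.2 ⟨((hφ M).1 hM).2⟩
  have h1 : (1 : Cardinal.{u}) ∈ spec φ :=
    ⟨PUnit, ⟨fun _ _ => PUnit.unit, fun _ _ => True⟩, (by
      let : L.Structure PUnit.{u + 1} := ⟨fun _ _ => PUnit.unit, fun _ _ => True⟩
      exact (hφ PUnit).2 ⟨⟨PUnit.unit⟩, fun _ _ => rfl⟩), by simp⟩
  obtain ⟨S, hS, hb', χ, hχ, -⟩ := dominated_infSpectra (B := B) hlam hκ hκlam _ ⟨L, φ, rfl⟩ hb _ h1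
  exact ⟨S, hS, hb', χ, hχ⟩

end Comparison

/-! ### Strong limits -/

section Limits

variable {lam κ : Cardinal.{u}} {B : Type u} [BooleanAlgebra B]

theorem two_power_lt_hanf (hlam : ℵ₀ ≤ lam) (hκ : ℵ₀ ≤ κ) (hκlam : κ ≤ Order.succ lam)
    (hB : #B ≤ lam) {μ : Cardinal.{u}} (hμ : μ < hanf (baSpectra1 lam κ B)) :
    2 ^ μ < hanf (baSpectra1 lam κ B) := by
  obtain ⟨S, hS, hb, χ, hχ, hle⟩ := exists_of_lt_hanf hμ
  obtain ⟨S', hS', hb', h⟩ := exists_baSpectra1_power hlam hκ hκlam hB hS hb hχ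
  exact (power_le_power_left two_ne_zero hle).trans_lt
    (lt_hanf (exists_isHanfBound_baSpectra1 hlam B) hS' hb' h)

/-- Suprema of bounded spectra are attained by bounded spectra, so they are below the Hanf number.
The supremum of the empty spectrum is `0`. -/
theorem sSup_lt_hanf (hlam : ℵ₀ ≤ lam) (hκ : ℵ₀ ≤ κ) (hκlam : κ ≤ Order.succ lam)
    (hB : #B ≤ lam) {S : Set Cardinal.{u}} (hS : S ∈ baSpectra1 lam κ B) (hb : BddAbove S) :
    sSup S < hanf (baSpectra1 lam κ B) := by
  rcases S.eq_empty_or_nonempty with rfl | hne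
  · obtain ⟨S, hS, hb, χ, hχ⟩ := exists_baSpectra1_nonempty (B := B) hlam hκ hκlam
    rw [csSup_empty]
    exact bot_le.trans_lt (lt_hanf (exists_isHanfBound_baSpectra1 hlam B) hS hb hχ)
  · obtain ⟨S', hS', h⟩ := exists_baSpectra1_sSup hlam hκ hκlam hB hS hb hne
    exact lt_hanf (exists_isHanfBound_baSpectra1 hlam B) hS' h.bddAbove h.1

theorem isStrongLimit_hanf (hlam : ℵ₀ ≤ lam) (hκ : ℵ₀ ≤ κ) (hκlam : κ ≤ Order.succ lam)
    (hB : #B ≤ lam) : (hanf (baSpectra1 lam κ B)).IsStrongLimit where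
  ne_zero := by
    have := sSup_lt_hanf hlam hκ hκlam hB (S := (exists_baSpectra1_nonempty hlam hκ hκlam).choose)
      (exists_baSpectra1_nonempty (B := B) hlam hκ hκlam).choose_spec.1
      (exists_baSpectra1_nonempty hlam hκ hκlam).choose_spec.2.1
    exact (bot_le.trans_lt this).ne'
  isStrongPrelimit := fun _ h => two_power_lt_hanf hlam hκ hκlam hB h

/-- Both kinds of spectra give the same Hanf number. -/
theorem hanf_baSpectra1 (hlam : ℵ₀ ≤ lam) (hκ : κ.IsRegular) (hκlam : κ ≤ Order.succ lam)
    (hB : #B ≤ lam) : hanf (baSpectra1 lam κ B) = hanfB lam κ B := by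
  have h := dominated_baSpectra1_baSpectra2 hlam hκ hκlam hB
  have h' := Dominated.of_subset (baSpectra2_subset hlam hκ.aleph0_le hκlam hB)
  have hb := exists_isHanfBound_baSpectra1 (κ := κ) hlam B
  exact le_antisymm (h.hanf_le_hanf ⟨_, h'.isHanfBound hb.choose_spec⟩) (h'.hanf_le_hanf hb)

end Limits

/-! ### The free Boolean algebra -/

section Free

variable {lam κ : Cardinal.{u}}

/-- The elements of the free Boolean algebra are values of Boolean terms. -/
theorem mk_freeBA_le (hlam : ℵ₀ ≤ lam) : #(FreeBA lam) ≤ lam := by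
  classical
  let β : Option Bool ⊕ lam.out → Type := fun a => match a with
    | .inl none => Empty
    | .inl (some false) => Unit
    | .inl (some true) => Bool
    | .inr _ => Empty
  let β' : (Option Bool ⊕ lam.out) → Type u := fun a => ULift (β a)
  have hβ : ∀ a, Finite (β' a) := by
    rintro ((_ | _ | _) | _) <;> dsimp [β', β] <;> infer_instance
  let ev : WType β' → Set (Set lam.out) := WType.elim _ fun p => match p with
    | ⟨.inl none, _⟩ => ⊥
    | ⟨.inl (some false), f⟩ => (f ⟨()⟩)ᶜ
    | ⟨.inl (some true), f⟩ => f ⟨false⟩ ⊔ f ⟨true⟩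
    | ⟨.inr i, _⟩ => {X | i ∈ X}
  have hev : ∀ s : FreeBA lam, ∃ w, ev w = s.1 := by
    rintro ⟨s, hs⟩
    induction hs using BooleanSubalgebra.closure_bot_sup_induction with
    | mem x hx =>
      obtain ⟨i, rfl⟩ := hx
      exact ⟨.mk (.inr i) fun e => e.down.elim, rfl⟩
    | bot => exact ⟨.mk (.inl none) fun e => e.down.elim, rfl⟩
    | sup x hx y hy ihx ihy =>
      obtain ⟨v, rfl⟩ := ihx
      obtain ⟨w, rfl⟩ := ihy
      exact ⟨.mk (.inl (some true)) fun b : ULift Bool => match b with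
        | ⟨false⟩ => v
        | ⟨true⟩ => w, rfl⟩
    | compl x hx ih =>
      obtain ⟨v, rfl⟩ := ih
      exact ⟨.mk (.inl (some false)) fun _ => v, rfl⟩
  choose w hw using hev
  refine (mk_le_of_injective (f := w) fun s t h => Subtype.ext ?_).trans
    ((WType.cardinalMk_le_max_aleph0_of_finite (β := β')).trans (max_le ?_ hlam))
  · rw [← hw, ← hw, h]
  · rw [mk_sum]
    simpa using add_le_of_le hlam (natCast_lt_aleph0.le.trans hlam : ((3 : ℕ) : Cardinal) ≤ lam)
      le_rfl

/-- Every Boolean algebra of cardinality at most `λ` is a quotient of the free one. -/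
theorem exists_surjective_freeBA {C : Type u} [BooleanAlgebra C] (hC : #C ≤ lam) :
    ∃ π : BoundedLatticeHom (FreeBA lam) C, Function.Surjective π := by
  rw [← mk_out lam] at hC
  obtain ⟨f⟩ := hC
  obtain ⟨π, hπ, -⟩ := FreeBA.existsUnique_lift lam (Function.invFun f)
  refine ⟨π, fun c => ?_⟩
  obtain ⟨i, hi⟩ := Function.invFun_surjective f.injective c
  exact ⟨_, (hπ i).trans hi⟩

theorem dominated_allBASpectra (hlam : ℵ₀ ≤ lam) (hκ : ℵ₀ ≤ κ) (hκlam : κ ≤ Order.succ lam) :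
    Dominated (allBASpectra lam κ) (baSpectra1 lam κ (FreeBA lam)) := by
  rintro _ ⟨C, _, hC, ψ, rfl⟩
  obtain ⟨π, hπ⟩ := exists_surjective_freeBA hC
  exact ((Dominated.of_subset (baSpectra2_subset hlam hκ hκlam hC)).trans
    (dominated_baSpectra1_of_surjective hlam hκ hκlam (mk_freeBA_le hlam) hπ)) _ ⟨ψ, rfl⟩

theorem exists_isHanfBound_allBASpectra (hlam : ℵ₀ ≤ lam) (hκ : ℵ₀ ≤ κ)
    (hκlam : κ ≤ Order.succ lam) : ∃ μ, IsHanfBound (allBASpectra lam κ) μ :=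
  ⟨_, (dominated_allBASpectra hlam hκ hκlam).isHanfBound
    (exists_isHanfBound_baSpectra1 hlam _).choose_spec⟩

theorem exists_isHanfBound_infSpectra (hlam : ℵ₀ ≤ lam) (hκ : ℵ₀ ≤ κ)
    (hκlam : κ ≤ Order.succ lam) : ∃ μ, IsHanfBound (infSpectra (Order.succ lam) κ) μ :=
  ⟨_, (dominated_infSpectra (B := FreeBA lam) hlam hκ hκlam).isHanfBound
    (exists_isHanfBound_baSpectra1 hlam _).choose_spec⟩

theorem hanfB_freeBA (hlam : ℵ₀ ≤ lam) (hκ : κ.IsRegular) (hκlam : κ ≤ Order.succ lam) :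
    hanfB lam κ (FreeBA lam) = hanfBa lam κ := by
  refine le_antisymm ?_ ?_
  · refine (Dominated.of_subset ?_).hanf_le_hanf
      (exists_isHanfBound_allBASpectra hlam hκ.aleph0_le hκlam)
    rintro _ ⟨ψ, rfl⟩
    exact ⟨_, _, mk_freeBA_le hlam, ψ, rfl⟩
  · rw [← hanf_baSpectra1 hlam hκ hκlam (mk_freeBA_le hlam)]
    exact (dominated_allBASpectra hlam hκ.aleph0_le hκlam).hanf_le_hanf
      (exists_isHanfBound_baSpectra1 hlam _)

end Free

/-! ### Longer conjunctions -/

section Longer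

variable {lam κ : Cardinal.{u}} {B : Type u} [BooleanAlgebra B]

/-- There are at most `2 ^ λ` sentences up to renaming of symbols, so a single sentence of
`𝕃_{(2^λ)⁺,κ}` can describe the disjoint union of a family of models, one for each of those
sentences whose spectrum has a greatest element. These greatest elements are cofinal in the
Hanf number, which is a strong limit. -/
theorem exists_infSpectra_hanf_le (hlam : ℵ₀ ≤ lam) (hκ : ℵ₀ ≤ κ) (hκlam : κ ≤ Order.succ lam)
    (hB : #B ≤ lam) : ∃ S ∈ infSpectra (Order.succ (2 ^ lam)) κ, BddAbove S ∧
      ∃ χ ∈ S, hanf (baSpectra1 lam κ B) ≤ χ := by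
  have hXlam : (univLang lam.out).card ≤ lam := by rw [card_univLang (by simpa using hlam), mk_out]
  let X := univLang lam.out
  let s : InfSentence (Order.succ lam) κ (voc B X) → BASentence lam κ B := fun ψ => ⟨X, hXlam, ψ⟩
  let J := {ψ : InfSentence (Order.succ lam) κ (voc B X) //
    BddAbove (spec1 (s ψ)) ∧ sSup (spec1 (s ψ)) ∈ spec1 (s ψ)}
  have h2 : lam < 2 ^ lam := cantor lam
  have h2' : (2 : Cardinal.{u}) ^ lam < Order.succ (2 ^ lam) := Order.lt_succ _
  have hΛ : ℵ₀ < Order.succ ((2 : Cardinal.{u}) ^ lam) := (hlam.trans_lt h2).trans h2'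
  have hvoc : (voc B X).card ≤ lam := card_voc_le hlam hB hXlam
  have hJ : #J ≤ 2 ^ lam := (mk_subtype_le _).trans ((mk_subtype_le _).trans
    (mk_infFormula_le hlam hκlam (hvoc.trans h2.le)))
  have hJ' : lift.{u} #J < lift.{u} (Order.succ ((2 : Cardinal.{u}) ^ lam)) := by
    simpa using hJ
  obtain ⟨φ, hφ⟩ := Definable.exists_sentence (Λ := Order.succ (2 ^ lam)) (κ := κ)
    (L := voc PEmpty.{u + 1} (auxLang J (voc B X))) hκ
    (C := fun M _ => (∀ j : J, ∃ x : M, x = cstM PEmpty.{u + 1} (voc B X) j ∧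
      ParModel PEmpty.{u + 1} J j.1 x ∧ ParBasic PEmpty.{u + 1} J B X x ∧
        ParFull PEmpty.{u + 1} J B X x) ∧ ∀ y : M, ∃ j : J,
          EM PEmpty.{u + 1} J (voc B X) (cstM PEmpty.{u + 1} (voc B X) j) y)
    (.and hΛ (.conj hJ' fun j => .ex hκ (.and hΛ (.eq (.var _) (.cst j)) (.and hΛ
      (.parModel hκ hΛ (hκlam.trans (Order.succ_le_succ h2.le)) (Order.succ_le_succ h2.le)
        (hvoc.trans_lt (h2.trans h2')) _ (.var _)) (.and hΛ
      ((Definable.parBasic hκ hΛ (hB.trans_lt (h2.trans h2'))).reindex fun _ => Sum.inr ())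
      ((Definable.parFull hκ hΛ ((power_le_power_left two_ne_zero hB).trans_lt h2')).reindex
        fun _ => Sum.inr ())))))
      (.all hκ (.disj hJ' fun j => .E (.cst j) (.var _))))
  refine ⟨spec φ, ⟨_, φ, rfl⟩, ?_, ?_⟩
  · refine ⟨Cardinal.sum fun j : J => sSup (spec1 (s j.1)), ?_⟩
    rintro _ ⟨M, _, hM, rfl⟩
    obtain ⟨-, h1, h3⟩ := (hφ M).1 hM
    have hcov : (Set.univ : Set M) = ⋃ j : J,
        {y | EM PEmpty.{u + 1} J (voc B X) (cstM PEmpty.{u + 1} (voc B X) j) y} := by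
      ext y; simpa using h3 y
    rw [← mk_univ, hcov]
    refine (mk_iUnion_le_sum_mk).trans (Cardinal.sum_le_sum _ _ fun j => ?_)
    obtain ⟨x, rfl, hx⟩ := h1 j
    exact le_csSup j.2.1 (ParGood.mem_spec1 (ψ := s j.1) ((parGood_iff _ _).2 hx))
  · choose N hNs hN hNB hNc using fun j : J => j.2.2
    let M := Σ j, N j
    obtain ⟨S, -, -, -, -, hpar, -, hcst, -⟩ := exists_structure (B := PEmpty.{u + 1}) (T := J)
      (L := voc B X) (M := M) (fun b => b.elim) (fun _ => False) (fun _ => False)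
      (fun _ _ => False) (fun x => N x.1) (fun x => Sigma.mk x.1) (fun x => sigma_mk_injective)
      (fun _ => id) (fun j => ⟨j, (hN j).1.some⟩) (fun _ _ _ => False)
    -- by the strong limit property, some model of the family is larger than the union
    have hle : hanf (baSpectra1 lam κ B) ≤ #M := by
      by_contra hlt
      push Not at hlt
      obtain ⟨S, hS, hb, χ, hχ, hle⟩ :=
        exists_of_lt_hanf (two_power_lt_hanf hlam hκ hκlam hB hlt)
      obtain ⟨S', hS', hmem⟩ := exists_baSpectra1_sSup hlam hκ hκlam hB hS hb ⟨χ, hχ⟩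
      obtain ⟨ψ, rfl⟩ := baSpectra1_subset_range hlam B hS'
      let j : J := ⟨ψ, hmem.bddAbove, by rw [hmem.csSup_eq]; exact hmem.1⟩
      have h1 : #(N j) = sSup S := (hNc j).trans hmem.csSup_eq
      have h3 : #(N j) ≤ #M := mk_le_of_injective (sigma_mk_injective (i := j))
      exact absurd (hle.trans ((le_csSup hb hχ).trans (h1.ge.trans h3))) (not_le.2 (cantor _))
    refine ⟨#M, ⟨M, S, (hφ M).2 ⟨?_, fun j => ⟨_, rfl, ?_⟩, fun y => ⟨y.1, ?_⟩⟩, rfl⟩, hle⟩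
    · by_contra hM
      rw [not_nonempty_iff] at hM
      rw [mk_eq_zero] at hle
      exact (isStrongLimit_hanf hlam hκ hκlam hB).ne_zero (le_bot_iff.1 hle)
    · rw [hcst]
      exact (parGood_iff _ _).1 ⟨N j, _, _, hpar _, hN j, hNB j⟩
    · rw [hcst, (hpar _).mem_iff]
      exact ⟨y.2, rfl⟩

end Longer

/-! ### Layered structures -/

/-- `W` is a strict weak order, that is, `M` is divided into linearly ordered layers. For fixed `x`,
the layers below `x` are coded in `Q` by `h x`, and each element is determined by its layer and by
its `ε`-predecessors in `P` and in the lower layers. -/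
structure Layered {M : Type u} (P Q : M → Prop) (W ε : M → M → Prop) (h : M → M → M) : Prop where
  trans : ∀ x y z, W x y → W y z → W x z
  weak : ∀ x y z, W x y → W x z ∨ W z y
  code_mem : ∀ x y, Q (h x y)
  code_inj : ∀ x y z, W y x → W z x → h x y = h x z → ¬ W y z
  ext : ∀ y z, ¬ W y z → ¬ W z y → (∀ u, W u y ∨ P u → (ε u y ↔ ε u z)) → y = z

namespace Layered

variable {M : Type u} {P Q : M → Prop} {W ε : M → M → Prop} {h : M → M → M}

/-- If the functions `D n` decode all sequences in `Q`, and no element of `Q` codes a sequence of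
codes of descending layers below some `x`, then there is no infinite descending sequence of layers.
-/
theorem wellFounded (H : Layered P Q W ε h) {D : ℕ → M → M}
    (hD : ∀ s : ℕ → M, (∀ n, Q (s n)) → ∃ q, Q q ∧ ∀ n, D n q = s n)
    (hW : ∀ x q, Q q → ¬ ∀ n, ∃ y z, W y x ∧ W z y ∧ h x y = D n q ∧ h x z = D (n + 1) q) :
    WellFounded W := by
  rw [wellFounded_iff_isEmpty_descending_chain]
  refine ⟨fun ⟨f, hf⟩ => ?_⟩
  have h0 : ∀ n, W (f (n + 1)) (f 0) := fun n => by
    induction n with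
    | zero => exact hf 0
    | succ n ih => exact H.trans _ _ _ (hf _) ih
  obtain ⟨q, hq, hqD⟩ := hD (fun n => h (f 0) (f (n + 1))) fun n => H.code_mem _ _
  exact hW (f 0) q hq fun n => ⟨f (n + 1), f (n + 2), h0 n, hf _, (hqD n).symm, (hqD (n + 1)).symm⟩

/-- In a well-founded structure, no sequence consists of the codes of descending layers. Each term
of the sequence is the code of at most one layer below `x`. -/
theorem not_descending (H : Layered P Q W ε h) (hwf : WellFounded W) (D : ℕ → M → M) (x q : M) :
    ¬ ∀ n, ∃ y z, W y x ∧ W z y ∧ h x y = D n q ∧ h x z = D (n + 1) q := by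
  intro hn
  choose y z hy hz hyD hzD using hn
  refine (wellFounded_iff_isEmpty_descending_chain.1 hwf).false ⟨y, fun n => ?_⟩
  refine (H.weak _ _ (y (n + 1)) (hz n)).resolve_left ?_
  exact H.code_inj x _ _ (H.trans _ _ _ (hz n) (hy n)) (hy _) ((hzD n).trans (hyD _).symm)

theorem rank_lt_iff (H : Layered P Q W ε h) [IsWellFounded M W] {x y : M} :
    IsWellFounded.rank W y < IsWellFounded.rank W x ↔ W y x := by
  refine ⟨fun hlt => ?_, IsWellFounded.rank_lt_of_rel⟩
  by_contra hyx
  refine absurd hlt (not_lt.2 ?_)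
  rw [IsWellFounded.rank_eq W x]
  refine Ordinal.iSup_le fun u => Order.succ_le_of_lt (IsWellFounded.rank_lt_of_rel ?_)
  exact (H.weak _ _ y u.2).resolve_right hyx

/-- The layers below `x` have different codes in `Q`, so there are at most `|Q|` of them. -/
theorem rank_lt_ord (H : Layered P Q W ε h) [IsWellFounded M W] {c : Cardinal.{u}}
    (hQ : #{x | Q x} ≤ c) (x : M) : IsWellFounded.rank W x < (Order.succ c).ord := by
  rw [lt_ord, Order.lt_succ_iff]
  refine le_trans ?_ hQ
  rw [← mk_toType]
  have hy : ∀ i : (IsWellFounded.rank W x).ToType, ∃ y,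
      IsWellFounded.rank W y = (Ordinal.ToType.mk.symm i).1 := fun i =>
    IsWellFounded.mem_range_rank_of_le (Set.mem_Iio.1 (Ordinal.ToType.mk.symm i).2).le
  choose y hy using hy
  have hyx : ∀ i, W (y i) x := fun i => by
    rw [← H.rank_lt_iff, hy]; exact (Ordinal.ToType.mk.symm i).2
  refine mk_le_of_injective (f := fun i => (⟨h x (y i), H.code_mem _ _⟩ : {x | Q x})) ?_
  intro i j hij
  have hij : h x (y i) = h x (y j) := congrArg Subtype.val hij
  have h1 := H.code_inj x _ _ (hyx i) (hyx j) hij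
  have h2 := H.code_inj x _ _ (hyx j) (hyx i) hij.symm
  rw [← H.rank_lt_iff, not_lt] at h1 h2
  have h3 := le_antisymm h2 h1
  rw [hy, hy] at h3
  exact Ordinal.ToType.mk.symm.injective (Subtype.ext h3)

end Layered

/-- If every element is determined by its rank and by a subset of the union of `P` and the set of
elements of lower rank, then the number of elements of rank less than `α` is bounded in terms of
`α` and `|P|`. -/
theorem exists_bound_of_rank (lam : Cardinal.{u}) (α : Ordinal.{u}) : ∃ σ : Cardinal.{u},
    ∀ (M : Type u) (r : M → Ordinal.{u}) (P : M → Prop) (ε : M → M → Prop), #{x | P x} ≤ lam →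
      (∀ y z, r y = r z → (∀ u, r u < r y ∨ P u → (ε u y ↔ ε u z)) → y = z) →
        #{x | r x < α} ≤ σ := by
  induction α using WellFoundedLT.induction with
  | ind α ih =>
  choose σ hσ using ih
  let b : α.ToType → Ordinal.{u} := fun i => (Ordinal.ToType.mk.symm i).1
  have hb : ∀ i, b i < α := fun i => (Ordinal.ToType.mk.symm i).2
  refine ⟨Cardinal.sum fun i => 2 ^ (σ (b i) (hb i) + lam), fun M r P ε hP hext => ?_⟩
  have hcov : {x | r x < α} ⊆ ⋃ i : α.ToType, {x | r x = b i} := fun x hx =>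
    Set.mem_iUnion.2 ⟨Ordinal.ToType.mk ⟨r x, hx⟩, by simp [b]⟩
  refine (mk_le_mk_of_subset hcov).trans ((mk_iUnion_le_sum_mk).trans
    (Cardinal.sum_le_sum _ _ fun i => ?_))
  have h1 : #({u | r u < b i} ∪ {u | P u} : Set M) ≤ σ (b i) (hb i) + lam :=
    (mk_union_le _ _).trans (add_le_add (hσ _ _ M r P ε hP hext) hP)
  refine le_trans ?_ (power_le_power_left two_ne_zero h1)
  rw [← mk_set]
  refine mk_le_of_injective (f := fun x : {x | r x = b i} => {u | ε u.1 x.1}) fun x y hxy => ?_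
  refine Subtype.ext (hext _ _ (x.2.trans y.2.symm) fun u hu => ?_)
  rw [show r x.1 = b i from x.2] at hu
  exact Set.ext_iff.1 hxy ⟨u, hu⟩

/-- The cardinalities of well-founded layered structures with `|P| ≤ λ` and `|Q| ≤ 2 ^ λ` are
bounded. -/
theorem Layered.exists_bound (lam : Cardinal.{u}) : ∃ σ : Cardinal.{u},
    ∀ (M : Type u) (P Q : M → Prop) (W ε : M → M → Prop) (h : M → M → M), Layered P Q W ε h →
      #{x | P x} ≤ lam → #{x | Q x} ≤ 2 ^ lam → WellFounded W → #M ≤ σ := by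
  obtain ⟨σ, hσ⟩ := exists_bound_of_rank lam (ord (Order.succ (2 ^ lam)))
  refine ⟨σ, fun M P Q W ε h H hP hQ hwf => ?_⟩
  have : IsWellFounded M W := ⟨hwf⟩
  have := hσ M (IsWellFounded.rank W) P ε hP fun y z hyz hu => H.ext y z
    (fun h => (H.rank_lt_iff.2 h).ne hyz) (fun h => (H.rank_lt_iff.2 h).ne hyz.symm)
    fun u hu' => hu u (hu'.imp_left H.rank_lt_iff.2)
  refine le_trans (le_of_eq ?_) this
  rw [← mk_univ]
  congr
  ext x
  simpa using H.rank_lt_ord hQ x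

/-- The elements of the initial ordinal of `ℶ_δ` can be divided into `δ` layers: the layer of index
`α` consists of the ordinals below `ℶ_α` that are not in lower layers. -/
theorem exists_layered {δ : Ordinal.{u}} (hδ : Order.IsSuccLimit δ)
    {P Q : (beth δ).ord.ToType → Prop} (hP : ℵ₀ ≤ #{x | P x})
    (hQ : ∀ α < δ, α.card ≤ #{x | Q x}) :
    ∃ W ε h, Layered P Q W ε h ∧ WellFounded W := by
  classical
  let M := (beth δ).ord.ToType
  have hex : ∀ x : M, ∃ α < δ, #(Set.Iio x) < beth α := by
    intro x
    have h1 := mk_Iio_toType_lt x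
    obtain ⟨α, hα⟩ := (lt_ciSup_iff' bddAbove_of_small).1 (h1.trans_eq (beth_limit hδ))
    exact ⟨α.1, α.2, hα⟩
  -- the index of the layer of `x`; it is `0` or a successor
  let r : M → Ordinal.{u} := fun x => sInf {α | #(Set.Iio x) < beth α}
  have hr : ∀ x, #(Set.Iio x) < beth (r x) := fun x =>
    csInf_mem (s := {α | #(Set.Iio x) < beth α}) ⟨_, (hex x).choose_spec.2⟩
  have hr' : ∀ x α, #(Set.Iio x) < beth α → r x ≤ α := fun x α hα =>
    csInf_le' (s := {α | #(Set.Iio x) < beth α}) hα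
  have hrδ : ∀ x, r x < δ := fun x => by
    obtain ⟨α, hα, h⟩ := hex x
    exact (hr' x α h).trans_lt hα
  have hcode : ∀ x, Nonempty ((r x).ToType ↪ {x | Q x}) := fun x => by
    rw [← Cardinal.le_def, mk_toType]
    exact hQ _ (hrδ x)
  have hbeth : ∀ x, beth (r x) ≤ 2 ^ #{u | r u < r x ∨ P u} := by
    intro x
    rcases Ordinal.zero_or_succ_or_isSuccLimit (r x) with h0 | ⟨β, hβ⟩ | hl
    · rw [h0, beth_zero]
      exact (hP.trans (mk_le_mk_of_subset fun u hu => Or.inr hu)).trans (cantor _).le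
    · have hβ' : β < r x := by rw [← hβ]; exact Order.lt_succ β
      rw [← hβ, beth_succ, hβ]
      refine power_le_power_left two_ne_zero ?_
      have h1 : (beth β).ord ≤ (beth δ).ord := ord_le_ord.2 (beth_mono (hβ'.trans (hrδ x)).le)
      rw [← mk_initial_eq h1]
      exact mk_le_mk_of_subset fun u hu => Or.inl ((hr' u β hu).trans_lt hβ')
    · have h1 := hr x
      rw [beth_limit hl, lt_ciSup_iff' bddAbove_of_small] at h1
      obtain ⟨α, hα⟩ := h1
      exact absurd α.2 (not_lt.2 (hr' x α.1 hα))
  have hlayer : ∀ α, ∃ ι : M → Set M, ∀ y z, r y = α → r z = α →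
      ι y ∩ {u | r u < α ∨ P u} = ι z ∩ {u | r u < α ∨ P u} → y = z := by
    intro α
    rcases Set.eq_empty_or_nonempty {y | r y = α} with he | ⟨x, rfl⟩
    · exact ⟨fun _ => ∅, fun y z hy => by
        have : y ∈ {y | r y = α} := hy
        rw [he] at this; exact this.elim⟩
    · have h1 : #{y | r y = r x} ≤ #(Set {u | r u < r x ∨ P u}) := by
        rw [mk_set]
        refine le_trans ?_ (hbeth x)
        refine (mk_le_mk_of_subset fun y hy => ?_).trans (mk_lt_le (beth (r x)))
        have := hr y
        rwa [show r y = r x from hy] at this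
      obtain ⟨ι⟩ := h1
      refine ⟨fun y => if hy : r y = r x then Subtype.val '' ι ⟨y, hy⟩ else ∅,
        fun y z hy hz hyz => ?_⟩
      simp only [hy, hz, dif_pos] at hyz
      rw [Set.inter_eq_left.2 (by rintro _ ⟨u, -, rfl⟩; exact u.2),
        Set.inter_eq_left.2 (by rintro _ ⟨u, -, rfl⟩; exact u.2)] at hyz
      exact congrArg Subtype.val
        (ι.injective (Set.image_injective.2 Subtype.val_injective hyz))
  -- `ι α` assigns different sets of elements of lower layers to the elements of the layer `α`
  choose ι hι using hlayer
  have hQ0 : Nonempty {x | Q x} := by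
    have h1 : (1 : Ordinal.{u}) < δ := Ordinal.one_lt_of_isSuccLimit hδ
    rw [← mk_ne_zero_iff, ← Cardinal.one_le_iff_ne_zero]
    simpa using hQ 1 h1
  let g : ∀ x, (r x).ToType ↪ {x | Q x} := fun x => (hcode x).some
  refine ⟨fun x y => r x < r y, fun u y => u ∈ ι (r y) y, fun x y =>
    if h : r y < r x then g x (Ordinal.ToType.mk ⟨r y, h⟩) else hQ0.some, ⟨?_, ?_, ?_, ?_, ?_⟩,
    InvImage.wf r wellFounded_lt⟩
  · exact fun x y z => lt_trans
  · exact fun x y z h => lt_or_ge (r x) (r z) |>.imp_right fun h' => h'.trans_lt h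
  · intro x y
    split_ifs
    · exact (g x _).2
    · exact hQ0.some.2
  · intro x y z hy hz h
    rw [dif_pos hy, dif_pos hz] at h
    have h1 := congrArg Subtype.val (Ordinal.ToType.mk.injective ((g x).injective (Subtype.ext h)))
    exact not_lt.2 (le_of_eq h1.symm)
  · intro y z h1 h2 h
    have hyz := le_antisymm (not_lt.1 h2) (not_lt.1 h1)
    refine hι (r y) y z rfl hyz.symm ?_
    ext u
    simp only [Set.mem_inter_iff, and_congr_left_iff]
    intro hu
    rw [h u hu, hyz]

/-! ### Ultrafilters of the free Boolean algebra -/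

section FreeUltra

variable {lam : Cardinal.{u}}

/-- The ultrafilter of all `s` with `X ∈ s`; it contains the generators with index in `X`. -/
def freeUlt (X : Set lam.out) : Set (FreeBA lam) := {s | X ∈ s.1}

theorem isUltra_freeUlt (X : Set lam.out) : IsUltra (freeUlt X) where
  top_mem := Set.mem_univ X
  bot_notMem := Set.notMem_empty X
  mem_of_le := fun _ ha _ hab => hab ha
  inf_mem := fun _ ha _ hb => ⟨ha, hb⟩
  mem_or_compl_mem := fun a => (em (X ∈ a.1))

theorem gen_mem_freeUlt {X : Set lam.out} {i : lam.out} :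
    FreeBA.gen lam i ∈ freeUlt X ↔ i ∈ X := Iff.rfl

/-- Ultrafilters of the free Boolean algebra are determined by the generators that they contain. -/
theorem IsUltra.eq_of_gen {U V : Set (FreeBA lam)} (hU : IsUltra U) (hV : IsUltra V)
    (h : ∀ i, FreeBA.gen lam i ∈ U ↔ FreeBA.gen lam i ∈ V) : U = V := by
  ext ⟨s, hs⟩
  induction hs using BooleanSubalgebra.closure_bot_sup_induction with
  | mem x hx => obtain ⟨i, rfl⟩ := hx; exact h i
  | bot => exact ⟨fun h => (hU.bot_notMem h).elim, fun h => (hV.bot_notMem h).elim⟩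
  | sup x hx y hy ihx ihy =>
    have key : ∀ {U : Set (FreeBA lam)}, IsUltra U → ∀ a b : FreeBA lam,
        a ⊔ b ∈ U ↔ a ∈ U ∨ b ∈ U := by
      intro U hU a b
      refine ⟨fun hab => ?_, fun hab => hab.elim (fun ha => hU.mem_of_le _ ha _ le_sup_left)
        fun hb => hU.mem_of_le _ hb _ le_sup_right⟩
      by_contra hn
      push Not at hn
      have h1 := hU.inf_mem _ ((hU.mem_compl_iff a).2 hn.1) _ ((hU.mem_compl_iff b).2 hn.2)
      rw [← compl_sup, hU.mem_compl_iff] at h1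
      exact h1 hab
    exact (key hU ⟨x, hx⟩ ⟨y, hy⟩).trans ((or_congr ihx ihy).trans (key hV _ _).symm)
  | compl x hx ih =>
    exact (hU.mem_compl_iff ⟨x, hx⟩).trans ((not_congr ih).trans (hV.mem_compl_iff ⟨x, hx⟩).symm)

theorem mk_ultra_freeBA : #{U : Set (FreeBA lam) // IsUltra U} = 2 ^ lam := by
  have : Function.Bijective fun X : Set lam.out =>
      (⟨freeUlt X, isUltra_freeUlt X⟩ : {U : Set (FreeBA lam) // IsUltra U}) := by
    refine ⟨fun X Y h => ?_, fun U => ⟨{i | FreeBA.gen lam i ∈ U.1}, Subtype.ext ?_⟩⟩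
    · ext i
      have := Set.ext_iff.1 (congrArg Subtype.val h) (FreeBA.gen lam i)
      exact this
    · exact (isUltra_freeUlt _).eq_of_gen U.2 fun i => Iff.rfl
  rw [← mk_congr (Equiv.ofBijective _ this), mk_set, mk_out]

theorem le_mk_freeBA : lam ≤ #(FreeBA lam) := by
  have h : Function.Injective (FreeBA.gen lam) := fun i j h => by
    have h1 : FreeBA.gen lam j ∈ freeUlt {i} := h ▸ (rfl : i = i)
    exact (Set.mem_singleton_iff.1 h1).symm
  simpa using mk_le_of_injective h

end FreeUltra

/-! ### A sentence with a model of cardinality `ℶ_δ`, `δ = (2^λ)⁺` -/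

section Beth

variable {lam : Cardinal.{u}}

/-- The additional symbols of the sentence. Every kind of symbol of `auxLang` is available in
countable supply, more than is needed. -/
abbrev bethLang : FirstOrder.Language.{u, u} :=
  auxLang (ULift.{u} ℕ) (univLang (ULift.{u} ℕ))

section Interp

variable (lam) {M : Type u} [(voc (FreeBA lam) bethLang).Structure M]

/-- The relation between layers. -/
abbrev WM (x y : M) : Prop := binM (FreeBA lam) (univLang (ULift.{u} ℕ)) (ULift.up 0) x y

/-- The membership relation. -/
abbrev epsM (x y : M) : Prop := binM (FreeBA lam) (univLang (ULift.{u} ℕ)) (ULift.up 1) x y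

/-- The codes of the lower layers. -/
abbrev codeM (x y : M) : M :=
  parF (FreeBA lam) (ULift.{u} ℕ) (univLang (ULift.{u} ℕ)) (n := 1) (ULift.up 0) x ![y]

/-- The `n`-th member of a sequence of ultrafilters. -/
abbrev decM (n : ℕ) (x : M) : M := unM (FreeBA lam) (univLang (ULift.{u} ℕ)) (ULift.up n) x

variable {lam} in
/-- The generator with index `i` belongs to the ultrafilter `x`. -/
abbrev genM (i : lam.out) (x : M) : Prop :=
  RM (FreeBA lam) bethLang
    (cM bethLang (FreeBA.gen lam i)) x

end Interp

/-- The sentence says that the model is layered, that no ultrafilter codes a sequence of codes of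
descending layers, and that the functions `decM n` compute the members of the sequence that is coded
by an ultrafilter: the generator with index `i` belongs to the `n`-th member of the sequence coded
by `q` if and only if the generator with index `e (i, n)` belongs to `q`. -/
theorem exists_beth_sentence (hlam : ℵ₀ ≤ lam) (e : lam.out × ℕ ≃ lam.out) :
    ∃ φ : BASentence lam ℵ₀ (FreeBA lam), spec1 φ = {μ | ∃ (M : Type u)
      (_ : (voc (FreeBA lam) bethLang).Structure M), Nonempty M ∧
        IsBAStructure (FreeBA lam) bethLang M ∧
        (Layered (M := M) (PM (FreeBA lam) bethLang)
          (QM (FreeBA lam) bethLang) (WM lam) (epsM lam)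
          (codeM lam) ∧
        (∀ x q : M, QM (FreeBA lam) bethLang q →
          ¬ ∀ n, ∃ y z, WM lam y x ∧ WM lam z y ∧ codeM lam x y = decM lam n q ∧
            codeM lam x z = decM lam (n + 1) q) ∧
        ∀ n : ℕ, ∀ q : M, QM (FreeBA lam) bethLang q →
          QM (FreeBA lam) bethLang (decM lam n q) ∧
            ∀ i, (genM i (decM lam n q) ↔ genM (e (i, n)) q)) ∧ #M = μ} := by
  have hκ : ℵ₀ ≤ ℵ₀ := le_rfl
  have hΛ : ℵ₀ < Order.succ lam := Order.lt_succ_iff.2 hlam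
  have hω : #(ULift.{u} ℕ) ≤ lam := by simpa using hlam
  have hω' : lift.{u} #ℕ < lift.{0} (Order.succ lam) := by simpa using hlam
  have hι : lift.{u} #lam.out < lift.{u} (Order.succ lam) := by simp
  have hcode : ∀ {α : Type} (a b : α), TermDefinable
      (voc (FreeBA lam) bethLang) α
        fun M _ v => codeM lam (v a) (v b) := fun a b =>
    TermDefinable.par (B := FreeBA lam) (T := ULift.{u} ℕ) (L := univLang (ULift.{u} ℕ)) (n := 1)
      (ULift.up 0 : ULift.{u} ℕ) (.var a) (h := fun M _ v => ![v b]) fun i => by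
        fin_cases i; exact .var b
  refine exists_baSentence hκ (card_auxLang_le hlam hω
    ((card_univLang (by simp)).le.trans hω)) (.and hΛ ?_ (.and hΛ ?_ ?_))
  · have h1 : Definable (Order.succ lam) ℵ₀
        (voc (FreeBA lam) bethLang) Empty fun M _ _ =>
        (∀ x y z : M, WM lam x y → WM lam y z → WM lam x z) ∧
        (∀ x y z : M, WM lam x y → WM lam x z ∨ WM lam z y) ∧
        (∀ x y : M, QM (FreeBA lam) bethLang
          (codeM lam x y)) ∧
        (∀ x y z : M, WM lam y x → WM lam z x → codeM lam x y = codeM lam x z → ¬ WM lam y z) ∧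
        ∀ y z : M, ¬ WM lam y z → ¬ WM lam z y → (∀ u : M, WM lam u y ∨
          PM (FreeBA lam) bethLang u →
            (epsM lam u y ↔ epsM lam u z)) → y = z :=
      .and hΛ (.all hκ (.all hκ (.all hκ (.imp hΛ (.bin _ (.var _) (.var _)) (.imp hΛ
        (.bin _ (.var _) (.var _)) (.bin _ (.var _) (.var _))))))) <|
      .and hΛ (.all hκ (.all hκ (.all hκ (.imp hΛ (.bin _ (.var _) (.var _)) (.or hΛ
        (.bin _ (.var _) (.var _)) (.bin _ (.var _) (.var _))))))) <|
      .and hΛ (.all hκ (.all hκ (.Q (hcode _ _)))) <|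
      .and hΛ (.all hκ (.all hκ (.all hκ (.imp hΛ (.bin _ (.var _) (.var _)) (.imp hΛ
        (.bin _ (.var _) (.var _)) (.imp hΛ (.eq (hcode _ _) (hcode _ _))
          (.not (.bin _ (.var _) (.var _))))))))) <|
      .all hκ (.all hκ (.imp hΛ (.not (.bin _ (.var _) (.var _))) (.imp hΛ
        (.not (.bin _ (.var _) (.var _))) (.imp hΛ (.all hκ (.imp hΛ (.or hΛ
          (.bin _ (.var _) (.var _)) (.P (.var _))) (.iff hΛ (.bin _ (.var _) (.var _))
            (.bin _ (.var _) (.var _))))) (.eq (.var _) (.var _))))))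
    exact h1.congr fun M _ v => ⟨fun ⟨h1, h2, h3, h4, h5⟩ => ⟨h1, h2, h3, h4, h5⟩,
      fun ⟨h1, h2, h3, h4, h5⟩ => ⟨h1, h2, h3, h4, h5⟩⟩
  · exact .all hκ (.all hκ (.imp hΛ (.Q (.var _)) (.not (.conj hω' fun n => .ex hκ (.ex hκ
      (.and hΛ (.bin _ (.var _) (.var _)) (.and hΛ (.bin _ (.var _) (.var _)) (.and hΛ
        (.eq (hcode _ _) (.un _ (.var _))) (.eq (hcode _ _) (.un _ (.var _)))))))))))
  · exact .conj hω' fun n => .all hκ (.imp hΛ (.Q (.var _)) (.and hΛ (.Q (.un _ (.var _)))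
      (.conj hι fun i => .iff hΛ (.R (.c _ _) (.un _ (.var _))) (.R (.c _ _) (.var _)))))

/-- The models of this sentence are well-founded, because in the represented set of *all*
ultrafilters every sequence has a code. So their cardinalities are bounded, and there is one of
cardinality `ℶ_δ`. -/
theorem beth_lt_hanf {lam : Cardinal.{u}} (hlam : ℵ₀ ≤ lam) :
    beth (ord (Order.succ (2 ^ lam))) < hanf (baSpectra1 lam ℵ₀ (FreeBA lam)) := by
  classical
  obtain ⟨e⟩ : Nonempty (lam.out × ℕ ≃ lam.out) := by
    rw [← Cardinal.eq, mk_prod]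
    simpa using mul_eq_left hlam hlam aleph0_ne_zero
  obtain ⟨φ, hφ⟩ := exists_beth_sentence hlam e
  have hF := mk_freeBA_le hlam
  refine lt_hanf (exists_isHanfBound_baSpectra1 hlam _) ⟨φ, rfl⟩ ?_ (χ := beth _) ?_
  · obtain ⟨σ, hσ⟩ := Layered.exists_bound lam
    refine ⟨σ, ?_⟩
    rw [hφ]
    rintro _ ⟨M, _, -, hM, ⟨hL, hW, hD⟩, rfl⟩
    refine hσ M _ _ _ _ _ hL (hM.mk_P_le.trans hF)
      (hM.mk_Q_le.trans (power_le_power_left two_ne_zero hF)) (hL.wellFounded ?_ hW)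
    intro s hs
    obtain ⟨q, ⟨hq, hqA⟩, -⟩ := hM.exists_unique _
      (isUltra_freeUlt {j | genM (e.symm j).1 (s (e.symm j).2)})
    refine ⟨q, hq, fun n => hM.uf_injOn (hD n q hq).1 (hs n) ((hM.isUltra _ (hD n q hq).1).eq_of_gen
      (hM.isUltra _ (hs n)) fun i => ?_)⟩
    refine ((hD n q hq).2 i).trans ?_
    have := Set.ext_iff.1 hqA (FreeBA.gen lam (e (i, n)))
    rw [gen_mem_freeUlt, Set.mem_ofPred_eq, Equiv.symm_apply_apply] at this
    exact this
  · set δ := ord (Order.succ (2 ^ lam))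
    have h2 : ℵ₀ ≤ (2 : Cardinal.{u}) ^ lam := hlam.trans (cantor lam).le
    have hδ : Order.IsSuccLimit δ := isSuccLimit_ord (h2.trans (Order.le_succ _))
    have h2δ : (2 : Cardinal.{u}) ^ lam ≤ beth δ := (Order.le_succ _).trans (le_beth_ord _)
    let M := (beth δ).ord.ToType
    have hM : #M = beth δ := mk_ord_toType _
    obtain ⟨c⟩ : #(FreeBA lam) ≤ #M := hM.symm ▸ hF.trans ((cantor lam).le.trans h2δ)
    obtain ⟨k⟩ : #{U : Set (FreeBA lam) // IsUltra U} ≤ #M := by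
      rw [hM, mk_ultra_freeBA]; exact h2δ
    obtain ⟨W, ε, h, hL, hwf⟩ := exists_layered hδ (P := fun x => x ∈ Set.range c)
      (Q := fun x => x ∈ Set.range k) (by
        refine (hlam.trans le_mk_freeBA).trans ?_
        exact (mk_range_eq c c.injective).ge) fun α hα => by
          refine (Order.lt_succ_iff.1 (lt_ord.1 hα)).trans ?_
          rw [← mk_ultra_freeBA]
          exact (mk_range_eq k k.injective).ge
    let d : ℕ → {U : Set (FreeBA lam) // IsUltra U} → {U : Set (FreeBA lam) // IsUltra U} :=
      fun n U => ⟨freeUlt {i | FreeBA.gen lam (e (i, n)) ∈ U.1}, isUltra_freeUlt _⟩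
    -- The function `codeM` is one of the functions of the family `N_x = M`; the other symbols of
    -- this family play no role.
    let I : M → (univLang (ULift.{u} ℕ)).Structure M := fun x =>
      ⟨fun {n} _ v => if hn : 0 < n then h x (v ⟨0, hn⟩) else x, fun _ _ => True⟩
    obtain ⟨S, hS, hc, hQ, hu, hN, hun, -, hbin⟩ := @exists_baStructure (FreeBA lam) (ULift.{u} ℕ)
      (univLang (ULift.{u} ℕ)) M _ c k (fun _ => M)
      I
      (fun _ => id) (fun _ => Function.injective_id)
      (fun n x => if hx : x ∈ Set.range k then k (d n.down hx.choose) else x)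
      (fun _ => k ⟨_, isUltra_freeUlt ∅⟩) (fun t x y => if t.down = 0 then W x y else ε x y)
    have hPM : (PM (FreeBA lam) bethLang : M → Prop) = fun x => x ∈ Set.range c := by
      funext x
      have := Set.ext_iff.1 hS.P_eq x
      rw [show (cM bethLang : FreeBA lam → M) = c from funext hc] at this
      exact propext this
    have hQM : (QM (FreeBA lam) bethLang : M → Prop) = fun x => x ∈ Set.range k :=
      funext fun x => propext (hQ x)
    have hW : (WM lam : M → M → Prop) = W := funext fun x => funext fun y => propext (by
      rw [WM, hbin]; simp)
    have hε : (epsM lam : M → M → Prop) = ε := funext fun x => funext fun y => propext (by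
      rw [epsM, hbin]; simp)
    have hcode : (codeM lam : M → M → M) = h := by
      funext x y
      let _ := I x
      exact ((hN x).map_fun (n := 1) (ULift.up 0 : ULift.{u} ℕ) ![y]).trans
        (show (if hn : 0 < 1 then h x (![y] ⟨0, hn⟩) else x) = h x y from by simp)
    have hdec : ∀ n U, decM lam n (k U) = k (d n U) := fun n U => by
      have hx : k U ∈ Set.range k := ⟨U, rfl⟩
      rw [decM, hun, dif_pos hx, k.injective hx.choose_spec]
    rw [hφ]
    refine ⟨M, S, ⟨k ⟨_, isUltra_freeUlt ∅⟩⟩, hS, ⟨?_, ?_, ?_⟩, hM⟩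
    · rw [hPM, hQM, hW, hε, hcode]
      exact hL
    · intro x q _
      rw [hW, hcode]
      exact hL.not_descending hwf _ x q
    · intro n q hq
      obtain ⟨U, rfl⟩ := (hQ q).1 hq
      rw [hdec]
      refine ⟨(hQ _).2 ⟨_, rfl⟩, fun i => ?_⟩
      exact (Set.ext_iff.1 (hu (d n U)) (FreeBA.gen lam i)).trans
        (Set.ext_iff.1 (hu U) (FreeBA.gen lam (e (i, n)))).symm

end Beth

/-! ### The Erdős–Rado theorem -/

section ErdosRado

variable {X C : Type u}

theorem exists_fiber_card_gt {ν : Cardinal.{u}} (hν : ℵ₀ ≤ ν) (hC : #C ≤ ν) (hX : ν < #X)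
    (g : X → C) : ∃ c, ν < #{x | g x = c} := by
  by_contra hc
  push Not at hc
  have h1 : (Set.univ : Set X) = ⋃ c, {x | g x = c} := by ext x; simp
  refine absurd hX (not_lt.2 ?_)
  rw [← mk_univ, h1]
  exact (mk_iUnion_le _).trans (mul_le_of_le hν hC (ciSup_le' hc))

/-- There is a set `A` of cardinality at most `2 ^ μ` in which every type over a subset of
cardinality at most `μ` that is realized is realized. -/
theorem exists_saturated_set {μ : Cardinal.{u}} (hμ : ℵ₀ ≤ μ) (hC : #C ≤ 2 ^ μ) [DecidableEq X]
    (f : Finset X → C) (a : X) : ∃ A : Set X, #A ≤ 2 ^ μ ∧ a ∈ A ∧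
      ∀ D ⊆ A, D.Nonempty → #D ≤ μ → ∀ x ∉ D, ∃ y ∈ A, y ∉ D ∧
        ∀ F : Finset X, (F : Set X) ⊆ D → f (insert y F) = f (insert x F) := by
  classical
  let G : (μ.out → X) → (Finset μ.out → C) → X := fun d h =>
    if hy : ∃ y, y ∉ Set.range d ∧ ∀ F, f (insert y (F.image d)) = h F then hy.choose else a
  -- `A` is the closure of `{a}` under the functions `G · h`
  let ar : Option (Finset μ.out → C) → Type u := fun o => o.elim PEmpty fun _ => μ.out
  let ev : WType ar → X := WType.elim X fun p => match p with
    | ⟨none, _⟩ => a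
    | ⟨some h, d⟩ => G d h
  have hinf : Infinite μ.out := by rw [Cardinal.infinite_iff, mk_out]; exact hμ
  refine ⟨Set.range ev, ?_, ⟨.mk none PEmpty.elim, rfl⟩, fun D hDA hD hDμ x hx => ?_⟩
  · refine mk_range_le.trans (mk_wtype_le hμ ?_ fun o => ?_)
    · rw [mk_option]
      refine add_le_of_le (hμ.trans (cantor μ).le) ?_
        (one_lt_aleph0.le.trans (hμ.trans (cantor μ).le))
      rw [← power_def, mk_finset_of_infinite, mk_out]
      refine (power_le_power_right hC).trans ?_
      rw [← power_mul, mul_eq_self hμ]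
    · cases o with
      | none => simp [ar]
      | some h => simp [ar]
  · have : Nonempty D := hD.to_subtype
    rw [← mk_out μ] at hDμ
    obtain ⟨g⟩ := hDμ
    let d : μ.out → X := fun i => (Function.invFun g i).1
    have hd : Set.range d = D := by
      ext y
      constructor
      · rintro ⟨i, rfl⟩; exact (Function.invFun g i).2
      · intro hy
        obtain ⟨i, hi⟩ := Function.invFun_surjective g.injective ⟨y, hy⟩
        exact ⟨i, congrArg Subtype.val hi⟩
    have hw : ∀ i, ∃ w, ev w = d i := fun i => hDA (Function.invFun g i).2
    choose w hw using hw
    have hex : ∃ y, y ∉ Set.range d ∧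
        ∀ F : Finset μ.out, f (insert y (F.image d)) = f (insert x (F.image d)) :=
      ⟨x, hd ▸ hx, fun F => rfl⟩
    have hev : ev (.mk (some fun F => f (insert x (F.image d))) w) =
        G (fun i => ev (w i)) fun F => f (insert x (F.image d)) := rfl
    rw [show (fun i => ev (w i)) = d from funext hw] at hev
    refine ⟨_, ⟨_, hev⟩, ?_⟩
    have hG : G d (fun F => f (insert x (F.image d))) = hex.choose := dif_pos hex
    rw [hG]
    refine ⟨hd ▸ hex.choose_spec.1, fun F hF => ?_⟩
    have hF' : (F : Set X) ⊆ d '' Set.univ := by rw [Set.image_univ, hd]; exact hF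
    obtain ⟨F', -, rfl⟩ := Finset.subset_set_image_iff.1 hF'
    exact hex.choose_spec.2 F'

/-- If `|X| > 2 ^ μ`, then there is a sequence of length `μ⁺` such that the colour of a finite set
of terms depends only on the set without its last element. -/
theorem exists_end_homogeneous {μ : Cardinal.{u}} (hμ : ℵ₀ ≤ μ) (hC : #C ≤ 2 ^ μ)
    (hX : 2 ^ μ < #X) [DecidableEq X] (f : Finset X → C) :
    ∃ (x : X) (y : (Order.succ μ).ord.ToType ↪ X), ∀ i, ∀ F : Finset (Order.succ μ).ord.ToType,
      (∀ j ∈ F, j < i) → f (insert (y i) (F.map y)) = f (insert x (F.map y)) := by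
  classical
  have : Nonempty X := by rw [← mk_ne_zero_iff]; exact (bot_le.trans_lt hX).ne'
  obtain ⟨a⟩ := this
  obtain ⟨A, hA, ha, h⟩ := exists_saturated_set hμ hC f a
  obtain ⟨x, hx⟩ : ∃ x, x ∉ A := by
    by_contra hall
    push Not at hall
    rw [Set.eq_univ_of_forall hall, mk_univ] at hA
    exact absurd hX (not_lt.2 hA)
  let J := (Order.succ μ).ord.ToType
  let pick : Set X → X := fun D => if hy : ∃ y ∈ A, y ∉ D ∧ ∀ F : Finset X, (F : Set X) ⊆ D →
    f (insert y F) = f (insert x F) then hy.choose else a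
  have hpick : ∀ D, pick D ∈ A := fun D => by
    by_cases hy : ∃ y ∈ A, y ∉ D ∧ ∀ F : Finset X, (F : Set X) ⊆ D → f (insert y F) = f (insert x F)
    · rw [show pick D = hy.choose from dif_pos hy]; exact hy.choose_spec.1
    · rw [show pick D = a from dif_neg hy]; exact ha
  let y : J → X := WellFoundedLT.fix fun i g =>
    pick (insert a (Set.range fun j : Set.Iio i => g j.1 j.2))
  let D : J → Set X := fun i => insert a (Set.range fun j : Set.Iio i => y j)
  have hy : ∀ i, y i = pick (D i) := fun i => WellFoundedLT.fix_eq _ i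
  have hspec : ∀ i, y i ∉ D i ∧ ∀ F : Finset X, (F : Set X) ⊆ D i →
      f (insert (y i) F) = f (insert x F) := by
    intro i
    have hDA : D i ⊆ A := by
      rintro _ (rfl | ⟨j, rfl⟩)
      · exact ha
      · change y j ∈ A
        rw [hy]; exact hpick _
    have hDμ : #(D i) ≤ μ := by
      refine mk_insert_le.trans (add_le_of_le hμ (mk_range_le.trans ?_) (one_lt_aleph0.le.trans hμ))
      exact Order.lt_succ_iff.1 (mk_Iio_toType_lt i)
    have hex := h (D i) hDA ⟨a, Or.inl rfl⟩ hDμ x fun hxD => hx (hDA hxD)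
    rw [hy, show pick (D i) = hex.choose from dif_pos hex]
    exact hex.choose_spec.2
  have hinj : Function.Injective y := by
    have key : ∀ i j, j < i → y i ≠ y j := fun i j hij h =>
      (hspec i).1 (Or.inr ⟨⟨j, hij⟩, h.symm⟩)
    intro i j hij
    rcases lt_trichotomy i j with h | h | h
    · exact absurd hij.symm (key _ _ h)
    · exact h
    · exact absurd hij (key _ _ h)
  refine ⟨x, ⟨y, hinj⟩, fun i F hF => (hspec i).2 _ ?_⟩
  intro z hz
  rw [Finset.coe_map] at hz
  obtain ⟨j, hj, rfl⟩ := hz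
  exact Or.inr ⟨⟨j, hF j hj⟩, rfl⟩

/-- **The Erdős–Rado theorem**, for colourings of the finite subsets of `X` by at most `ℶ_β`
colours: `ℶ_(β+n)⁺ → (ℶ_β⁺)^(n+1)`. In the induction, the colour of a set of `n + 2` elements of an
end-homogeneous sequence is replaced by a colour of the set of its first `n + 1` elements. -/
theorem erdos_rado {β : Ordinal.{u}} (hC : #C ≤ beth β) (n : ℕ) :
    ∀ {X : Type u} (f : Finset X → C), beth (β + n) < #X → ∃ (Y : Set X) (c : C), beth β < #Y ∧
      ∀ F : Finset X, (F : Set X) ⊆ Y → F.card = n + 1 → f F = c := by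
  classical
  induction n with
  | zero =>
    intro X f hX
    rw [Nat.cast_zero, add_zero] at hX
    obtain ⟨c, hc⟩ := exists_fiber_card_gt (aleph0_le_beth β) hC hX fun x => f {x}
    refine ⟨_, c, hc, fun F hF h1 => ?_⟩
    obtain ⟨x, rfl⟩ := Finset.card_eq_one.1 h1
    exact hF (Finset.mem_coe.2 (Finset.mem_singleton_self x))
  | succ n ih =>
    intro X f hX
    have hle : beth β ≤ beth (β + n) := beth_mono le_self_add
    rw [Nat.cast_succ, ← add_assoc, beth_add_one] at hX
    obtain ⟨x, y, hy⟩ := exists_end_homogeneous (aleph0_le_beth _)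
      ((hC.trans hle).trans (cantor _).le) hX f
    obtain ⟨Y, c, hY, h⟩ := ih (fun G => f (insert x (G.map y)))
      (by rw [mk_ord_toType]; exact Order.lt_succ _)
    refine ⟨y '' Y, c, by rwa [mk_image_eq y.injective], fun F hF hFn => ?_⟩
    obtain ⟨G, hG, rfl⟩ := Finset.subset_set_image_iff.1 hF
    rw [← Finset.map_eq_image] at hFn ⊢
    rw [Finset.card_map] at hFn
    have hne : G.Nonempty := Finset.card_pos.1 (by omega)
    have hmax := G.max'_mem hne
    have h1 := hy (G.max' hne) (G.erase (G.max' hne)) fun j hj => G.lt_max'_of_mem_erase_max' hne hj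
    rw [← Finset.map_insert, Finset.insert_erase hmax] at h1
    rw [h1]
    refine h _ (fun j hj => hG (Finset.mem_of_mem_erase hj)) ?_
    rw [Finset.card_erase_of_mem hmax, hFn]
    rfl

end ErdosRado

/-! ### Skolem functions -/

section Skolem

variable {Λ κ : Cardinal.{u}} {L : FirstOrder.Language.{u, u}}

namespace InfFormula

/-- The set of subformulas of a formula. -/
def subf : InfFormula Λ κ L → Set (InfFormula Λ κ L)
  | equal t₁ t₂ => {equal t₁ t₂}
  | rel R ts => {rel R ts}
  | neg φ => insert (neg φ) φ.subf
  | conj γ φ => insert (conj γ φ) (⋃ i, (φ i).subf)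
  | ex s hs φ => insert (ex s hs φ) φ.subf

theorem self_mem_subf (φ : InfFormula Λ κ L) : φ ∈ φ.subf := by
  cases φ with
  | equal | rel => exact rfl
  | neg | conj | ex => exact Or.inl rfl

theorem subf_subset {φ ψ : InfFormula Λ κ L} (h : φ ∈ ψ.subf) : φ.subf ⊆ ψ.subf := by
  induction ψ with
  | equal | rel => rw [Set.mem_singleton_iff.1 h]
  | neg ψ ih | ex s hs ψ ih =>
    rcases h with rfl | h
    · exact subset_rfl
    · exact (ih h).trans (Set.subset_insert _ _)
  | conj γ ψ ih =>
    rcases h with rfl | h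
    · exact subset_rfl
    · obtain ⟨i, h⟩ := Set.mem_iUnion.1 h
      exact (ih i h).trans ((Set.subset_iUnion (fun i => (ψ i).subf) i).trans
        (Set.subset_insert _ _))

theorem finite_freeVars_of_mem_subf {φ ψ : InfFormula Λ ℵ₀ L} (h : φ ∈ ψ.subf)
    (hψ : ψ.freeVars.Finite) : φ.freeVars.Finite := by
  induction ψ with
  | equal | rel => rwa [Set.mem_singleton_iff.1 h]
  | neg ψ ih =>
    rcases h with rfl | h
    · exact hψ
    · exact ih h hψ
  | ex s hs ψ ih =>
    rcases h with rfl | h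
    · exact hψ
    · refine ih h ((hψ.union (lt_aleph0_iff_set_finite.1 hs)).subset ?_)
      intro x hx
      by_cases hxs : x ∈ s
      · exact Or.inr hxs
      · exact Or.inl ⟨hx, hxs⟩
  | conj γ ψ ih =>
    rcases h with rfl | h
    · exact hψ
    · obtain ⟨i, h⟩ := Set.mem_iUnion.1 h
      exact ih i h (hψ.subset (Set.subset_iUnion (fun i => (ψ i).freeVars) i))

theorem mk_subf_le {lam : Cardinal.{u}} (hlam : ℵ₀ ≤ lam) (φ : InfFormula (Order.succ lam) κ L) :
    #φ.subf ≤ lam := by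
  have h1 : (1 : Cardinal.{u}) ≤ lam := one_lt_aleph0.le.trans hlam
  induction φ with
  | equal | rel => simpa [subf] using h1
  | neg ψ ih | ex s hs ψ ih => exact mk_insert_le.trans (add_le_of_le hlam ih h1)
  | conj γ ψ ih =>
    refine mk_insert_le.trans (add_le_of_le hlam ((mk_iUnion_le _).trans ?_) h1)
    exact mul_le_of_le hlam (Order.lt_succ_iff.1 (mk_Iio_toType_lt γ)) (ciSup_le' ih)

open Classical in
/-- For a formula `∃ x_[s] φ` that is satisfied by `v`, an assignment that satisfies `φ` and agrees
with `v` outside `s`; in all other cases, `v` itself. -/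
noncomputable def witness {M : Type u} [L.Structure M] : InfFormula Λ κ L → (Var κ → M) → Var κ → M
  | ex s _ φ, v => if h : ∃ w : Var κ → M, (∀ x, x ∉ s → w x = v x) ∧ φ.Realize w then
      h.choose else v
  | _, v => v

theorem witness_spec {M : Type u} [L.Structure M] {s : Set (Var κ)} {hs : #s < κ}
    {φ : InfFormula Λ κ L} {v : Var κ → M} (h : (ex s hs φ).Realize v) :
    (∀ x, x ∉ s → (ex s hs φ).witness v x = v x) ∧ φ.Realize ((ex s hs φ).witness v) := by
  have h' : ∃ w : Var κ → M, (∀ x, x ∉ s → w x = v x) ∧ φ.Realize w := h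
  rw [show (ex s hs φ).witness v = h'.choose from dif_pos h']
  exact h'.choose_spec

end InfFormula

/-- The vocabulary `L` with Skolem functions: for `φ ∈ S` and variables `e 0, …, e (n - 1), x` there
is an `n`-ary function that gives a value of `x` that witnesses `φ`, in terms of the values of the
`e i`. -/
def skLang (S : Set (InfFormula Λ κ L)) : FirstOrder.Language.{u, u} :=
  ⟨fun n => L.Functions n ⊕ (S × (Fin n → Var κ) × Var κ), L.Relations⟩

open Classical in
/-- The assignment that gives the variables `e i` the values `a i`, and all others the value `d`. -/
noncomputable def assign {M : Type u} (d : M) {n : ℕ} (e : Fin n → Var κ) (a : Fin n → M) :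
    Var κ → M :=
  fun y => if h : ∃ i, e i = y then a h.choose else d

theorem assign_comp {M : Type u} (d : M) {n : ℕ} (e : Fin n → Var κ) (v : Var κ → M) {y : Var κ}
    (hy : y ∈ Set.range e) : assign d e (fun i => v (e i)) y = v y := by
  have hy' : ∃ i, e i = y := hy
  rw [assign, dif_pos hy', hy'.choose_spec]

/-- The expansion of a structure by Skolem functions. For formulas that are not existential, or have
free variables other than the `e i`, the functions have no significance. -/
noncomputable instance skStructure (S : Set (InfFormula Λ κ L)) (M : Type u) [L.Structure M]
    [Nonempty M] : (skLang S).Structure M where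
  funMap := fun {_} f a => match f with
    | .inl f => FirstOrder.Language.Structure.funMap f a
    | .inr (χ, e, x) => χ.1.witness (assign (Classical.arbitrary M) e a) x
  RelMap := fun {_} R a => FirstOrder.Language.Structure.RelMap (L := L) R a

/-- Terms with Skolem functions form an `L`-structure, with the relations given by `r`. -/
abbrev termStructure (S : Set (InfFormula Λ κ L)) {α : Type w}
    (r : ∀ {n}, L.Relations n → (Fin n → (skLang S).Term α) → Prop) :
    L.Structure ((skLang S).Term α) where
  funMap f ts := .func (Sum.inl f) ts
  RelMap R ts := r R ts

/-- Substituting Skolem terms into a term `t` of `L` commutes with evaluation. -/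
theorem realize_realize (S : Set (InfFormula Λ κ L)) {α : Type w}
    (r : ∀ {n}, L.Relations n → (Fin n → (skLang S).Term α) → Prop) {M : Type u} [L.Structure M]
    [Nonempty M] (a : α → M) {β : Type w'} (t : L.Term β) (τ : β → (skLang S).Term α) :
    (@FirstOrder.Language.Term.realize L _ (termStructure S r) _ τ t).realize a =
      t.realize fun x => (τ x).realize a := by
  induction t with
  | var => rfl
  | func f ts ih =>
    change FirstOrder.Language.Structure.funMap f _ = FirstOrder.Language.Structure.funMap f _
    exact congrArg _ (funext ih)

theorem mk_skTerm_le {lam : Cardinal.{u}} (hlam : ℵ₀ ≤ lam) (hκ : κ ≤ lam)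
    {S : Set (InfFormula Λ κ L)} (hS : #S ≤ lam) (hL : L.card ≤ lam) (n : ℕ) :
    #((skLang S).Term (Fin n)) ≤ lam := by
  refine FirstOrder.Language.Term.card_le.trans (max_le hlam ?_)
  rw [mk_sum, mk_fin, lift_natCast, lift_uzero]
  refine add_le_of_le hlam (natCast_lt_aleph0.le.trans hlam) ?_
  have h1 : ∀ m, #((skLang S).Functions m) ≤ lam := fun m => by
    change #(L.Functions m ⊕ (S × (Fin m → Var κ) × Var κ)) ≤ lam
    have hV : #(Var κ) ≤ lam := by simpa using hκ
    rw [mk_sum, lift_id, lift_id, mk_prod, lift_id, lift_id, mk_prod, lift_id, lift_id]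
    refine add_le_of_le hlam (le_trans ?_ hL) (mul_le_of_le hlam hS (mul_le_of_le hlam ?_ hV))
    · exact mk_le_of_injective (f := fun f => (.inl ⟨m, f⟩ : L.Symbols)) fun f g h => by
        simpa using h
    · rw [mk_pi, prod_const]
      simp only [mk_fin, lift_natCast, lift_id']
      exact (power_nat_le_max).trans (max_le hV hlam)
  rw [mk_sigma]
  refine (Cardinal.sum_le_sum _ (fun _ => lam) h1).trans ?_
  simpa using mul_le_of_le hlam hlam le_rfl

end Skolem

/-! ### Types of increasing sequences -/

section Types

variable {Λ : Cardinal.{u}} {L : FirstOrder.Language.{u, u}}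

/-- The statements that can be made about `n` elements by means of formulas from `S`, with Skolem
terms substituted for their free variables. -/
abbrev EMStatement (S : Set (InfFormula Λ ℵ₀ L)) (n : ℕ) : Type u :=
  Σ φ : S, φ.1.freeVars → (skLang S).Term (Fin n)

open Classical in
/-- The set of those statements that are true about the sequence `a`. The values of variables that
are not free are irrelevant. -/
def emType (S : Set (InfFormula Λ ℵ₀ L)) {M : Type u} [L.Structure M] [Nonempty M] {n : ℕ}
    (a : Fin n → M) : Set (EMStatement S n) :=
  {p | p.1.1.Realize fun x => if h : x ∈ p.1.1.freeVars then (p.2 ⟨x, h⟩).realize a else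
    Classical.arbitrary M}

theorem mk_set_emStatement_le {lam : Cardinal.{u}} (hlam : ℵ₀ ≤ lam)
    {S : Set (InfFormula Λ ℵ₀ L)} (hS : #S ≤ lam) (hL : L.card ≤ lam)
    (hfin : ∀ φ ∈ S, φ.freeVars.Finite) (n : ℕ) : #(Set (EMStatement S n)) ≤ 2 ^ lam := by
  rw [mk_set]
  refine power_le_power_left two_ne_zero ?_
  rw [mk_sigma]
  refine (Cardinal.sum_le_sum _ (fun _ => lam) fun φ => ?_).trans ?_
  · rw [← power_def]
    obtain ⟨m, hm⟩ := lt_aleph0.1 (lt_aleph0_iff_set_finite.2 (hfin φ.1 φ.2))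
    rw [hm]
    exact power_nat_le_max.trans (max_le (mk_skTerm_le hlam hlam hS hL n) hlam)
  · simpa using mul_le_of_le hlam hS le_rfl

variable (ψ : InfSentence Λ ℵ₀ L)

/-- There are large subsets of models of `ψ` in which, for `k < n`, all increasing sequences of
length `k` have the type `p k`. -/
def Homogeneous (δ : Ordinal.{u}) (p : ∀ k, Set (EMStatement ψ.1.subf k)) (n : ℕ) : Prop :=
  ∀ β < δ, ∃ (M : Type u) (_ : L.Structure M) (_ : LinearOrder M) (_ : Nonempty M) (X : Set M),
    IsModel M ψ ∧ beth β < #X ∧ ∀ k < n, ∀ a : Fin k → M, StrictMono a → (∀ i, a i ∈ X) →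
      emType ψ.1.subf a = p k

variable {ψ}

theorem Homogeneous.congr {δ : Ordinal.{u}} {p p' : ∀ k, Set (EMStatement ψ.1.subf k)} {n : ℕ}
    (h : Homogeneous ψ δ p n) (hp : ∀ k < n, p' k = p k) : Homogeneous ψ δ p' n := by
  intro β hβ
  obtain ⟨M, _, _, _, X, hM, hX, hk⟩ := h β hβ
  exact ⟨M, _, _, _, X, hM, hX, fun k hkn a ha haX => (hk k hkn a ha haX).trans (hp k hkn).symm⟩

/-- A colouring of the ordinals below a regular cardinal by fewer colours has a colour that occurs
cofinally often. -/
theorem exists_uniform {c : Cardinal.{u}} (hc : c.IsRegular) {C : Type u} (hC : #C < c)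
    {R : Ordinal.{u} → C → Prop} (hmono : ∀ β γ x, β ≤ γ → R γ x → R β x)
    (h : ∀ β < c.ord, ∃ x, R β x) : ∃ x, ∀ β < c.ord, R β x := by
  by_contra hn
  push Not at hn
  choose β hβ hR using hn
  have hsup : iSup β < c.ord := Ordinal.iSup_lt_of_lt_cof (by rwa [hc.cof_ord]) hβ
  obtain ⟨x, hx⟩ := h _ hsup
  exact hR x (hmono _ _ x (Ordinal.le_iSup β x) hx)

/-- The Erdős–Rado theorem makes the type of increasing `n`-tuples constant on large subsets. Since
there are at most `2 ^ λ` types, one of them works for cofinally many `β`, hence for all `β`. -/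
theorem Homogeneous.succ {lam : Cardinal.{u}} (hlam : ℵ₀ ≤ lam) (hL : L.card ≤ lam)
    (hS : #ψ.1.subf ≤ lam) {p : ∀ k, Set (EMStatement ψ.1.subf k)} {n : ℕ}
    (h : Homogeneous ψ (ord (Order.succ (2 ^ lam))) p n) :
    ∃ p' : ∀ k, Set (EMStatement ψ.1.subf k), (∀ k < n, p' k = p k) ∧
      Homogeneous ψ (ord (Order.succ (2 ^ lam))) p' (n + 1) := by
  classical
  have h2 : ℵ₀ ≤ (2 : Cardinal.{u}) ^ lam := hlam.trans (cantor lam).le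
  set δ := ord (Order.succ ((2 : Cardinal.{u}) ^ lam))
  have hδ : Order.IsSuccLimit δ := isSuccLimit_ord (h2.trans (Order.le_succ _))
  have hCard : #(Set (EMStatement ψ.1.subf n)) ≤ 2 ^ lam :=
    mk_set_emStatement_le hlam hS hL (fun φ hφ => InfFormula.finite_freeVars_of_mem_subf hφ
      (by rw [ψ.2]; exact Set.finite_empty)) n
  obtain ⟨c, hc⟩ : ∃ c, ∀ β < δ, ∃ (M : Type u) (_ : L.Structure M) (_ : LinearOrder M)
      (_ : Nonempty M) (X : Set M), IsModel M ψ ∧ beth β < #X ∧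
        (∀ k < n, ∀ a : Fin k → M, StrictMono a → (∀ i, a i ∈ X) → emType ψ.1.subf a = p k) ∧
        ∀ a : Fin n → M, StrictMono a → (∀ i, a i ∈ X) → emType ψ.1.subf a = c := by
    refine exists_uniform (isRegular_succ h2) (hCard.trans_lt (Order.lt_succ _)) ?_ ?_
    · rintro β γ x hβγ ⟨M, _, _, _, X, hM, hX, hk⟩
      exact ⟨M, _, _, _, X, hM, (beth_mono hβγ).trans_lt hX, hk⟩
    · intro β hβ
      rcases n with _ | m
      · obtain ⟨M, _, _, _, X, hM, hX, hk⟩ := h β hβ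
        exact ⟨emType ψ.1.subf (Fin.elim0 : Fin 0 → M), M, _, _, _, X, hM, hX, hk,
          fun a _ _ => congrArg _ (Subsingleton.elim _ _)⟩
      · -- enlarging `β` ensures that there are at most `ℶ_β` types
        set β' := max β (ord (2 ^ lam))
        have hβ' : β' < δ := max_lt hβ (ord_lt_ord.2 (Order.lt_succ _))
        obtain ⟨M, iM, oM, nM, X, hM, hX, hk⟩ := h (β' + m) (hδ.add_natCast_lt hβ' m)
        obtain ⟨Y, c, hY, hc⟩ := erdos_rado (hCard.trans ((le_beth_ord _).trans
          (beth_mono (le_max_right _ _)))) m (fun F : Finset X => if hF : F.card = m + 1 then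
            emType ψ.1.subf (fun i => (F.orderEmbOfFin hF i).1) else ∅) hX
        refine ⟨c, M, iM, oM, nM, Subtype.val '' Y, hM, ?_, ?_, ?_⟩
        · rw [mk_image_eq Subtype.val_injective]
          exact (beth_mono (le_max_left _ _)).trans_lt hY
        · exact fun k hkn a ha haX => hk k hkn a ha fun i => by
            obtain ⟨y, -, hy⟩ := haX i; rw [← hy]; exact y.2
        · intro a ha haX
          choose b hb hba using haX
          obtain rfl : (fun i => (b i).1) = a := funext hba
          have hb' : StrictMono b := ha
          have hcard : (Finset.univ.image b).card = m + 1 := by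
            rw [Finset.card_image_of_injective _ hb'.injective, Finset.card_fin]
          have := hc (Finset.univ.image b) (by
            intro y hy
            simp only [Finset.coe_image, Finset.coe_univ, Set.image_univ] at hy
            obtain ⟨i, rfl⟩ := hy
            exact hb i) hcard
          rw [dif_pos hcard] at this
          rw [← this, ← Finset.orderEmbOfFin_unique hcard (f := b) (by simp) hb']
  refine ⟨Function.update p n c, fun k hk => Function.update_of_ne hk.ne _ _, fun β hβ => ?_⟩
  obtain ⟨M, iM, oM, nM, X, hM, hX, hk, hn⟩ := hc β hβ
  refine ⟨M, iM, oM, nM, X, hM, hX, fun k hkn a ha haX => ?_⟩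
  rcases (Nat.lt_succ_iff.1 hkn).lt_or_eq with hlt | rfl
  · rw [Function.update_of_ne hlt.ne]
    exact hk k hlt a ha haX
  · rw [Function.update_self]
    exact hn a ha haX

/-- The types are chosen by recursion on the length of the tuples. -/
theorem exists_homogeneous {lam : Cardinal.{u}} (hlam : ℵ₀ ≤ lam) (hL : L.card ≤ lam)
    (hS : #ψ.1.subf ≤ lam)
    (h : ∀ β < ord (Order.succ ((2 : Cardinal.{u}) ^ lam)), ∃ χ ∈ spec ψ, beth β ≤ χ) :
    ∃ p, ∀ n, Homogeneous ψ (ord (Order.succ (2 ^ lam))) p n := by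
  classical
  set δ := ord (Order.succ ((2 : Cardinal.{u}) ^ lam))
  have hδ : Order.IsSuccLimit δ :=
    isSuccLimit_ord ((hlam.trans (cantor lam).le).trans (Order.le_succ _))
  have h0 : Homogeneous ψ δ (fun _ => ∅) 0 := by
    intro β hβ
    obtain ⟨_, ⟨M, _, hM, rfl⟩, hle⟩ := h (Order.succ β) (hδ.succ_lt hβ)
    have := hM.1
    refine ⟨M, _, linearOrderOfSTO WellOrderingRel, this, Set.univ, hM, ?_, by simp⟩
    rw [mk_univ]
    exact (beth_lt_beth.2 (Order.lt_succ β)).trans_le hle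
  let step : ∀ n, {p // Homogeneous ψ δ p n} → {p // Homogeneous ψ δ p (n + 1)} := fun n p =>
    ⟨_, (p.2.succ hlam hL hS).choose_spec.2⟩
  have hstep : ∀ n p, ∀ k < n, (step n p).1 k = p.1 k := fun n p =>
    (p.2.succ hlam hL hS).choose_spec.1
  let g : ∀ n, {p // Homogeneous ψ δ p n} := fun n => Nat.rec ⟨_, h0⟩ step n
  have hg : ∀ k n, k < n → (g n).1 k = (g (k + 1)).1 k := by
    intro k n hkn
    induction n, hkn using Nat.le_induction with
    | base => rfl
    | succ n hn ih => exact (hstep n (g n) k hn).trans ih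
  exact ⟨fun k => (g (k + 1)).1 k, fun n => (g n).2.congr fun k hk => (hg k n hk).symm⟩

end Types

/-! ### Models generated by indiscernibles -/

section Indiscernibles

variable {Λ : Cardinal.{u}} {L : FirstOrder.Language.{u, u}} {ψ : InfSentence Λ ℵ₀ L}

/-- The truth of a statement about elements indexed by `F` is determined by the type of the
increasing enumeration of these elements. -/
theorem realize_iff_mem_emType {S : Set (InfFormula Λ ℵ₀ L)} {I : Type u} [LinearOrder I]
    {M : Type u} [L.Structure M] [Nonempty M] {F : Finset I} (a : I → M)
    {φ : InfFormula Λ ℵ₀ L} (hφ : φ ∈ S) (τ : Var ℵ₀ → (skLang S).Term I)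
    (hτ : ∀ x ∈ φ.freeVars, (τ x).varFinset ⊆ F) :
    φ.Realize (fun x => (τ x).realize a) ↔
      (⟨⟨φ, hφ⟩, fun x => (τ x.1).restrictVar fun i =>
        (F.orderIsoOfFin rfl).symm ⟨i, hτ x.1 x.2 i.2⟩⟩ : EMStatement S F.card) ∈
          emType S fun i => a (F.orderEmbOfFin rfl i) := by
  refine InfFormula.realize_congr _ fun x hx => ?_
  simp only [dif_pos hx]
  refine (FirstOrder.Language.Term.realize_restrictVar a fun i => ?_).symm
  rw [← Finset.coe_orderIsoOfFin_apply, OrderIso.apply_symm_apply]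

open Filter in
/-- Let `a F`, for finite sets `F ⊆ I`, be a map of `I` into a model `M F` of `ψ`, such that the
truth in `M F` of statements about the elements `a F i`, `i ∈ F₀`, does not depend on `F ⊇ F₀`.
Then the Skolem terms in the elements of `I`, identified if they are equal in `M F` for all large
`F`, form a model of `ψ`. -/
theorem exists_model_of_coherent {I : Type u} [Nonempty I] [DecidableEq I]
    (M : Finset I → Type u) [∀ F, L.Structure (M F)] [∀ F, Nonempty (M F)]
    (hM : ∀ F, IsModel (M F) ψ) (a : ∀ F, I → M F) (ha : ∀ F, Set.InjOn (a F) F)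
    (hcoh : ∀ F₀ F : Finset I, F₀ ⊆ F → ∀ φ ∈ ψ.1.subf, ∀ τ : Var ℵ₀ → (skLang ψ.1.subf).Term I,
      (∀ x ∈ φ.freeVars, (τ x).varFinset ⊆ F₀) →
        (φ.Realize (fun x => (τ x).realize (a F)) ↔ φ.Realize fun x => (τ x).realize (a F₀))) :
    ∃ χ ∈ spec ψ, #I ≤ χ := by
  classical
  let S := ψ.1.subf
  let s : Setoid ((skLang S).Term I) :=
    { r := fun t t' => ∀ᶠ F in atTop, t.realize (a F) = t'.realize (a F)
      iseqv := ⟨fun t => .of_forall fun F => rfl, fun h => h.mono fun F => Eq.symm,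
        fun h h' => (h.and h').mono fun F hF => hF.1.trans hF.2⟩ }
  let r : ∀ {n}, L.Relations n → (Fin n → (skLang S).Term I) → Prop := fun R ts =>
    ∀ᶠ F in atTop, FirstOrder.Language.Structure.RelMap R fun i => (ts i).realize (a F)
  let ps : L.Prestructure s :=
    { toStructure := termStructure S r
      fun_equiv := fun {n f} x y hxy => by
        have h1 : ∀ᶠ F in atTop, ∀ i, (x i).realize (a F) = (y i).realize (a F) :=
          eventually_all.2 hxy
        refine h1.mono fun F hF => ?_
        exact congrArg (FirstOrder.Language.Structure.funMap (L := skLang S) (M := M F) (Sum.inl f))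
          (funext hF)
      rel_equiv := fun {n R} x y hxy => by
        have h1 : ∀ᶠ F in atTop, ∀ i, (x i).realize (a F) = (y i).realize (a F) :=
          eventually_all.2 hxy
        exact propext (eventually_congr (h1.mono fun F hF => by rw [funext hF])) }
  have hfin : ∀ φ ∈ S, ∀ τ : Var ℵ₀ → (skLang S).Term I, ∃ F₀ : Finset I,
      ∀ x ∈ φ.freeVars, (τ x).varFinset ⊆ F₀ := by
    intro φ hφ τ
    have h1 : φ.freeVars.Finite :=
      InfFormula.finite_freeVars_of_mem_subf hφ (by rw [ψ.2]; exact Set.finite_empty)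
    exact ⟨h1.toFinset.biUnion fun x => (τ x).varFinset, fun x hx =>
      Finset.subset_biUnion_of_mem (fun x => (τ x).varFinset) (h1.mem_toFinset.2 hx)⟩
  have hev : ∀ φ ∈ S, ∀ (τ : Var ℵ₀ → (skLang S).Term I) (F₀ : Finset I),
      (∀ x ∈ φ.freeVars, (τ x).varFinset ⊆ F₀) →
      ∀ᶠ F in atTop, (φ.Realize (fun x => (τ x).realize (a F)) ↔
        φ.Realize fun x => (τ x).realize (a F₀)) := fun φ hφ τ F₀ h =>
    (eventually_ge_atTop F₀).mono fun F hF => hcoh F₀ F hF φ hφ τ h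
  have main : ∀ φ ∈ S, ∀ τ : Var ℵ₀ → (skLang S).Term I,
      φ.Realize (fun x => (⟦τ x⟧ : Quotient s)) ↔
        ∀ᶠ F in atTop, φ.Realize fun x => (τ x).realize (a F) := by
    intro φ
    induction φ with
    | equal t₁ t₂ =>
      intro _ τ
      simp only [InfFormula.Realize, FirstOrder.Language.Term.realize_quotient_mk']
      refine Quotient.eq.trans (eventually_congr (.of_forall fun F => ?_))
      rw [realize_realize, realize_realize]
    | rel R ts =>
      intro _ τ
      simp only [InfFormula.Realize, FirstOrder.Language.Term.realize_quotient_mk']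
      refine (FirstOrder.Language.relMap_quotient_mk' s R _).trans
        (eventually_congr (.of_forall fun F => ?_))
      simp only [realize_realize]
    | neg φ ih =>
      intro hφ τ
      have hφ' : φ ∈ S := InfFormula.subf_subset hφ (Or.inr φ.self_mem_subf)
      obtain ⟨F₀, h0⟩ := hfin φ hφ' τ
      have h1 := hev φ hφ' τ F₀ h0
      have h2 : ∀ᶠ F in atTop, (¬ φ.Realize (fun x => (τ x).realize (a F)) ↔
        ¬ φ.Realize fun x => (τ x).realize (a F₀)) := h1.mono fun F => not_congr
      refine (not_congr ((ih hφ' τ).trans ((eventually_congr h1).trans eventually_const))).trans ?_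
      exact ((eventually_congr h2).trans eventually_const).symm
    | conj γ φ ih =>
      intro hφ τ
      have hφ' : ∀ i, φ i ∈ S := fun i => InfFormula.subf_subset hφ
        (Or.inr (Set.mem_iUnion.2 ⟨i, (φ i).self_mem_subf⟩))
      obtain ⟨F₀, h0⟩ := hfin _ hφ τ
      refine Iff.trans ?_ ((eventually_congr (hev _ hφ τ F₀ h0)).trans eventually_const).symm
      refine forall_congr' fun i => (ih i (hφ' i) τ).trans ((eventually_congr
        (hev _ (hφ' i) τ F₀ fun x hx => h0 x (Set.mem_iUnion.2 ⟨i, hx⟩))).trans eventually_const)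
    | ex s' hs φ ih =>
      intro hφ τ
      have hφ' : φ ∈ S := InfFormula.subf_subset hφ (Or.inr φ.self_mem_subf)
      constructor
      · rintro ⟨w, hw, h⟩
        let σ : Var ℵ₀ → (skLang S).Term I := fun x => if x ∈ s' then (w x).out else τ x
        have hσ : (fun x => (⟦σ x⟧ : Quotient s)) = w := by
          funext x
          by_cases hx : x ∈ s'
          · simp only [σ, if_pos hx, Quotient.out_eq]
          · simp only [σ, if_neg hx]; exact (hw x hx).symm
        rw [← hσ] at h
        refine ((ih hφ' σ).1 h).mono fun F hF => ⟨_, fun x hx => ?_, hF⟩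
        simp only [σ, if_neg hx]
      · intro h
        -- the free variables of the formula are the arguments of the Skolem functions
        have h1 : (InfFormula.ex s' hs φ).freeVars.Finite :=
          InfFormula.finite_freeVars_of_mem_subf hφ (by rw [ψ.2]; exact Set.finite_empty)
        obtain ⟨n, e, he⟩ := h1.fin_param
        let σ : Var ℵ₀ → (skLang S).Term I := fun x => if x ∈ s' then
          .func (Sum.inr (⟨_, hφ⟩, e, x)) fun i => τ (e i) else τ x
        refine ⟨fun x => ⟦σ x⟧, fun x hx => by simp only [σ, if_neg hx],
          (ih hφ' σ).2 (h.mono fun F hF => ?_)⟩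
        set v : Var ℵ₀ → M F := fun x => (τ x).realize (a F)
        set v' := assign (Classical.arbitrary (M F)) e fun i => v (e i)
        have hv : ∀ x ∈ (InfFormula.ex s' hs φ).freeVars, v' x = v x := fun x hx =>
          assign_comp _ e v (he.2.symm ▸ hx)
        obtain ⟨h2, h3⟩ := InfFormula.witness_spec
          ((InfFormula.realize_congr _ hv).2 hF : (InfFormula.ex s' hs φ).Realize v')
        refine (InfFormula.realize_congr _ fun x hx => ?_).1 h3
        by_cases hxs : x ∈ s'
        · simp only [σ, if_pos hxs]
          rfl
        · simp only [σ, if_neg hxs]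
          exact (h2 x hxs).trans (hv x ⟨hx, hxs⟩)
  refine ⟨#(Quotient s), ⟨Quotient s, inferInstance, ⟨⟨⟦.var (Classical.arbitrary I)⟧⟩,
    fun v => ?_⟩, rfl⟩, mk_le_of_injective (f := fun i => (⟦.var i⟧ : Quotient s))
      fun i j hij => ?_⟩
  · have := (main ψ.1 ψ.1.self_mem_subf fun x => (v x).out).2 (.of_forall fun F => (hM F).2 _)
    simpa using this
  · have h1 : ∀ᶠ F in atTop, a F i = a F j := Quotient.eq.1 hij
    obtain ⟨F, hF, hle⟩ := (h1.and (eventually_ge_atTop {i, j})).exists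
    exact ha F (hle (by simp)) (hle (by simp)) hF

/-- A finite linear order embeds into every infinite set of elements of a linear order. -/
theorem exists_strictMonoOn {I M : Type u} [LinearOrder I] [LinearOrder M] [Nonempty M]
    {X : Set M} (hX : X.Infinite) (F : Finset I) :
    ∃ a : I → M, StrictMonoOn a F ∧ ∀ i ∈ F, a i ∈ X := by
  classical
  obtain ⟨G, hGX, hG⟩ := hX.exists_subset_card_eq F.card
  refine ⟨fun i => if h : i ∈ F then G.orderEmbOfFin hG ((F.orderIsoOfFin rfl).symm ⟨i, h⟩) else
    Classical.arbitrary M, fun i hi j hj hij => ?_, fun i hi => ?_⟩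
  · have hi' : i ∈ F := hi
    have hj' : j ∈ F := hj
    simp only [dif_pos hi', dif_pos hj']
    simpa using hij
  · simp only [dif_pos hi]
    exact hGX (Finset.orderEmbOfFin_mem _ _ _)

/-- Indiscernible sequences of every order type generate models of every cardinality. -/
theorem not_bddAbove_of_homogeneous {δ : Ordinal.{u}} (hδ : 0 < δ)
    {p : ∀ k, Set (EMStatement ψ.1.subf k)} (h : ∀ n, Homogeneous ψ δ p n) :
    ¬ BddAbove (spec ψ) := by
  rintro ⟨χ, hχ⟩
  let I := (max 1 (Order.succ χ)).ord.ToType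
  have hI : #I = max 1 (Order.succ χ) := by simp [I]
  have hne : Nonempty I := mk_ne_zero_iff.1 (by
    rw [hI]; exact (one_pos.trans_le (le_max_left _ _)).ne')
  choose M iM oM nM X hM hX hk using fun F : Finset I => h (F.card + 1) 0 hδ
  have hinf : ∀ F, (X F).Infinite := fun F => by
    have := hX F
    rw [beth_zero] at this
    exact Set.infinite_coe_iff.1 (infinite_iff.2 this.le)
  choose a ha haX using fun F : Finset I => exists_strictMonoOn (hinf F) F
  have htype : ∀ F₀ F : Finset I, F₀ ⊆ F →
      emType ψ.1.subf (fun i => a F (F₀.orderEmbOfFin rfl i)) = p F₀.card := fun F₀ F hF =>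
    hk F _ (Nat.lt_succ_of_le (Finset.card_le_card hF)) _
      (fun i j hij => ha F (hF (Finset.orderEmbOfFin_mem _ _ _))
        (hF (Finset.orderEmbOfFin_mem _ _ _)) ((F₀.orderEmbOfFin rfl).strictMono hij))
      fun i => haX F _ (hF (Finset.orderEmbOfFin_mem _ _ _))
  obtain ⟨χ', h1, h2⟩ := exists_model_of_coherent M hM a (fun F => (ha F).injOn)
    fun F₀ F hF φ hφ τ hτ => by
      rw [realize_iff_mem_emType _ hφ τ hτ, realize_iff_mem_emType _ hφ τ hτ, htype F₀ F hF,
        htype F₀ F₀ subset_rfl]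
  rw [hI] at h2
  exact ((Order.lt_succ χ).trans_le ((le_max_right _ _).trans h2)).not_ge (hχ h1)

end Indiscernibles

/-- **Morley's theorem.** A bounded spectrum is bounded by `ℶ_β` for some `β < (2 ^ λ)⁺`. -/
theorem exists_spec_lt_beth {lam : Cardinal.{u}} (hlam : ℵ₀ ≤ lam)
    {L : FirstOrder.Language.{u, u}} (hL : L.card ≤ lam) (ψ : InfSentence (Order.succ lam) ℵ₀ L)
    (hψ : BddAbove (spec ψ)) :
    ∃ β < ord (Order.succ ((2 : Cardinal.{u}) ^ lam)), ∀ χ ∈ spec ψ, χ < beth β := by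
  by_contra hn
  push Not at hn
  obtain ⟨p, hp⟩ := exists_homogeneous hlam hL (InfFormula.mk_subf_le hlam ψ.1) hn
  refine not_bddAbove_of_homogeneous ?_ hp hψ
  rw [pos_iff_ne_zero, Ne, ord_eq_zero]
  exact (Order.bot_lt_succ _).ne'

/-- Up to the names of the symbols there are at most `2 ^ λ` sentences, and `(2 ^ λ)⁺` is regular.
-/
theorem hanfInf_lt_beth {lam : Cardinal.{u}} (hlam : ℵ₀ ≤ lam) :
    hanfInf (Order.succ lam) ℵ₀ < beth (ord (Order.succ (2 ^ lam))) := by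
  have h2 : ℵ₀ ≤ (2 : Cardinal.{u}) ^ lam := hlam.trans (cantor lam).le
  let J := InfSentence (Order.succ lam) ℵ₀ (univLang lam.out)
  have hcard : (univLang lam.out).card ≤ lam := by
    rw [card_univLang (by simpa using hlam), mk_out]
  have hJ : #J ≤ 2 ^ lam := (mk_subtype_le _).trans
    (mk_infFormula_le hlam (hlam.trans (Order.le_succ _)) (hcard.trans (cantor lam).le))
  have hreg : (Order.succ ((2 : Cardinal.{u}) ^ lam)).IsRegular := isRegular_succ h2
  have hex : ∀ ψ : J, ∃ β < ord (Order.succ ((2 : Cardinal.{u}) ^ lam)),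
      BddAbove (spec ψ) → ∀ χ ∈ spec ψ, χ < beth β := fun ψ => by
    by_cases h : BddAbove (spec ψ)
    · obtain ⟨β, hβ, h'⟩ := exists_spec_lt_beth hlam hcard ψ h
      exact ⟨β, hβ, fun _ => h'⟩
    · exact ⟨0, hreg.ord_pos, fun h' => absurd h' h⟩
  choose β hβ hspec using hex
  have hsup : iSup β < ord (Order.succ ((2 : Cardinal.{u}) ^ lam)) :=
    Ordinal.iSup_lt_of_lt_cof (by rw [hreg.cof_ord]; exact Order.lt_succ_of_le hJ) hβ
  refine lt_of_le_of_lt (hanf_le ?_) (beth_strictMono hsup)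
  rintro _ ⟨L, ψ, rfl⟩ ⟨χ, hχ, hle⟩ hb
  obtain ⟨L₀, ψ₀, hL₀, h0⟩ := exists_small_vocabulary hlam ψ
  obtain ⟨σ, hσ⟩ := exists_lhom_univLang (X := lam.out) (by simpa using hL₀)
  rw [← h0, ← spec_mapL hσ] at hχ hb
  have h1 := hspec (ψ₀.mapL σ) hb χ hχ
  exact (h1.trans_le (beth_strictMono.monotone (Ordinal.le_iSup β _))).not_ge hle

end HanfBA

theorem mainTheorem8 (lam κ : Cardinal.{u}) (hlam : ℵ₀ ≤ lam) (hκ : κ.IsRegular)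
    (hκlam : κ ≤ Order.succ lam) (B : Type u) [BooleanAlgebra B] (hB : #B ≤ lam) :
    -- the Hanf numbers exist
    (HanfBA.IsHanfBound (HanfBA.infSpectra (Order.succ lam) κ)
        (HanfBA.hanfInf (Order.succ lam) κ) ∧
      HanfBA.IsHanfBound (HanfBA.infSpectra (Order.succ (2 ^ lam)) κ)
        (HanfBA.hanfInf (Order.succ (2 ^ lam)) κ) ∧
      HanfBA.IsHanfBound (HanfBA.baSpectra2 lam κ B) (HanfBA.hanfB lam κ B) ∧
      HanfBA.IsHanfBound (HanfBA.allBASpectra lam κ) (HanfBA.hanfBa lam κ)) ∧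
    -- `Mod¹` and `Mod²` give the same Hanf number
    HanfBA.hanf (HanfBA.baSpectra1 lam κ B) = HanfBA.hanfB lam κ B ∧
    -- the chain of Hanf numbers
    (HanfBA.hanfInf (Order.succ lam) κ ≤ HanfBA.hanfB lam κ B ∧
      HanfBA.hanfB lam κ B ≤ HanfBA.hanfB lam κ (HanfBA.FreeBA lam) ∧
      HanfBA.hanfB lam κ (HanfBA.FreeBA lam) = HanfBA.hanfBa lam κ ∧
      HanfBA.hanfBa lam κ < HanfBA.hanfInf (Order.succ (2 ^ lam)) κ) ∧
    -- the case `κ = ℵ₀`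
    (κ = ℵ₀ →
      HanfBA.hanfInf (Order.succ lam) κ < Cardinal.beth (Cardinal.ord (Order.succ (2 ^ lam))) ∧
      Cardinal.beth (Cardinal.ord (Order.succ (2 ^ lam))) < HanfBA.hanfB lam κ (HanfBA.FreeBA lam)) ∧
    -- strong limits
    ((∀ μ < HanfBA.hanfB lam κ B, 2 ^ μ < HanfBA.hanfB lam κ B) ∧
      (HanfBA.hanfB lam κ B).IsStrongLimit) ∧
    ((∀ μ < HanfBA.hanfBa lam κ, 2 ^ μ < HanfBA.hanfBa lam κ) ∧
      (HanfBA.hanfBa lam κ).IsStrongLimit) ∧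
    -- the supremum of a bounded spectrum is below the Hanf number
    (∀ ψ : HanfBA.BASentence lam κ B, BddAbove (HanfBA.spec2 ψ) →
      sSup (HanfBA.spec2 ψ) < HanfBA.hanfB lam κ B) ∧
    (∀ (B' : Type u) [BooleanAlgebra B'], #B' ≤ lam → ∀ ψ : HanfBA.BASentence lam κ B',
      BddAbove (HanfBA.spec2 ψ) → sSup (HanfBA.spec2 ψ) < HanfBA.hanfBa lam κ) ∧
    -- manipulation of spectra
    (∀ ψ₁ : HanfBA.BASentence lam κ B, ∃ ψ₂ ψ₂' ψ₂'' : HanfBA.BASentence lam κ B,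
      HanfBA.spec1 ψ₂ = {μ | μ = μ ^< κ ∧ μ ∈ HanfBA.spec1 ψ₁} ∧
      HanfBA.spec1 ψ₂' = {ν | ∃ μ ∈ HanfBA.spec1 ψ₁, ν = μ ^< κ} ∧
      HanfBA.spec1 ψ₂'' = {μ | lam ≤ μ ∧ μ ∈ HanfBA.spec1 ψ₁}) := by
  have hκ0 := hκ.aleph0_le
  have h2 : lam ≤ 2 ^ lam := (cantor lam).le
  have hF := HanfBA.mk_freeBA_le hlam
  have hbB := HanfBA.exists_isHanfBound_baSpectra1 (κ := κ) hlam B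
  have hbF := HanfBA.exists_isHanfBound_baSpectra1 (κ := κ) hlam (HanfBA.FreeBA lam)
  have heB := HanfBA.hanf_baSpectra1 hlam hκ hκlam hB
  have heF := HanfBA.hanf_baSpectra1 hlam hκ hκlam hF
  have hFa := HanfBA.hanfB_freeBA hlam hκ hκlam
  have hbig := HanfBA.exists_isHanfBound_infSpectra (hlam.trans h2) hκ0
    (hκlam.trans (Order.succ_le_succ h2))
  obtain ⟨π, hπ⟩ := HanfBA.exists_surjective_freeBA hB
  refine ⟨⟨HanfBA.isHanfBound_hanf
      (HanfBA.exists_isHanfBound_infSpectra hlam hκ0 hκlam).choose_spec,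
    HanfBA.isHanfBound_hanf hbig.choose_spec,
    HanfBA.isHanfBound_hanf ((HanfBA.Dominated.of_subset
      (HanfBA.baSpectra2_subset hlam hκ0 hκlam hB)).isHanfBound
      hbB.choose_spec),
    HanfBA.isHanfBound_hanf (HanfBA.exists_isHanfBound_allBASpectra hlam hκ0 hκlam).choose_spec⟩,
    heB, ⟨?_, ?_, hFa, ?_⟩, ?_, ?_, ?_, ?_, ?_, ?_⟩
  · rw [← heB]
    exact (HanfBA.dominated_infSpectra hlam hκ0 hκlam).hanf_le_hanf hbB
  · rw [← heB, ← heF]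
    exact (HanfBA.dominated_baSpectra1_of_surjective hlam hκ0 hκlam hF hπ).hanf_le_hanf hbF
  · rw [← hFa, ← heF]
    obtain ⟨S, hS, hb, χ, hχ, hle⟩ := HanfBA.exists_infSpectra_hanf_le hlam hκ0 hκlam hF
    exact hle.trans_lt (HanfBA.lt_hanf hbig hS hb hχ)
  · rintro rfl
    rw [← heF]
    exact ⟨HanfBA.hanfInf_lt_beth hlam, HanfBA.beth_lt_hanf hlam⟩
  · rw [← heB]
    exact ⟨fun μ hμ => HanfBA.two_power_lt_hanf hlam hκ0 hκlam hB hμ,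
      HanfBA.isStrongLimit_hanf hlam hκ0 hκlam hB⟩
  · rw [← hFa, ← heF]
    exact ⟨fun μ hμ => HanfBA.two_power_lt_hanf hlam hκ0 hκlam hF hμ,
      HanfBA.isStrongLimit_hanf hlam hκ0 hκlam hF⟩
  · intro ψ hb
    rw [← heB]
    exact HanfBA.sSup_lt_hanf hlam hκ0 hκlam hB
      (HanfBA.baSpectra2_subset hlam hκ0 hκlam hB ⟨ψ, rfl⟩) hb
  · intro B' _ hB' ψ hb
    obtain ⟨π, hπ⟩ := HanfBA.exists_surjective_freeBA hB'
    rw [← hFa, ← heF]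
    exact (HanfBA.sSup_lt_hanf hlam hκ0 hκlam hB'
      (HanfBA.baSpectra2_subset hlam hκ0 hκlam hB' ⟨ψ, rfl⟩)
      hb).trans_le (((HanfBA.dominated_baSpectra1_of_surjective hlam hκ0 hκlam hF hπ)).hanf_le_hanf
        hbF)
  · intro ψ₁
    obtain ⟨ψ₂, h₂⟩ := HanfBA.exists_spec1_eq_closed hlam hκ0 hκlam hB ψ₁
    obtain ⟨ψ₂', h₂'⟩ := HanfBA.exists_spec1_eq_powerlt hlam hκ hκlam hB ψ₁
    obtain ⟨ψ₂'', h₂''⟩ := HanfBA.exists_spec1_eq_ge hlam hκ0 hκlam hB ψ₁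
    exact ⟨ψ₂, ψ₂', ψ₂'', h₂, h₂', h₂''⟩
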